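/- Let $K/\mathbb{Q}_p$ be a finite extension with ring of integers $\mathcal{O}_K$, uniformizer $\pi$ and residue field $k$, and put $g=[K:\mathbb{Q}_p]$. Let $\mathfrak{S}=W(k)[\![u]\!]$ with the Frobenius $\varphi$ that extends the Frobenius of $W(k)$ by $\varphi(u)=u^p$, and let $E=E(u)$ be the minimal polynomial of $\pi$ over $W(k)[1/p]$. A \emph{Kisin module} is a finitely generated $u$-torsion free $\mathfrak{S}$-module $\mathfrak{M}$ with an isomorphism $\phi_{\mathfrak{M}}:\varphi^*(\mathfrak{M})[1/E]\cong\mathfrak{M}[1/E]$; morphisms are the $\mathfrak{S}$-linear maps that commute with the $\phi$'s. It is \emph{flat} if $\mathfrak{M}$ is flat over $\mathfrak{S}$. A \emph{strict subobject} is a sub-Kisin module with $u$-torsion free cokernel. An \emph{isogeny} of flat Kisin modules is a morphism whose kernel and cokernel are $p$-power torsion and $u$-torsion free; $\mathfrak{M}$ and $\mathfrak{N}$ are \emph{isogenous} if there is an isogeny $\mathfrak{M}\to\mathfrak{N}$. For $r\ge 0$ the Tate twist $\mathfrak{M}(r)$ is $\mathfrak{M}$ with structure map multiplied by $(c_0^{-1}E)^r$,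 where $c_0=E(0)/p\in W(k)^\times$; it is \emph{effective} if $\phi_{\mathfrak{M}(r)}$ maps $\varphi^*\mathfrak{M}$ into $\mathfrak{M}$, which holds for all large $r$. For a $p$-power torsion Kisin module let $\mathrm{rk}(\mathfrak{M})$ be the length of $\mathfrak{M}\otimes_{\mathfrak{S}}\mathcal{O}_{\mathcal{E}}$ over $\mathcal{O}_{\mathcal{E}}$, the $p$-adic completion of $\mathfrak{S}[1/u]$; let $\deg(\mathfrak{M})=\frac1g\,\ell_{\mathbb{Z}_p}(\mathrm{coker}\,\phi_{\mathfrak{M}(r)})-r\,\mathrm{rk}(\mathfrak{M})$ for any $r\ge0$ such that $\mathfrak{M}(r)$ is effective, and $\mu(\mathfrak{M})=\deg(\mathfrak{M})/\mathrm{rk}(\mathfrak{M})$. Such an $\mathfrak{M}$ is \emph{semi-stable} if $\mu(\mathfrak{M}')\ge\mu(\mathfrak{M})$ for all non-zero strict subobjects $\mathfrak{M}'\subset\mathfrak{M}$. A flat Kisin module $\mathfrak{M}$ is \emph{semi-stable} if $\mathfrak{M}/p\mathfrak{M}$ is semi-stable. For a flat Kisin module let $\mathrm{rk}_{\mathfrak{S}}(\mathfrak{M})=\dim_{\mathcal{E}}(\mathfrak{M}\otimes_{\mathfrak{S}}\mathcal{E})$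 with $\mathcal{E}=\mathcal{O}_{\mathcal{E}}[1/p]$, let $\deg_{\mathfrak{S}}(\mathfrak{M})=d-r\,\mathrm{rk}_{\mathfrak{S}}(\mathfrak{M})$, where $\mathfrak{M}(r)$ is effective and the characteristic ideal of $\mathrm{coker}\,\phi_{\mathfrak{M}(r)}$ is $(E^d)$, and let $\mu_{\mathfrak{S}}=\deg_{\mathfrak{S}}/\mathrm{rk}_{\mathfrak{S}}$. A flat Kisin module $\mathfrak{M}$ is of \emph{type HN} if there is a filtration $0=\mathfrak{M}_0\subsetneq\mathfrak{M}_1\subsetneq\dots\subsetneq\mathfrak{M}_r=\mathfrak{M}$ (with $r\ge 0$) by strict subobjects such that each $\mathfrak{M}_i/\mathfrak{M}_{i-1}$ is a semi-stable flat Kisin module and $$\mu_{\mathfrak{S}}(\mathfrak{M}_1/\mathfrak{M}_0)<\mu_{\mathfrak{S}}(\mathfrak{M}_2/\mathfrak{M}_1)<\dots<\mu_{\mathfrak{S}}(\mathfrak{M}_r/\mathfrak{M}_{r-1}).$$ \textbf{Theorem.} Every flat Kisin module is isogenous to a flat Kisin module of type HN. -/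

import Mathlib

open scoped TensorProduct Pointwise PowerSeries

noncomputable section

namespace Kisin

universe u v w

/-! ### The coefficient rings -/

section Rings

variable (p : ℕ) [Fact p.Prime] (k : Type u) [Field k] [CharP k p]

/-- The ring `𝔖 = W(k)⟦u⟧`; the variable `u` is `PowerSeries.X`. -/
abbrev S : Type u := (WittVector p k)⟦X⟧

/-- The Frobenius `φ` of `𝔖`: the Witt vector Frobenius on coefficients, and `φ(u) = u ^ p`. -/
def frob : S p k →+* S p k :=
  (PowerSeries.expand (R := WittVector p k) p (Fact.out : p.Prime).ne_zero).toRingHom.comp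
    (PowerSeries.map (WittVector.frobenius (p := p) (R := k)))

/-- The structure map `ℤ_p = W(𝔽_p) → W(k) → 𝔖`. -/
def padicToS : ℤ_[p] →+* S p k :=
  (PowerSeries.C (R := WittVector p k)).comp
    ((WittVector.map (ZMod.castHom (dvd_refl p) k)).comp
      (WittVector.equiv p).symm.toRingHom)

/-- The length over `ℤ_p` of an `𝔖`-module. -/
def lengthZp (T : Type v) [AddCommGroup T] [Module (S p k) T] : ℕ∞ :=
  letI : Module ℤ_[p] T := Module.compHom T (padicToS p k)
  Module.length ℤ_[p] T

/-- `𝒪_ℰ`, the `p`-adic completion of `𝔖[1/u]`. -/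
abbrev OE : Type u :=
  AdicCompletion (Ideal.span {(p : Localization.Away (PowerSeries.X : S p k))})
    (Localization.Away (PowerSeries.X : S p k))

/-- `ℰ = 𝒪_ℰ[1/p]`. -/
abbrev EE : Type u := Localization.Away (p : OE p k)

end Rings

/-- The minimal polynomial `E(u)` of `π` over `W(k)` with respect to the coefficient map `ι`, as an
element of `𝔖`. As `W(k)` is integrally closed, this is also the minimal polynomial of `π` over
`W(k)[1/p]`. -/
def uniformizerPoly (p : ℕ) [Fact p.Prime] (k : Type u) [Field k] [CharP k p]
    {A : Type v} [CommRing A] (ι : WittVector p k →+* A) (π : A) : S p k :=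
  letI : Algebra (WittVector p k) A := ι.toAlgebra
  ((minpoly (WittVector p k) π : Polynomial (WittVector p k)) : S p k)

/-- The characteristic ideal of a finitely generated torsion module `T` over a Noetherian integrally
closed domain `R`: the product, over the primes `𝔭` of height one, of `𝔭 ^ length (T_𝔭)`.
For `R = 𝔖` and `T` pseudo-isomorphic to `⨁ R/(f i ^ h i)` with prime elements `f i`, it is
generated by `∏ f i ^ h i`: finite modules vanish after localization at a prime of height one, and
the localization of `⨁ R/(f i ^ h i)` at `𝔭` has length the sum of the `h i` with `(f i) = 𝔭`. -/
def charIdeal (R : Type u) [CommRing R] (T : Type v) [AddCommGroup T] [Module R T] : Ideal R :=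
  ∏ᶠ 𝔭 : {𝔭 : PrimeSpectrum R // 𝔭.asIdeal.height = 1},
    𝔭.1.asIdeal ^
      (Module.length (Localization.AtPrime 𝔭.1.asIdeal)
        (LocalizedModule 𝔭.1.asIdeal.primeCompl T)).toNat

/-! ### Frobenius pullback -/

section Pullback

variable {R : Type u} [CommRing R] (φ : R →+* R)

/-- The ring `R`, seen as an `R`-algebra through `φ`. -/
def Twisted (_φ : R →+* R) : Type u := R

instance : CommRing (Twisted φ) := inferInstanceAs (CommRing R)

instance : Algebra R (Twisted φ) := RingHom.toAlgebra (S := Twisted φ) φ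

/-- `φ^* M = R ⊗_{φ, R} M`. -/
def Pullback (M : Type v) [AddCommGroup M] [Module R M] : Type (max u v) :=
  Twisted φ ⊗[R] M

variable (M : Type v) [AddCommGroup M] [Module R M]

instance : AddCommGroup (Pullback φ M) := inferInstanceAs (AddCommGroup (Twisted φ ⊗[R] M))

/-- `R` acts on `φ^* M` through the left factor: `a • (b ⊗ m) = (a * b) ⊗ m`. -/
instance : Module R (Pullback φ M) :=
  inferInstanceAs (Module (Twisted φ) (Twisted φ ⊗[R] M))

variable {M} {N : Type w} [AddCommGroup N] [Module R N]

/-- The element `a ⊗ m` of `φ^* M`. -/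
def Pullback.tmul (a : R) (m : M) : Pullback φ M := (show Twisted φ from a) ⊗ₜ[R] m

/-- `φ^* f : φ^* M → φ^* N`, `a ⊗ m ↦ a ⊗ f m`. -/
def Pullback.map (f : M →ₗ[R] N) : Pullback φ M →ₗ[R] Pullback φ N :=
  show Twisted φ ⊗[R] M →ₗ[Twisted φ] Twisted φ ⊗[R] N from f.baseChange (Twisted φ)

theorem Pullback.smul_tmul (a b : R) (m : M) :
    a • Pullback.tmul φ b m = Pullback.tmul φ (a * b) m := rfl

theorem Pullback.tmul_smul (a b : R) (m : M) :
    Pullback.tmul φ b (a • m) = Pullback.tmul φ (φ a * b) m :=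
  (TensorProduct.smul_tmul (R := R) a (show Twisted φ from b) m).symm

theorem Pullback.map_tmul (f : M →ₗ[R] N) (a : R) (m : M) :
    Pullback.map φ f (Pullback.tmul φ a m) = Pullback.tmul φ a (f m) := rfl

end Pullback

/-- `M[1/E]`. -/
abbrev Away {R : Type u} [CommRing R] (E : R) (M : Type v) [AddCommGroup M] [Module R M] :
    Type (max u v) :=
  LocalizedModule (Submonoid.powers E) M

/-- `f[1/E] : M[1/E] → N[1/E]`. -/
def Away.map {R : Type u} [CommRing R] (E : R) {M : Type v} [AddCommGroup M] [Module R M]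
    {N : Type w} [AddCommGroup N] [Module R N] (f : M →ₗ[R] N) : Away E M →ₗ[R] Away E N :=
  IsLocalizedModule.map (Submonoid.powers E)
    (LocalizedModule.mkLinearMap (Submonoid.powers E) M)
    (LocalizedModule.mkLinearMap (Submonoid.powers E) N) f

end Kisin

open Kisin

universe u w

/-! ### Kisin modules -/

/-- A Kisin module: a finite `u`-torsion free `𝔖`-module `𝔐` with an isomorphism
`φ^*(𝔐)[1/E] ≃ 𝔐[1/E]`. -/
structure KisinModule (p : ℕ) [Fact p.Prime] (k : Type u) [Field k] [CharP k p] (E : S p k) where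
  carrier : Type w
  [addCommGroup : AddCommGroup carrier]
  [module : Module (S p k) carrier]
  [finite : Module.Finite (S p k) carrier]
  u_torsion_free : ∀ m : carrier, (PowerSeries.X : S p k) • m = 0 → m = 0
  phi : Away E (Pullback (frob p k) carrier) ≃ₗ[S p k] Away E carrier

namespace KisinModule

attribute [instance] addCommGroup module finite

variable {p : ℕ} [Fact p.Prime] {k : Type u} [Field k] [CharP k p] {E : S p k}

instance : CoeSort (KisinModule.{u, w} p k E) (Type w) := ⟨carrier⟩

/-- A morphism of Kisin modules: an `𝔖`-linear map commuting with the structure maps. -/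
structure Hom (M N : KisinModule.{u, w} p k E) where
  lin : M →ₗ[S p k] N
  comm : ∀ x, N.phi (Away.map E (Pullback.map (frob p k) lin) x) = Away.map E lin (M.phi x)

variable (M : KisinModule.{u, w} p k E)

/-- Flat Kisin modules. -/
def IsFlat : Prop := Module.Flat (S p k) M

/-- A morphism that exhibits its source as a strict subobject of its target: it is injective with
`u`-torsion free cokernel. (The cokernel then carries a unique structure of Kisin module for which
the projection is a morphism.) -/
def Hom.IsStrictMono {M N : KisinModule.{u, w} p k E} (f : Hom M N) : Prop :=
  Function.Injective f.lin ∧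
    ∀ y : N, (PowerSeries.X : S p k) • y ∈ LinearMap.range f.lin → y ∈ LinearMap.range f.lin

/-- An isogeny: a morphism whose kernel and cokernel are `p`-power torsion Kisin modules, that is,
are `p`-power torsion and `u`-torsion free (for the kernel the latter is automatic). It is used
between flat Kisin modules. -/
def Hom.IsIsogeny {M N : KisinModule.{u, w} p k E} (f : Hom M N) : Prop :=
  (∃ n : ℕ, ∀ x ∈ LinearMap.ker f.lin, (p : S p k) ^ n • x = 0) ∧
  (∃ n : ℕ, ∀ y : N, (p : S p k) ^ n • y ∈ LinearMap.range f.lin) ∧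
    ∀ y : N, (PowerSeries.X : S p k) • y ∈ LinearMap.range f.lin → y ∈ LinearMap.range f.lin

/-- `M` and `N` are isogenous. -/
def Isogenous (M N : KisinModule.{u, w} p k E) : Prop := ∃ f : Hom M N, f.IsIsogeny

/-! ### The cokernel of Frobenius -/

/-- The image of `𝔐` in `𝔐[1/E]`. (The map `𝔐 → 𝔐[1/E]` is injective when `𝔐` is flat or `p`-power
torsion, which are the only cases in which degrees are considered.) -/
def lattice : Submodule (S p k) (Away E M) :=
  LinearMap.range (LocalizedModule.mkLinearMap (Submonoid.powers E) M)

/-- `φ_𝔐(φ^* 𝔐)` inside `𝔐[1/E]`. -/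
def frobLattice : Submodule (S p k) (Away E M) :=
  (LinearMap.range (LocalizedModule.mkLinearMap (Submonoid.powers E)
    (Pullback (frob p k) M))).map M.phi.toLinearMap

/-- The Tate twist `𝔐(r)` is effective. Up to a unit of `W(k)`, the structure map of `𝔐(r)` is
`E ^ r` times that of `𝔐`, so the image of its Frobenius is `E ^ r • φ_𝔐(φ^* 𝔐)`. -/
def TwistEffective (r : ℕ) : Prop := (E ^ r) • M.frobLattice ≤ M.lattice

/-- The least `r ≥ 0` for which `𝔐(r)` is effective. -/
def twistExponent : ℕ := sInf {r : ℕ | M.TwistEffective r}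

/-- The cokernel of the linearized Frobenius of the effective Kisin module `𝔐(r)`, where `r` is
`twistExponent`; for effective `𝔐` one has `r = 0`. -/
def TwistCoker : Type (max u w) :=
  ↥M.lattice ⧸ ((E ^ M.twistExponent) • M.frobLattice).submoduleOf M.lattice

instance : AddCommGroup M.TwistCoker :=
  inferInstanceAs (AddCommGroup
    (↥M.lattice ⧸ ((E ^ M.twistExponent) • M.frobLattice).submoduleOf M.lattice))

instance : Module (S p k) M.TwistCoker :=
  inferInstanceAs (Module (S p k)
    (↥M.lattice ⧸ ((E ^ M.twistExponent) • M.frobLattice).submoduleOf M.lattice))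

/-! ### Rank, degree and slope of torsion Kisin modules -/

/-- `rk(𝔐)`, the length of `𝔐 ⊗ 𝒪_ℰ` over `𝒪_ℰ`. -/
def torRank : ℕ := (Module.length (OE p k) (OE p k ⊗[S p k] M)).toNat

/-- `deg(𝔐) = deg(𝔐(r)) - r * rk(𝔐)`, where `deg(𝔐(r))` is `1/g` times the `ℤ_p`-length of the
cokernel of Frobenius on `𝔐(r)`; here `g = [K : ℚ_p]`. -/
def torDeg (g : ℕ) : ℚ :=
  ((lengthZp p k M.TwistCoker).toNat : ℚ) / g - M.twistExponent * M.torRank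

/-- `μ(𝔐) = deg(𝔐) / rk(𝔐)`. -/
def torSlope (g : ℕ) : ℚ := M.torDeg g / M.torRank

/-- Semi-stability of a (`p`-power torsion) Kisin module: every non-zero strict subobject has slope
at least that of the whole module. -/
def TorSemistable (g : ℕ) : Prop :=
  ∀ (N : KisinModule.{u, w} p k E) (f : Hom N M), f.IsStrictMono → Nontrivial N →
    M.torSlope g ≤ N.torSlope g

/-! ### Rank, degree and slope of flat Kisin modules -/

/-- `rk_𝔖(𝔐)`, the dimension of `𝔐 ⊗ ℰ` over `ℰ`. -/
def flatRank : ℕ := Module.finrank (EE p k) (EE p k ⊗[S p k] M)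

/-- `deg_𝔖(𝔐) = deg_𝔖(𝔐(r)) - r * rk_𝔖(𝔐)`, where `deg_𝔖(𝔐(r))` is the natural number `d` such that
the characteristic ideal of the cokernel of Frobenius on `𝔐(r)` is `(E ^ d)`. -/
def flatDeg : ℤ :=
  (sInf {d : ℕ | charIdeal (S p k) M.TwistCoker = Ideal.span {E ^ d}} : ℕ) -
    M.twistExponent * M.flatRank

/-- `μ_𝔖(𝔐) = deg_𝔖(𝔐) / rk_𝔖(𝔐)`. -/
def flatSlope : ℚ := M.flatDeg / M.flatRank

/-- `q : 𝔐 → 𝔔` exhibits the Kisin module `𝔔` as `𝔐/p`. -/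
def Hom.IsModP {M Q : KisinModule.{u, w} p k E} (q : Hom M Q) : Prop :=
  Function.Surjective q.lin ∧ ∀ x : M, q.lin x = 0 ↔ ∃ y : M, x = (p : S p k) • y

/-- Semi-stability of a flat Kisin module `𝔐`: the Kisin module `𝔐/p` is semi-stable. (For flat `𝔐`
the module `𝔐/p` is a Kisin module in a unique way such that the projection is a morphism.) -/
def FlatSemistable (g : ℕ) : Prop :=
  ∃ (Q : KisinModule.{u, w} p k E) (q : Hom M Q), q.IsModP ∧ Q.TorSemistable g

/-- A flat Kisin module `𝔐` is of type HN: there is a filtration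
`0 = 𝔐_0 ⊊ 𝔐_1 ⊊ ⋯ ⊊ 𝔐_r = 𝔐` by strict subobjects, given by `sub i : F i → 𝔐`, whose graded pieces
`G i = 𝔐_{i+1}/𝔐_i` are semi-stable flat Kisin modules with strictly increasing slopes. -/
def IsTypeHN (g : ℕ) : Prop :=
  ∃ (r : ℕ) (F : Fin (r + 1) → KisinModule.{u, w} p k E) (sub : ∀ i, Hom (F i) M)
    (G : Fin r → KisinModule.{u, w} p k E) (gr : ∀ i : Fin r, Hom (F i.succ) (G i)),
    (∀ i, (sub i).IsStrictMono) ∧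
    LinearMap.range (sub 0).lin = ⊥ ∧
    LinearMap.range (sub (Fin.last r)).lin = ⊤ ∧
    (∀ i : Fin r, LinearMap.range (sub i.castSucc).lin < LinearMap.range (sub i.succ).lin) ∧
    (∀ i : Fin r, Function.Surjective (gr i).lin ∧
      ∀ x : F i.succ, (gr i).lin x = 0 ↔
        (sub i.succ).lin x ∈ LinearMap.range (sub i.castSucc).lin) ∧
    (∀ i, (G i).IsFlat ∧ (G i).FlatSemistable g) ∧
    StrictMono fun i => (G i).flatSlope

end KisinModule

end

/-! The proof is a `p`-adic form of Langton's method. After a Tate twist the Frobenius is a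
semilinear endomorphism `f` of a free module `M`, and everything takes place among the `f`-stable
submodules of `M`: Kisin modules are subquotients `Y / Z`. For subquotients killed by `p` and
`u`-torsion free, the degree is the length of the cokernel of Frobenius, that is, the `u`-adic
valuation of the determinant of Frobenius modulo `p`. Since `E ≡ u ^ e` modulo `p` and `[K : ℚ_p] =
e [k : 𝔽_p]`, both `μ` of the reduction and `μ_𝔖` equal degree divided by `e` times rank, minus the
twist (`torSlope_eq`, `flatSlope_eq`), so all slopes can be read modulo `p`.

Let `X / B` be flat. Among the nonzero stable submodules of `X / (B + pX)` take one, `Y / (B + pX)`,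
of least slope and then of largest rank, and replace `X` by `Y`. The new reduction is an extension
of `Y / (B + pX)` by `(B + pX) / (B + pY) ≅ X / Y`: subobject and quotient have changed places, and
rank and degree are unchanged. The nonzero stable submodules of `X / Y` have slope larger than that
of `Y / (B + pX)`. Hence the least slope cannot drop; if it stays the same, the rank of the
destabilizing submodule cannot grow; and if both stay the same, the new destabilizing submodule maps
isomorphically onto the old one (`StepData.slope_le`). Slopes have bounded denominators and are
bounded above, so some lattice `X_0` maximizes the least slope, and then minimizes the rank. From
there every modification `X_0 ⊇ X_1 ⊇ ⋯` is of the split kind (`exists_isSplitSeq`).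

Put `F = ⋂ X_n`. By `p`-adic completeness the split pieces glue: `F / (B + pF) ≅ X_1 / (B + pX_0)`
(`IsSplitSeq.iInf_sup_eq`, `IsSplitSeq.iInf_inf_le`). So `F / B` is flat and semistable, `X_0 / F`
is flat, and its reduction `X_0 / X_1` has only submodules of larger slope (`exists_first_step`).
Induction on the rank (`exists_filtration`) filters a lattice that contains `p ^ a M` for some `a`,
and multiplication by `p ^ a` is the isogeny. -/

namespace KisinHN

universe u₁ u₂ u₃

/-! ### Relative lengths of submodules -/

section RelLength

variable {R : Type*} [CommRing R] {M M' : Type*} [AddCommGroup M] [Module R M]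
  [AddCommGroup M'] [Module R M']

theorem mem_submoduleOf_iff {A B : Submodule R M} {x : A} :
    x ∈ B.submoduleOf A ↔ (x : M) ∈ B := Iff.rfl

/-- The length of `A / (A ⊓ B)`. -/
noncomputable def relLength (A B : Submodule R M) : ℕ∞ :=
  Module.length R (↥A ⧸ B.submoduleOf A)

/-- The composite `A → A' → A' / B'` is onto by `hA` and has kernel `C` by `hC`. Neither injectivity
nor surjectivity of `g` is needed, so the isomorphism theorems, multiplication by `p` and the
passage to subquotients are all instances. -/
theorem relLength_eq_of_map (g : M →ₗ[R] M') {A C : Submodule R M} {A' B' : Submodule R M'}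
    (hA : A.map g ⊔ B' = A') (hC : A ⊓ B'.comap g = C) : relLength A C = relLength A' B' := by
  have hmem : ∀ x : A, g x ∈ A' := fun x =>
    hA ▸ Submodule.mem_sup_left (Submodule.mem_map_of_mem x.2)
  let h : A →ₗ[R] A' := (g.domRestrict A).codRestrict A' hmem
  let k : A →ₗ[R] (↥A' ⧸ B'.submoduleOf A') := (B'.submoduleOf A').mkQ.comp h
  have hker : LinearMap.ker k = C.submoduleOf A := by
    ext x
    simp only [k, LinearMap.mem_ker, LinearMap.comp_apply, Submodule.mkQ_apply,
      Submodule.Quotient.mk_eq_zero, mem_submoduleOf_iff, ← hC, Submodule.mem_inf,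
      Submodule.mem_comap, x.2, true_and]
    rfl
  have hsurj : Function.Surjective k := by
    intro y
    obtain ⟨⟨y, hy⟩, rfl⟩ := Submodule.Quotient.mk_surjective _ y
    obtain ⟨a, ha, b, hb, rfl⟩ := Submodule.mem_sup.1 (hA.symm ▸ hy)
    obtain ⟨x, hx, rfl⟩ := Submodule.mem_map.1 ha
    refine ⟨⟨x, hx⟩, ?_⟩
    simp only [k, LinearMap.comp_apply, Submodule.mkQ_apply]
    rw [Submodule.Quotient.eq, mem_submoduleOf_iff]
    change g x - (g x + b) ∈ B'
    simpa using hb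
  rw [relLength, relLength, ← hker]
  exact (k.quotKerEquivOfSurjective hsurj).length_eq

theorem relLength_sup_left (A B : Submodule R M) :
    relLength (A ⊔ B) B = relLength A (A ⊓ B) :=
  (relLength_eq_of_map LinearMap.id (by simp) (by simp)).symm

theorem relLength_add {A B C : Submodule R M} (hCB : C ≤ B) (hBA : B ≤ A) :
    relLength A C = relLength A B + relLength B C := by
  have h1 : C.submoduleOf B ≤ (C.submoduleOf A).comap (Submodule.inclusion hBA) := by
    intro x hx; exact hx
  have h2 : C.submoduleOf A ≤ B.submoduleOf A := fun x hx => hCB hx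
  have := Module.length_eq_add_of_exact
    (Submodule.mapQ (C.submoduleOf B) (C.submoduleOf A) (Submodule.inclusion hBA) h1)
    (Submodule.factor h2) ?_ (Submodule.factor_surjective h2) ?_
  · rw [relLength, this, add_comm]; rfl
  · rw [← LinearMap.ker_eq_bot, LinearMap.ker_eq_bot']
    intro x
    obtain ⟨x, rfl⟩ := Submodule.Quotient.mk_surjective _ x
    intro hx
    simpa [mem_submoduleOf_iff] using hx
  · intro x
    obtain ⟨x, rfl⟩ := Submodule.Quotient.mk_surjective _ x
    constructor
    · intro hx
      have hx' : (x : M) ∈ B := by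
        simpa [Submodule.factor, mem_submoduleOf_iff] using hx
      exact ⟨Submodule.Quotient.mk ⟨x, hx'⟩, by simp; rfl⟩
    · rintro ⟨y, hy⟩
      obtain ⟨y, rfl⟩ := Submodule.Quotient.mk_surjective _ y
      rw [← hy]
      simp [Submodule.factor, mem_submoduleOf_iff]

theorem relLength_eq_zero_iff {A B : Submodule R M} : relLength A B = 0 ↔ A ≤ B := by
  rw [relLength, Module.length_eq_zero_iff, Submodule.Quotient.subsingleton_iff,
    Submodule.submoduleOf_eq_top]

theorem relLength_top_eq (B : Submodule R M) : relLength ⊤ B = Module.length R (M ⧸ B) := by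
  refine LinearEquiv.length_eq ?_
  exact Submodule.Quotient.equiv _ _ Submodule.topEquiv (by
    ext x; simp [mem_submoduleOf_iff])

end RelLength

/-! ### Cokernels of matrices over a discrete valuation ring -/

section DVR

open IsDiscreteValuationRing

variable {D : Type*} [CommRing D] [IsDomain D] [IsDiscreteValuationRing D]

theorem length_quotient_span_singleton_eq_addVal {a : D} (ha : a ≠ 0) :
    Module.length D (D ⧸ Ideal.span {a}) = addVal D a := by
  obtain ⟨ϖ, hϖ⟩ := exists_irreducible D
  obtain ⟨n, v, rfl⟩ := eq_unit_mul_pow_irreducible ha hϖ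
  rw [Ideal.span_singleton_mul_left_unit v.isUnit, ← Ideal.span_singleton_pow,
    ← hϖ.maximalIdeal_eq, length_quotient_pow_maximalIdeal, addVal_def' v hϖ]

/-- By the Smith normal form the range is spanned by multiples `a i` of the members of a basis, so
the length is the sum of the valuations of the `a i`. The matrix `A` differs from this diagonal map
by an automorphism of the source, whose determinant is a unit. -/
theorem length_quotient_range_mulVecLin {n : Type*} [Fintype n] [DecidableEq n]
    (A : Matrix n n D) (hA : A.det ≠ 0) :
    Module.length D ((n → D) ⧸ LinearMap.range A.mulVecLin) = addVal D A.det := by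
  have hinj : Function.Injective A.mulVecLin := by
    rw [Matrix.coe_mulVecLin]
    exact Matrix.mulVec_injective_of_det_ne_zero hA
  set N := LinearMap.range A.mulVecLin with hN
  let e₀ : (n → D) ≃ₗ[D] N := LinearEquiv.ofInjective A.mulVecLin hinj
  have hr : Module.finrank D N = Module.finrank D (n → D) := (e₀.finrank_eq).symm
  let b : Module.Basis n D (n → D) := Pi.basisFun D n
  let a := Submodule.smithNormalFormCoeffs b hr
  let tb := Submodule.smithNormalFormTopBasis b hr
  let bb := Submodule.smithNormalFormBotBasis b hr
  let e₁ : (n → D) ≃ₗ[D] N := tb.equiv bb (Equiv.refl n)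
  have hdiag : LinearMap.det (N.subtype.comp e₁.toLinearMap) = ∏ i, a i := by
    rw [← LinearMap.det_toMatrix tb]
    have : LinearMap.toMatrix tb tb (N.subtype.comp e₁.toLinearMap) = Matrix.diagonal a := by
      ext i j
      rw [LinearMap.toMatrix_apply]
      have : (N.subtype.comp e₁.toLinearMap) (tb j) = a j • tb j := by
        simp only [LinearMap.comp_apply, e₁, LinearEquiv.coe_coe, Module.Basis.equiv_apply,
          Equiv.refl_apply, Submodule.subtype_apply]
        exact Submodule.smithNormalFormBotBasis_def b hr j
      rw [this, map_smul, Module.Basis.repr_self, Finsupp.smul_single, Finsupp.single_apply,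
        Matrix.diagonal_apply]
      by_cases h : i = j
      · subst h; simp
      · simp [h, Ne.symm h]
    rw [this, Matrix.det_diagonal]
  have hfac : A.mulVecLin =
      (N.subtype.comp e₁.toLinearMap).comp (e₀.trans e₁.symm).toLinearMap := by
    refine LinearMap.ext fun x => ?_
    simp only [LinearMap.comp_apply, LinearEquiv.coe_coe, LinearEquiv.trans_apply,
      LinearEquiv.apply_symm_apply, Submodule.subtype_apply]
    exact (LinearEquiv.ofInjective_apply A.mulVecLin x).symm
  have hdet : A.det = (∏ i, a i) * LinearMap.det (e₀.trans e₁.symm).toLinearMap := by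
    rw [← hdiag, ← LinearMap.det_comp, ← hfac, ← Matrix.toLin'_apply', LinearMap.det_toLin']
  have hunit : IsUnit (LinearMap.det (e₀.trans e₁.symm).toLinearMap) :=
    LinearEquiv.isUnit_det' _
  rw [(Submodule.quotientEquivPiSpan N b hr).length_eq, Module.length_pi_of_fintype, hdet,
    addVal_mul, addVal_eq_zero_of_unit hunit.unit |> fun h => (by simpa using h :
      addVal D (LinearMap.det (e₀.trans e₁.symm).toLinearMap) = 0), add_zero]
  rw [Finset.sum_congr rfl fun i _ => length_quotient_span_singleton_eq_addVal
    (Submodule.smithNormalFormCoeffs_ne_zero b hr i)]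
  have : ∀ s : Finset n, ∑ i ∈ s, addVal D (a i) = addVal D (∏ i ∈ s, a i) := by
    intro s
    induction s using Finset.induction_on with
    | empty => simp
    | insert i s hi ih => rw [Finset.sum_insert hi, Finset.prod_insert hi, addVal_mul, ih]
  exact this _

end DVR

end KisinHN

/-! ### The axioms on the coefficient ring, and the `u`-adic valuation modulo `p` -/

namespace KisinHN

open IsDiscreteValuationRing

/-- The ring-theoretic properties of `𝔖` with its Frobenius `φ` and the elements `p`, `u`, `E`
that the theory of slopes relies on. -/
structure FrobeniusDatum {R : Type*} [CommRing R] (φ : R →+* R) (p u E : R) (e q : ℕ)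
    [IsDomain (R ⧸ Ideal.span {p})] [IsDiscreteValuationRing (R ⧸ Ideal.span {p})] : Prop where
  prime_p : Prime p
  irreducible_u : Irreducible (Ideal.Quotient.mk (Ideal.span {p}) u)
  map_p : φ p = p
  map_u : φ u = u ^ q
  two_le : 2 ≤ q
  dvd_sub : p ∣ E - u ^ e
  e_pos : 0 < e
  prime_E : Prime E
  precomplete : IsPrecomplete (Ideal.span {p}) R

variable {R : Type*} [CommRing R] {φ : R →+* R} {p u E : R} {e q : ℕ}

theorem mk_eq_zero_iff_dvd {a : R} : Ideal.Quotient.mk (Ideal.span {p}) a = 0 ↔ p ∣ a := by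
  rw [Ideal.Quotient.eq_zero_iff_mem, Ideal.mem_span_singleton]

section Valuation

variable [IsDomain (R ⧸ Ideal.span {p})] [IsDiscreteValuationRing (R ⧸ Ideal.span {p})]

variable (p) in
/-- The `u`-adic valuation of the reduction modulo `p`. -/
noncomputable def uVal (a : R) : ℕ∞ :=
  addVal (R ⧸ Ideal.span {p}) (Ideal.Quotient.mk (Ideal.span {p}) a)

theorem uVal_mul (a b : R) : uVal p (a * b) = uVal p a + uVal p b := by
  simp [uVal]

theorem uVal_eq_top_iff {a : R} : uVal p a = ⊤ ↔ p ∣ a := by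
  rw [uVal, addVal_eq_top_iff, mk_eq_zero_iff_dvd]

theorem uVal_eq_of_dvd_sub {a b : R} (h : p ∣ a - b) : uVal p a = uVal p b := by
  rw [uVal, uVal, (Ideal.Quotient.eq).2 (Ideal.mem_span_singleton.2 h)]

theorem uVal_eq_zero_of_isUnit {a : R} (h : IsUnit a) : uVal p a = 0 :=
  addVal_eq_zero_iff.2 (h.map _)

theorem isUnit_of_uVal_eq_zero [IsLocalRing R] {a : R} (h : uVal p a = 0) :
    IsUnit a := by
  have h1 := addVal_eq_zero_iff.1 h
  have : IsLocalHom (Ideal.Quotient.mk (Ideal.span {p})) :=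
    
    .of_surjective _ Ideal.Quotient.mk_surjective
  exact isUnit_of_map_unit _ _ h1

namespace FrobeniusDatum

variable (hR : FrobeniusDatum φ p u E e q)
include hR

theorem uVal_u_pow (n : ℕ) : uVal p (u ^ n) = n := by
  rw [uVal, map_pow, hR.irreducible_u.addVal_pow]

/-- On a module killed by `p`, powers of `E` act as powers of `u`; this links the Kisin condition
(inverting `E`) with nondegeneracy modulo `p` (inverting `u`). -/
theorem dvd_E_pow_sub (h : ℕ) : p ∣ E ^ h - u ^ (e * h) := by
  rw [pow_mul]
  exact dvd_trans hR.dvd_sub (sub_dvd_pow_sub_pow _ _ _)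

/-- Modulo `p` an element is a unit times `u ^ n`, and `φ` preserves units and sends `u` to `u ^ q`.
For multiples of `p` both sides are `⊤`. -/
theorem uVal_map [IsLocalRing R] (a : R) : uVal p (φ a) = q * uVal p a := by
  have hq : q ≠ 0 := by have := hR.two_le; omega
  by_cases ha : p ∣ a
  · have : p ∣ φ a := hR.map_p ▸ map_dvd φ ha
    rw [uVal_eq_top_iff.2 ha, uVal_eq_top_iff.2 this, ENat.mul_top (by simpa using hq)]
  · obtain ⟨n, v, hv⟩ := eq_unit_mul_pow_irreducible (mt mk_eq_zero_iff_dvd.1 ha) hR.irreducible_u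
    obtain ⟨w, hw⟩ := Ideal.Quotient.mk_surjective (v : R ⧸ Ideal.span {p})
    have hw' : IsUnit w := by
      refine isUnit_of_uVal_eq_zero (p := p) ?_
      rw [uVal, hw]; exact addVal_eq_zero_iff.2 v.isUnit
    have h1 : p ∣ a - w * u ^ n := by
      rw [← mk_eq_zero_iff_dvd, map_sub, hv, map_mul, hw, map_pow, sub_self]
    have h2 : p ∣ φ a - φ w * u ^ (q * n) := by
      have := map_dvd φ h1
      rwa [hR.map_p, map_sub, map_mul, map_pow, hR.map_u, ← pow_mul] at this
    rw [uVal_eq_of_dvd_sub h1, uVal_eq_of_dvd_sub h2, uVal_mul, uVal_mul,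
      uVal_eq_zero_of_isUnit hw', uVal_eq_zero_of_isUnit (hw'.map φ), hR.uVal_u_pow, hR.uVal_u_pow]
    push_cast; ring

end FrobeniusDatum

end Valuation

/-! ### Subquotients killed by `p` -/

variable {M : Type*} [AddCommGroup M] [Module R M]

section Basis

variable (p u) in
/-- `Y / Z` is killed by `p` and `u`-torsion free. -/
structure IsPM (Y Z : Submodule R M) : Prop where
  le : Z ≤ Y
  p_mem : ∀ y ∈ Y, p • y ∈ Z
  u_tf : ∀ y ∈ Y, u • y ∈ Z → y ∈ Z

variable (p) in
/-- The family `b` gives a basis of `Y / Z` over `R / p`. -/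
structure IsPBasis (Y Z : Submodule R M) {n : ℕ} (b : Fin n → M) : Prop where
  mem : ∀ i, b i ∈ Y
  le : Y ≤ Z ⊔ Submodule.span R (Set.range b)
  dvd : ∀ c : Fin n → R, ∑ i, c i • b i ∈ Z → ∀ i, p ∣ c i

theorem IsPBasis.exists_coeff {Y Z : Submodule R M} {n : ℕ} {b : Fin n → M}
    (hb : IsPBasis p Y Z b) {y : M} (hy : y ∈ Y) :
    ∃ c : Fin n → R, y - ∑ i, c i • b i ∈ Z := by
  obtain ⟨z, hz, w, hw, rfl⟩ := Submodule.mem_sup.1 (hb.le hy)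
  obtain ⟨c, rfl⟩ := (Submodule.mem_span_range_iff_exists_fun R).1 hw
  exact ⟨c, by simpa using hz⟩

theorem IsPBasis.exists_matrix {Y Z : Submodule R M} {n m : ℕ} {b : Fin n → M}
    (hb : IsPBasis p Y Z b) {g : Fin m → M} (hg : ∀ j, g j ∈ Y) :
    ∃ A : Matrix (Fin n) (Fin m) R, ∀ j, g j - ∑ i, A i j • b i ∈ Z := by
  choose c hc using fun j => hb.exists_coeff (hg j)
  exact ⟨fun i j => c j i, hc⟩

theorem IsPM.sum_mem {Y Z : Submodule R M} (h : IsPM p u Y Z) {n : ℕ} {b : Fin n → M}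
    (hb : ∀ i, b i ∈ Y) {c : Fin n → R} (hc : ∀ i, p ∣ c i) : ∑ i, c i • b i ∈ Z := by
  refine Submodule.sum_mem _ fun i _ => ?_
  obtain ⟨d, hd⟩ := hc i
  rw [hd, mul_comm, mul_smul]
  exact Z.smul_mem _ (h.p_mem _ (hb i))

variable [IsDomain (R ⧸ Ideal.span {p})] [IsDiscreteValuationRing (R ⧸ Ideal.span {p})]

/-- A finite torsion-free module over the discrete valuation ring `R / p` is free; as nonzero
elements of `R / p` are units times powers of `u`, absence of `u`-torsion is enough. -/
theorem IsPM.exists_isPBasis (hu : Irreducible (Ideal.Quotient.mk (Ideal.span {p}) u))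
    [IsNoetherian R M] {Y Z : Submodule R M} (h : IsPM p u Y Z) :
    ∃ (n : ℕ) (b : Fin n → M), IsPBasis p Y Z b := by
  let N := ↥Y ⧸ Z.submoduleOf Y
  have hN : Module.IsTorsionBySet R N (Ideal.span {p} : Ideal R) := by
    refine (Module.isTorsionBySet_span_singleton_iff p).2 fun x => ?_
    obtain ⟨x, rfl⟩ := Submodule.Quotient.mk_surjective _ x
    rw [← Submodule.Quotient.mk_smul, Submodule.Quotient.mk_eq_zero]
    exact h.p_mem _ x.2
  let _ : Module (R ⧸ Ideal.span {p}) N := hN.module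
  have : IsScalarTower R (R ⧸ Ideal.span {p}) N := hN.isScalarTower
  have hsm : ∀ (a : R) (x : N), (Ideal.Quotient.mk (Ideal.span {p}) a) • x = a • x :=
    fun a x => rfl
  have : Module.Finite (R ⧸ Ideal.span {p}) N := Module.Finite.of_restrictScalars_finite R _ _
  have : Module.IsTorsionFree (R ⧸ Ideal.span {p}) N := by
    rw [Module.isTorsionFree_iff_smul_eq_zero]
    intro a x hax
    by_contra! hne
    obtain ⟨n, v, rfl⟩ := eq_unit_mul_pow_irreducible hne.1 hu
    rw [mul_smul] at hax
    have hax : (Ideal.Quotient.mk (Ideal.span {p}) u ^ n) • x = 0 := by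
      have := congrArg (fun y => (↑v⁻¹ : R ⧸ Ideal.span {p}) • y) hax
      simpa [smul_smul] using this
    rw [← map_pow, hsm] at hax
    have key : ∀ (n : ℕ) (x : N), u ^ n • x = 0 → x = 0 := by
      intro n
      induction n with
      | zero => intro x hx; simpa using hx
      | succ n ih =>
        intro x hx
        rw [pow_succ, mul_smul] at hx
        have hx := ih _ hx
        obtain ⟨x, rfl⟩ := Submodule.Quotient.mk_surjective _ x
        rw [← Submodule.Quotient.mk_smul, Submodule.Quotient.mk_eq_zero] at hx
        rw [Submodule.Quotient.mk_eq_zero]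
        exact h.u_tf _ x.2 hx
    exact hne.2 (key n x hax)
  let bN := Module.finBasis (R ⧸ Ideal.span {p}) N
  choose b hb using fun i => Submodule.Quotient.mk_surjective _ (bN i)
  refine ⟨_, fun i => (b i : M), fun i => (b i).2, ?_, ?_⟩
  · intro y hy
    obtain ⟨c, hc⟩ : ∃ c : Fin _ → R, ∀ i, Ideal.Quotient.mk (Ideal.span {p}) (c i) =
        bN.repr (Submodule.Quotient.mk ⟨y, hy⟩) i :=
      ⟨_, fun i => (Ideal.Quotient.mk_surjective _).choose_spec⟩
    have h1 : (Submodule.Quotient.mk ⟨y, hy⟩ : N) = Submodule.Quotient.mk (∑ i, c i • b i) := by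
      conv_lhs => rw [← bN.sum_repr (Submodule.Quotient.mk ⟨y, hy⟩)]
      rw [← Submodule.mkQ_apply (Z.submoduleOf Y) (∑ i, c i • b i), map_sum]
      refine Finset.sum_congr rfl fun i _ => ?_
      rw [← hc, hsm, ← hb, map_smul, Submodule.mkQ_apply]
    rw [Submodule.Quotient.eq, mem_submoduleOf_iff] at h1
    have h2 := Submodule.add_mem_sup h1 (Submodule.sum_mem (Submodule.span R
      (Set.range fun i => (b i : M))) fun i _ =>
        Submodule.smul_mem _ (c i) (Submodule.subset_span ⟨i, rfl⟩) : ∑ i, c i • (b i : M) ∈ _)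
    simpa using h2
  · intro c hc i
    have h1 : ∑ i, Ideal.Quotient.mk (Ideal.span {p}) (c i) • bN i = 0 := by
      have : (Submodule.Quotient.mk (∑ i, c i • b i) : N) = 0 := by
        rw [Submodule.Quotient.mk_eq_zero, mem_submoduleOf_iff]
        simpa using hc
      rw [← this, ← Submodule.mkQ_apply, map_sum]
      refine Finset.sum_congr rfl fun i _ => ?_
      rw [hsm, ← hb, map_smul, Submodule.mkQ_apply]
    exact mk_eq_zero_iff_dvd.1 (Fintype.linearIndependent_iff.1 bN.linearIndependent _ h1 i)

/-- The quotient `Y / (Z + span g)` and the cokernel of `A` modulo `p` on `(R / p) ^ n` are the same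
quotient of `R ^ n`, which reduces the claim to the determinant formula over a discrete valuation
ring. -/
theorem IsPBasis.relLength_sup_span {Y Z : Submodule R M} {n : ℕ} {b : Fin n → M}
    (hb : IsPBasis p Y Z b) (hPM : IsPM p u Y Z) {g : Fin n → M} {A : Matrix (Fin n) (Fin n) R}
    (hg : ∀ j, g j - ∑ i, A i j • b i ∈ Z) (hA : ¬ p ∣ A.det) :
    relLength Y (Z ⊔ Submodule.span R (Set.range g)) = uVal p A.det := by
  let D := R ⧸ Ideal.span {p}
  let T : (Fin n → R) →ₗ[R] M := Fintype.linearCombination R b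
  have hT : ∀ c, T c = ∑ i, c i • b i := fun c => by
    simp [T, Fintype.linearCombination_apply]
  let ρ : (Fin n → R) →ₗ[R] (Fin n → D) :=
    LinearMap.pi fun i => (Algebra.linearMap R D).comp (LinearMap.proj i)
  have hρ : ∀ c i, ρ c i = Ideal.Quotient.mk (Ideal.span {p}) (c i) := fun c i => rfl
  let Ab : Matrix (Fin n) (Fin n) D := A.map (Ideal.Quotient.mk (Ideal.span {p}))
  have hdet : Ab.det = Ideal.Quotient.mk (Ideal.span {p}) A.det :=
    (RingHom.map_det _ A).symm
  let Q : Submodule R (Fin n → D) := (LinearMap.range Ab.mulVecLin).restrictScalars R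
  have hg' : ∀ d : Fin n → R, ∑ j, d j • g j - ∑ i, (A.mulVec d) i • b i ∈ Z := by
    intro d
    have h1 : ∑ i, (A.mulVec d) i • b i = ∑ j, d j • ∑ i, A i j • b i := by
      simp only [Matrix.mulVec, dotProduct, Finset.sum_smul, Finset.smul_sum, smul_smul]
      rw [Finset.sum_comm]
      simp only [mul_comm]
    rw [h1, ← Finset.sum_sub_distrib]
    refine Submodule.sum_mem _ fun j _ => ?_
    rw [← smul_sub]
    exact Z.smul_mem _ (hg j)
  have hspan : Submodule.span R (Set.range g) ≤ Y := by
    rw [Submodule.span_le]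
    rintro _ ⟨j, rfl⟩
    have := Y.add_mem (hPM.le (hg j)) (Submodule.sum_mem Y
      fun i (_ : i ∈ Finset.univ) => Y.smul_mem (A i j) (hb.mem i))
    simpa using this
  -- Both sides say that `c` is congruent modulo `p` to `A d` for some vector `d`.
  have hC : (Z ⊔ Submodule.span R (Set.range g)).comap T = Q.comap ρ := by
    ext c
    simp only [Submodule.mem_comap, hT]
    constructor
    · intro hc
      obtain ⟨z, hz, w, hw, hzw⟩ := Submodule.mem_sup.1 hc
      obtain ⟨d, rfl⟩ := (Submodule.mem_span_range_iff_exists_fun R).1 hw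
      have h1 : ∑ i, (c i - A.mulVec d i) • b i ∈ Z := by
        have := Z.add_mem hz (hg' d)
        simp only [sub_smul, Finset.sum_sub_distrib, ← hzw]
        convert this using 1; abel
      have h2 := hb.dvd _ h1
      refine ⟨ρ d, ?_⟩
      ext i
      rw [Matrix.mulVecLin_apply, hρ, ← sub_eq_zero, ← neg_eq_zero, neg_sub]
      rw [← mk_eq_zero_iff_dvd.2 (h2 i), map_sub]
      congr 1
      simp [Matrix.mulVec, dotProduct, Ab, hρ, map_sum]
    · rintro ⟨d, hd⟩
      obtain ⟨d, rfl⟩ : ∃ d', ρ d' = d := by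
        choose d' hd' using fun i => Ideal.Quotient.mk_surjective (d i)
        exact ⟨d', funext hd'⟩
      have h2 : ∀ i, p ∣ c i - A.mulVec d i := by
        intro i
        rw [← mk_eq_zero_iff_dvd, map_sub, ← hρ, ← hd, Matrix.mulVecLin_apply]
        simp [Matrix.mulVec, dotProduct, Ab, hρ, map_sum]
      have h3 := hPM.sum_mem hb.mem h2
      have h4 : ∑ i, c i • b i = (∑ i, (c i - A.mulVec d i) • b i
          - (∑ j, d j • g j - ∑ i, (A.mulVec d) i • b i)) + ∑ j, d j • g j := by
        simp only [sub_smul, Finset.sum_sub_distrib]; abel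
      rw [h4]
      exact Submodule.add_mem_sup (Z.sub_mem h3 (hg' d)) (Submodule.sum_mem _ fun j _ =>
        Submodule.smul_mem _ _ (Submodule.subset_span ⟨j, rfl⟩))
  have hTtop : (⊤ : Submodule R (Fin n → R)).map T = Submodule.span R (Set.range b) := by
    rw [Submodule.map_top]; exact Fintype.range_linearCombination R b
  have hY : (⊤ : Submodule R (Fin n → R)).map T ⊔ (Z ⊔ Submodule.span R (Set.range g)) = Y := by
    rw [hTtop]
    apply le_antisymm
    · refine sup_le ?_ (sup_le hPM.le hspan)
      rw [Submodule.span_le]; rintro _ ⟨i, rfl⟩; exact hb.mem i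
    · exact hb.le.trans (sup_le (le_sup_of_le_right le_sup_left) le_sup_left)
  have hD : (⊤ : Submodule R (Fin n → R)).map ρ ⊔ Q = ⊤ := by
    rw [eq_top_iff]
    refine le_sup_of_le_left ?_
    rintro d -
    choose d' hd' using fun i => Ideal.Quotient.mk_surjective (d i)
    exact ⟨d', trivial, funext hd'⟩
  rw [← relLength_eq_of_map T hY (top_inf_eq _), hC, relLength_eq_of_map ρ hD (top_inf_eq _),
    relLength_top_eq, uVal, ← hdet, ← length_quotient_range_mulVecLin Ab (by
      rw [hdet]; exact mt mk_eq_zero_iff_dvd.1 hA),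
    (Submodule.Quotient.restrictScalarsEquiv R (LinearMap.range Ab.mulVecLin)).length_eq]
  exact Module.length_eq_of_surjective Ideal.Quotient.mk_surjective

end Basis

end KisinHN

namespace KisinHN

open IsDiscreteValuationRing

variable {R : Type*} [CommRing R] {φ : R →+* R} {p u E : R} {e q : ℕ}
variable {M : Type*} [AddCommGroup M] [Module R M]

/-! ### Frobenius-stable submodules -/

section FrobSpan

variable (f : M →ₛₗ[φ] M)

/-- The submodule generated by `f(Y)`. -/
def frobSpan (Y : Submodule R M) : Submodule R M := Submodule.span R (f '' Y)

/-- `Y` is stable under `f`. -/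
def Stable (Y : Submodule R M) : Prop := ∀ y ∈ Y, f y ∈ Y

variable {f}

theorem mem_frobSpan {Y : Submodule R M} {y : M} (hy : y ∈ Y) : f y ∈ frobSpan f Y :=
  Submodule.subset_span ⟨y, hy, rfl⟩

theorem frobSpan_le {Y Z : Submodule R M} (h : ∀ y ∈ Y, f y ∈ Z) : frobSpan f Y ≤ Z := by
  rw [frobSpan, Submodule.span_le]
  rintro _ ⟨y, hy, rfl⟩
  exact h y hy

theorem Stable.frobSpan_le {Y : Submodule R M} (h : Stable f Y) : frobSpan f Y ≤ Y :=
  KisinHN.frobSpan_le h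

theorem frobSpan_mono {Y Z : Submodule R M} (h : Y ≤ Z) : frobSpan f Y ≤ frobSpan f Z :=
  frobSpan_le fun _ hy => mem_frobSpan (h hy)

theorem frobSpan_sup (Y Z : Submodule R M) : frobSpan f (Y ⊔ Z) = frobSpan f Y ⊔ frobSpan f Z := by
  apply le_antisymm
  · refine frobSpan_le fun x hx => ?_
    obtain ⟨y, hy, z, hz, rfl⟩ := Submodule.mem_sup.1 hx
    rw [map_add]
    exact Submodule.add_mem_sup (mem_frobSpan hy) (mem_frobSpan hz)
  · exact sup_le (frobSpan_mono le_sup_left) (frobSpan_mono le_sup_right)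

theorem frobSpan_smul (a : R) (Y : Submodule R M) :
    frobSpan f (a • Y) = φ a • frobSpan f Y := by
  apply le_antisymm
  · refine frobSpan_le fun x hx => ?_
    obtain ⟨y, hy, rfl⟩ := Submodule.mem_smul_pointwise_iff_exists _ _ _ |>.1 hx
    rw [f.map_smulₛₗ]
    exact Submodule.smul_mem_pointwise_smul _ _ _ (mem_frobSpan hy)
  · rw [frobSpan, Submodule.smul_span, Submodule.span_le]
    rintro _ ⟨_, ⟨y, hy, rfl⟩, rfl⟩
    change φ a • f y ∈ _
    rw [← f.map_smulₛₗ]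
    exact mem_frobSpan (Submodule.smul_mem_pointwise_smul _ _ _ hy)

theorem frobSpan_span (s : Set M) : frobSpan f (Submodule.span R s) = Submodule.span R (f '' s) := by
  apply le_antisymm
  · refine frobSpan_le fun x hx => ?_
    induction hx using Submodule.span_induction with
    | mem x hx => exact Submodule.subset_span ⟨x, hx, rfl⟩
    | zero => simp
    | add x y _ _ hx hy => rw [map_add]; exact add_mem hx hy
    | smul a x _ hx => rw [f.map_smulₛₗ]; exact Submodule.smul_mem _ _ hx
  · exact Submodule.span_mono (Set.image_mono Submodule.subset_span)

theorem Stable.sup {Y Z : Submodule R M} (hY : Stable f Y) (hZ : Stable f Z) :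
    Stable f (Y ⊔ Z) := by
  intro x hx
  obtain ⟨y, hy, z, hz, rfl⟩ := Submodule.mem_sup.1 hx
  rw [map_add]
  exact Submodule.add_mem_sup (hY y hy) (hZ z hz)

theorem Stable.inf {Y Z : Submodule R M} (hY : Stable f Y) (hZ : Stable f Z) :
    Stable f (Y ⊓ Z) := fun x hx => ⟨hY x hx.1, hZ x hx.2⟩

theorem Stable.iInf {ι : Sort*} {Y : ι → Submodule R M} (hY : ∀ i, Stable f (Y i)) :
    Stable f (⨅ i, Y i) := fun x hx => by
  rw [Submodule.mem_iInf] at hx ⊢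
  exact fun i => hY i x (hx i)

theorem Stable.smul_dvd {Y : Submodule R M} (hY : Stable f Y) {a : R} (ha : a ∣ φ a) :
    Stable f (a • Y) := by
  intro x hx
  obtain ⟨y, hy, rfl⟩ := Submodule.mem_smul_pointwise_iff_exists _ _ _ |>.1 hx
  obtain ⟨c, hc⟩ := ha
  rw [f.map_smulₛₗ, hc, mul_smul]
  exact Submodule.smul_mem_pointwise_smul _ _ _ (Y.smul_mem _ (hY y hy))

theorem stable_top : Stable f ⊤ := fun _ _ => trivial

theorem stable_bot : Stable f ⊥ := fun y hy => by
  rw [(Submodule.mem_bot R).1 hy, map_zero]; exact Submodule.zero_mem _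

end FrobSpan

theorem smul_pointwise_le {a : R} {Y Z : Submodule R M} : a • Y ≤ Z ↔ ∀ y ∈ Y, a • y ∈ Z := by
  constructor
  · intro h y hy; exact h (Submodule.smul_mem_pointwise_smul _ _ _ hy)
  · intro h x hx
    obtain ⟨y, hy, rfl⟩ := Submodule.mem_smul_pointwise_iff_exists _ _ _ |>.1 hx
    exact h y hy

theorem smul_pointwise_le_self (a : R) (Y : Submodule R M) : a • Y ≤ Y :=
  smul_pointwise_le.2 fun _ hy => Y.smul_mem _ hy

/-! ### Rank and degree of subquotients -/

variable (p u) in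
/-- `Y / Z` is killed by `p`, `u`-torsion free, and its Frobenius is an isomorphism after inverting
`u`. -/
structure IsPP (f : M →ₛₗ[φ] M) (Y Z : Submodule R M) : Prop extends IsPM p u Y Z where
  stable_left : Stable f Y
  stable_right : Stable f Z
  nondeg : ∃ h : ℕ, ∀ y ∈ Y, u ^ h • y ∈ Z ⊔ frobSpan f Y

variable (u) in
/-- The rank of `Y / Z`. -/
noncomputable def rank (Y Z : Submodule R M) : ℕ := (relLength Y (Z ⊔ u • Y)).toNat

/-- The degree of `Y / Z`: the length of the cokernel of the linearized Frobenius. -/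
noncomputable def degree (f : M →ₛₗ[φ] M) (Y Z : Submodule R M) : ℕ :=
  (relLength Y (Z ⊔ frobSpan f Y)).toNat

/-- Additivity of the length of the cokernel of an operator along `0 → Z/W → Y/W → Y/Z → 0`. Here
`TY` and `TZ` stand for the images of the operator, and `hinj` is the injectivity on `Y / Z` that
kills the connecting map of the snake lemma. It is applied to multiplication by `u` (rank) and to
Frobenius (degree). -/
theorem relLength_sup_add {W Z Y TY TZ : Submodule R M} (hWZ : W ≤ Z) (hZY : Z ≤ Y)
    (hTY : TY ≤ Y) (hTZ : TZ ≤ TY) (hTZZ : TZ ≤ Z) (hinj : Z ⊓ TY ≤ TZ) :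
    relLength Y (W ⊔ TY) = relLength Y (Z ⊔ TY) + relLength Z (W ⊔ TZ) := by
  rw [relLength_add (B := Z ⊔ TY) (sup_le_sup_right hWZ _) (sup_le hZY hTY)]
  congr 1
  have h1 : Z ⊔ TY = Z ⊔ (W ⊔ TY) := by rw [← sup_assoc, sup_eq_left.2 hWZ]
  have h2 : Z ⊓ (W ⊔ TY) = W ⊔ TZ := by
    rw [inf_comm, sup_inf_assoc_of_le TY hWZ]
    exact le_antisymm (sup_le_sup_left (inf_comm Z TY ▸ hinj) _)
      (sup_le_sup_left (le_inf hTZ hTZZ) _)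
  rw [h1, relLength_sup_left, h2]

/-- The isomorphism `(Y + W) / W ≅ Y / (Y ∩ W)` matches the images `T'` and `T` of an operator that
agree modulo `W`. -/
theorem relLength_sup_sup {W Y T T' : Submodule R M} (hT : T ≤ Y) (hT' : W ⊔ T' = W ⊔ T) :
    relLength (Y ⊔ W) (W ⊔ T') = relLength Y ((Y ⊓ W) ⊔ T) := by
  have h1 : Y ⊔ W = Y ⊔ (W ⊔ T) := by
    rw [sup_comm W T, ← sup_assoc, sup_eq_left.2 hT]
  rw [hT', h1, relLength_sup_left, sup_comm W T, inf_comm Y (T ⊔ W),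
    sup_inf_assoc_of_le W hT, sup_comm T, inf_comm]

/-- A square matrix over the domain `R / p` with nonzero determinant is injective. -/
theorem IsPBasis.dvd_of_sum_mem [IsDomain (R ⧸ Ideal.span {p})] {Z Y : Submodule R M} {n : ℕ} {b : Fin n → M} (hb : IsPBasis p Y Z b) {g : Fin n → M}
    {A : Matrix (Fin n) (Fin n) R} (hA : ∀ j, g j - ∑ i, A i j • b i ∈ Z) (hdet : ¬ p ∣ A.det)
    {c : Fin n → R} (hc : ∑ j, c j • g j ∈ Z) : ∀ j, p ∣ c j := by
  have h1 : ∑ i, (A.mulVec c) i • b i ∈ Z := by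
    have h2 : ∑ i, (A.mulVec c) i • b i = ∑ j, c j • g j
        - ∑ j, c j • (g j - ∑ i, A i j • b i) := by
      simp only [smul_sub, Finset.sum_sub_distrib, Finset.smul_sum, Matrix.mulVec, dotProduct,
        Finset.sum_smul, smul_smul, sub_sub_cancel]
      rw [Finset.sum_comm]
      simp only [mul_comm]
    rw [h2]
    exact Z.sub_mem hc (Z.sum_mem fun j _ => Z.smul_mem _ (hA j))
  have h3 := hb.dvd _ h1
  have h4 : (A.map (Ideal.Quotient.mk (Ideal.span {p}))).mulVec
      (fun j => Ideal.Quotient.mk (Ideal.span {p}) (c j)) = 0 := by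
    ext i
    rw [Pi.zero_apply, ← mk_eq_zero_iff_dvd.2 (h3 i)]
    simp [Matrix.mulVec, dotProduct, map_sum]
  have h5 : (A.map (Ideal.Quotient.mk (Ideal.span {p}))).det ≠ 0 := by
    rw [show (A.map (Ideal.Quotient.mk (Ideal.span {p}))).det
      = Ideal.Quotient.mk (Ideal.span {p}) A.det from (RingHom.map_det _ A).symm]
    exact mt mk_eq_zero_iff_dvd.1 hdet
  intro j
  exact mk_eq_zero_iff_dvd.1 (congrFun (Matrix.eq_zero_of_mulVec_eq_zero h5 h4) j)

theorem IsPBasis.sup_frobSpan {f : M →ₛₗ[φ] M} {Z Y : Submodule R M} (h : IsPM p u Y Z) (hs : Stable f Z) {n : ℕ}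
    {b : Fin n → M} (hb : IsPBasis p Y Z b) :
    Z ⊔ frobSpan f Y = Z ⊔ Submodule.span R (Set.range (f ∘ b)) := by
  have h1 : Y = Z ⊔ Submodule.span R (Set.range b) := by
    refine le_antisymm hb.le (sup_le h.le (Submodule.span_le.2 ?_))
    rintro _ ⟨i, rfl⟩; exact hb.mem i
  conv_lhs => rw [h1]
  rw [frobSpan_sup, frobSpan_span, ← Set.range_comp, ← sup_assoc, sup_eq_left.2 hs.frobSpan_le]

section Calculus

variable [IsDomain (R ⧸ Ideal.span {p})] [IsDiscreteValuationRing (R ⧸ Ideal.span {p})]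
variable {f : M →ₛₗ[φ] M} {W Z Y : Submodule R M}

/-- Multiplication by `u` has matrix `u • 1`, whose determinant `u ^ n` has valuation `n`. -/
theorem IsPM.relLength_rank (hR : FrobeniusDatum φ p u E e q) (h : IsPM p u Y Z) {n : ℕ}
    {b : Fin n → M} (hb : IsPBasis p Y Z b) : relLength Y (Z ⊔ u • Y) = n := by
  have h1 : Z ⊔ u • Y = Z ⊔ Submodule.span R (Set.range fun i => u • b i) := by
    apply le_antisymm
    · refine sup_le le_sup_left (smul_pointwise_le.2 fun y hy => ?_)
      obtain ⟨c, hc⟩ := hb.exists_coeff hy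
      have h2 : u • y = u • (y - ∑ i, c i • b i) + ∑ i, c i • (u • b i) := by
        rw [smul_sub, Finset.smul_sum]
        simp only [smul_comm u]
        abel
      rw [h2]
      exact Submodule.add_mem_sup (Z.smul_mem _ hc) (Submodule.sum_mem _ fun i _ =>
        Submodule.smul_mem _ _ (Submodule.subset_span ⟨i, rfl⟩))
    · refine sup_le le_sup_left (Submodule.span_le.2 ?_)
      rintro _ ⟨i, rfl⟩
      exact Submodule.mem_sup_right (Submodule.smul_mem_pointwise_smul _ _ _ (hb.mem i))
  have hdet : (u • (1 : Matrix (Fin n) (Fin n) R)).det = u ^ n := by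
    rw [Matrix.det_smul, Matrix.det_one, mul_one, Fintype.card_fin]
  rw [h1, hb.relLength_sup_span h (A := u • (1 : Matrix (Fin n) (Fin n) R)), hdet, hR.uVal_u_pow]
  · intro j
    simp [Matrix.one_apply]
  · rw [hdet, ← uVal_eq_top_iff, hR.uVal_u_pow]; exact ENat.natCast_ne_top _

theorem IsPM.rank_eq (hR : FrobeniusDatum φ p u E e q) (h : IsPM p u Y Z) {n : ℕ}
    {b : Fin n → M} (hb : IsPBasis p Y Z b) : rank u Y Z = n := by
  rw [rank, h.relLength_rank hR hb, ENat.toNat_natCast]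

theorem IsPM.coe_rank [IsNoetherian R M] (hR : FrobeniusDatum φ p u E e q) (h : IsPM p u Y Z) :
    (rank u Y Z : ℕ∞) = relLength Y (Z ⊔ u • Y) := by
  obtain ⟨n, b, hb⟩ := h.exists_isPBasis hR.irreducible_u
  rw [h.rank_eq hR hb, h.relLength_rank hR hb]

theorem IsPM.rank_pos [IsNoetherian R M] (hR : FrobeniusDatum φ p u E e q) (h : IsPM p u Y Z)
    (hne : Z ≠ Y) : 0 < rank u Y Z := by
  obtain ⟨n, b, hb⟩ := h.exists_isPBasis hR.irreducible_u
  rw [h.rank_eq hR hb, Nat.pos_iff_ne_zero]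
  rintro rfl
  refine hne (le_antisymm h.le (hb.le.trans ?_))
  rw [Set.range_eq_empty, Submodule.span_empty, sup_bot_eq]

/-- If `u ^ h` kills the cokernel of the matrix `A`, then `A` is nonsingular modulo `p`. -/
theorem IsPBasis.not_dvd_det (hR : FrobeniusDatum φ p u E e q)
    {n : ℕ} {b : Fin n → M} (hb : IsPBasis p Y Z b) {g : Fin n → M}
    {A : Matrix (Fin n) (Fin n) R} (hA : ∀ j, g j - ∑ i, A i j • b i ∈ Z)
    (hn : ∃ h : ℕ, ∀ j, u ^ h • b j ∈ Z ⊔ Submodule.span R (Set.range g)) : ¬ p ∣ A.det := by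
  obtain ⟨k, hk⟩ := hn
  have h1 : ∀ j, ∃ c : Fin n → R, u ^ k • b j - ∑ l, c l • g l ∈ Z := by
    intro j
    obtain ⟨z, hz, w, hw, hzw⟩ := Submodule.mem_sup.1 (hk j)
    obtain ⟨c, rfl⟩ := (Submodule.mem_span_range_iff_exists_fun R).1 hw
    exact ⟨c, by rw [← hzw]; simpa using hz⟩
  choose c hc using h1
  -- The matrix `C` writes `u ^ k • b j` in terms of `g`. Thus `A * C ≡ u ^ k` modulo `p`, and the
  -- determinant of the right-hand side is a power of the nonzero element `u`.
  let C : Matrix (Fin n) (Fin n) R := fun l j => c j l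
  have h2 : ∀ i j, p ∣ (u ^ k • (1 : Matrix (Fin n) (Fin n) R) - A * C) i j := by
    intro i j
    refine hb.dvd (fun i => (u ^ k • (1 : Matrix (Fin n) (Fin n) R) - A * C) i j) ?_ i
    have h3 : ∑ i, ((u ^ k • (1 : Matrix (Fin n) (Fin n) R) - A * C) i j) • b i
        = (u ^ k • b j - ∑ l, c j l • g l) + ∑ l, c j l • (g l - ∑ i, A i l • b i) := by
      simp only [smul_sub, Finset.sum_sub_distrib, Matrix.sub_apply, sub_smul, Finset.smul_sum]
      have h4 : ∑ x, ((A * C) x j) • b x = ∑ x, ∑ i, c j x • A i x • b i := by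
        rw [Finset.sum_comm]
        refine Finset.sum_congr rfl fun i _ => ?_
        rw [Matrix.mul_apply, Finset.sum_smul]
        exact Finset.sum_congr rfl fun x _ => by rw [smul_smul, mul_comm]
      have h5 : ∑ x, ((u ^ k • (1 : Matrix (Fin n) (Fin n) R)) x j) • b x = u ^ k • b j := by
        simp [Matrix.one_apply]
      rw [h4, h5]; abel
    rw [h3]
    exact Z.add_mem (hc j) (Z.sum_mem fun l _ => Z.smul_mem _ (hA l))
  intro hdvd
  have h6 : (A.map (Ideal.Quotient.mk (Ideal.span {p}))) * C.map (Ideal.Quotient.mk (Ideal.span {p}))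
      = (Ideal.Quotient.mk (Ideal.span {p}) (u ^ k)) • 1 := by
    ext i j
    have := mk_eq_zero_iff_dvd.2 (h2 i j)
    rw [Matrix.sub_apply, map_sub, sub_eq_zero] at this
    rw [← Matrix.map_mul, Matrix.map_apply, ← this]
    by_cases hij : i = j <;> simp [hij]
  have h7 := congrArg Matrix.det h6
  have h8 : (A.map (Ideal.Quotient.mk (Ideal.span {p}))).det = 0 := by
    rw [← mk_eq_zero_iff_dvd.2 hdvd]; exact (RingHom.map_det _ A).symm
  rw [Matrix.det_mul, h8, zero_mul, Matrix.det_smul, Matrix.det_one, mul_one] at h7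
  have h9 := eq_zero_of_pow_eq_zero h7.symm
  rw [map_pow] at h9
  exact hR.irreducible_u.ne_zero (eq_zero_of_pow_eq_zero h9)

theorem IsPP.exists_matrix (hR : FrobeniusDatum φ p u E e q) (h : IsPP p u f Y Z) {n : ℕ}
    {b : Fin n → M} (hb : IsPBasis p Y Z b) :
    ∃ A : Matrix (Fin n) (Fin n) R, (∀ j, f (b j) - ∑ i, A i j • b i ∈ Z) ∧ ¬ p ∣ A.det ∧
      relLength Y (Z ⊔ frobSpan f Y) = uVal p A.det := by
  obtain ⟨A, hA⟩ := hb.exists_matrix (g := f ∘ b) fun j => h.stable_left _ (hb.mem j)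
  have hdet : ¬ p ∣ A.det := by
    obtain ⟨k, hk⟩ := h.nondeg
    refine hb.not_dvd_det hR hA ⟨k, fun j => ?_⟩
    rw [← IsPBasis.sup_frobSpan h.toIsPM h.stable_right hb]
    exact hk _ (hb.mem j)
  refine ⟨A, hA, hdet, ?_⟩
  rw [IsPBasis.sup_frobSpan h.toIsPM h.stable_right hb, hb.relLength_sup_span h.toIsPM hA hdet]

variable [IsNoetherian R M]

theorem IsPP.coe_degree (hR : FrobeniusDatum φ p u E e q) (h : IsPP p u f Y Z) :
    (degree f Y Z : ℕ∞) = relLength Y (Z ⊔ frobSpan f Y) := by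
  obtain ⟨n, b, hb⟩ := h.exists_isPBasis hR.irreducible_u
  obtain ⟨A, hA, hdet, hl⟩ := h.exists_matrix hR hb
  rw [degree, ENat.natCast_toNat]
  rw [hl]
  exact mt uVal_eq_top_iff.1 hdet

/-- The linearized Frobenius of `Y / Z` is injective. -/
theorem IsPP.inf_frobSpan_le (hR : FrobeniusDatum φ p u E e q) (h : IsPP p u f Y Z) :
    Z ⊓ frobSpan f Y ≤ frobSpan f Z := by
  obtain ⟨n, b, hb⟩ := h.exists_isPBasis hR.irreducible_u
  obtain ⟨A, hA, hdet, -⟩ := h.exists_matrix hR hb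
  have h1 : frobSpan f Y ≤ frobSpan f Z ⊔ Submodule.span R (Set.range (f ∘ b)) := by
    refine (frobSpan_mono hb.le).trans ?_
    rw [frobSpan_sup, frobSpan_span, Set.range_comp]
  rintro x ⟨hx, hx'⟩
  obtain ⟨z, hz, w, hw, rfl⟩ := Submodule.mem_sup.1 (h1 hx')
  obtain ⟨c, rfl⟩ := (Submodule.mem_span_range_iff_exists_fun R).1 hw
  have h2 : ∑ j, c j • (f ∘ b) j ∈ Z := by
    have := Z.sub_mem hx (h.stable_right.frobSpan_le hz)
    simpa using this
  have h3 := hb.dvd_of_sum_mem hA hdet h2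
  refine add_mem hz (Submodule.sum_mem _ fun j _ => ?_)
  -- A coefficient divisible by `p` can be moved inside `f` because `φ p = p`, and `p • b j` lies in
  -- `Z`.
  obtain ⟨d, hd⟩ := h3 j
  rw [hd, mul_comm, mul_smul]
  refine Submodule.smul_mem _ _ ?_
  have : p • (f ∘ b) j = f (p • b j) := by rw [f.map_smulₛₗ, hR.map_p]; rfl
  rw [this]
  exact mem_frobSpan (h.p_mem _ (hb.mem j))

theorem IsPP.rank_add (hR : FrobeniusDatum φ p u E e q) (hYW : IsPP p u f Y W)
    (hYZ : IsPP p u f Y Z) (hZW : IsPP p u f Z W) :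
    rank u Y W = rank u Y Z + rank u Z W := by
  have := relLength_sup_add (TY := u • Y) (TZ := u • Z) hZW.le hYZ.le (smul_pointwise_le_self _ _)
    (smul_pointwise_le.2 fun y hy => Submodule.smul_mem_pointwise_smul _ _ _ (hYZ.le hy))
    (smul_pointwise_le_self _ _) (by
      rintro x ⟨hx, hx'⟩
      obtain ⟨y, hy, rfl⟩ := Submodule.mem_smul_pointwise_iff_exists _ _ _ |>.1 hx'
      exact Submodule.smul_mem_pointwise_smul _ _ _ (hYZ.u_tf y hy hx))
  rw [← hYW.coe_rank hR, ← hYZ.coe_rank hR, ← hZW.coe_rank hR] at this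
  exact_mod_cast this

theorem IsPP.degree_add (hR : FrobeniusDatum φ p u E e q) (hYW : IsPP p u f Y W)
    (hYZ : IsPP p u f Y Z) (hZW : IsPP p u f Z W) :
    degree f Y W = degree f Y Z + degree f Z W := by
  have := relLength_sup_add (TY := frobSpan f Y) (TZ := frobSpan f Z) hZW.le hYZ.le
    hYZ.stable_left.frobSpan_le (frobSpan_mono hYZ.le) hYZ.stable_right.frobSpan_le
    (hYZ.inf_frobSpan_le hR)
  rw [← hYW.coe_degree hR, ← hYZ.coe_degree hR, ← hZW.coe_degree hR] at this
  exact_mod_cast this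

end Calculus

end KisinHN

namespace KisinHN

variable {R : Type*} [CommRing R] {φ : R →+* R} {p u E : R} {e q : ℕ}
variable {M : Type*} [AddCommGroup M] [Module R M]
variable [IsDomain (R ⧸ Ideal.span {p})] [IsDiscreteValuationRing (R ⧸ Ideal.span {p})]
variable {f : M →ₛₗ[φ] M} {W Z Y Y' : Submodule R M}

/-! ### Constructions with subquotients -/

omit [IsDomain (R ⧸ Ideal.span {p})] [IsDiscreteValuationRing (R ⧸ Ideal.span {p})] in
theorem smul_pointwise_mono (a : R) (h : Y ≤ Z) : a • Y ≤ a • Z :=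
  smul_pointwise_le.2 fun _ hy => Submodule.smul_mem_pointwise_smul _ _ _ (h hy)

omit [IsDomain (R ⧸ Ideal.span {p})] [IsDiscreteValuationRing (R ⧸ Ideal.span {p})] in
theorem IsPP.quotient (h : IsPP p u f Y W) (hWZ : W ≤ Z) (hZY : Z ≤ Y) (hZ : Stable f Z)
    (hu : ∀ y ∈ Y, u • y ∈ Z → y ∈ Z) : IsPP p u f Y Z where
  le := hZY
  p_mem y hy := hWZ (h.p_mem y hy)
  u_tf := hu
  stable_left := h.stable_left
  stable_right := hZ
  nondeg := by
    obtain ⟨k, hk⟩ := h.nondeg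
    exact ⟨k, fun y hy => sup_le_sup_right hWZ _ (hk y hy)⟩

omit [IsDomain (R ⧸ Ideal.span {p})] [IsDiscreteValuationRing (R ⧸ Ideal.span {p})] in
theorem IsPM.sub (h : IsPM p u Y W) (hWZ : W ≤ Z) (hZY : Z ≤ Y) : IsPM p u Z W where
  le := hWZ
  p_mem z hz := h.p_mem z (hZY hz)
  u_tf z hz := h.u_tf z (hZY hz)

omit [IsDomain (R ⧸ Ideal.span {p})] [IsDiscreteValuationRing (R ⧸ Ideal.span {p})] in
theorem IsPP.ext (hYZ : IsPP p u f Y Z) (hZW : IsPP p u f Z W) (hp : ∀ y ∈ Y, p • y ∈ W) :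
    IsPP p u f Y W where
  le := hZW.le.trans hYZ.le
  p_mem := hp
  u_tf y hy hu := hZW.u_tf y (hYZ.u_tf y hy (hZW.le hu)) hu
  stable_left := hYZ.stable_left
  stable_right := hZW.stable_right
  nondeg := by
    obtain ⟨k, hk⟩ := hYZ.nondeg
    obtain ⟨l, hl⟩ := hZW.nondeg
    refine ⟨l + k, fun y hy => ?_⟩
    obtain ⟨z, hz, w, hw, hzw⟩ := Submodule.mem_sup.1 (hk y hy)
    rw [pow_add, mul_smul, ← hzw, smul_add]
    refine add_mem ?_ (Submodule.smul_mem _ _ (Submodule.mem_sup_right hw))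
    exact sup_le_sup_left (frobSpan_mono hYZ.le) _ (hl z hz)

/-- For `y ∈ Z`, the element `u ^ k • y` lies in `Z` and in `W + f(Y)`, hence by the modular law in
`W + (Z ∩ f(Y))`; injectivity of Frobenius on `Y / Z` puts the last term in the span of `f(Z)`. -/
theorem IsPP.sub_saturated [IsNoetherian R M] (hR : FrobeniusDatum φ p u E e q)
    (h : IsPP p u f Y W) (hYZ : IsPP p u f Y Z) (hWZ : W ≤ Z) : IsPP p u f Z W where
  toIsPM := h.toIsPM.sub hWZ hYZ.le
  stable_left := hYZ.stable_right
  stable_right := h.stable_right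
  nondeg := by
    obtain ⟨k, hk⟩ := h.nondeg
    refine ⟨k, fun y hy => ?_⟩
    have h1 : u ^ k • y ∈ Z ⊓ (W ⊔ frobSpan f Y) := ⟨Z.smul_mem _ hy, hk y (hYZ.le hy)⟩
    rw [inf_comm, sup_inf_assoc_of_le _ hWZ, inf_comm] at h1
    exact sup_le_sup_left (hYZ.inf_frobSpan_le hR) _ h1

/-- The submodules of `Y` carried into `Z` by `u ^ n` increase with `n` and become constant by
noetherianity. Frobenius sends level `m` to level `q * m`, which is again the stable value. -/
theorem FrobeniusDatum.exists_saturation [IsNoetherian R M] (hR : FrobeniusDatum φ p u E e q)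
    (hY : Stable f Y) (hZ : Stable f Z) (hZY : Z ≤ Y) :
    ∃ (Z' : Submodule R M) (m : ℕ), Z ≤ Z' ∧ Z' ≤ Y ∧ Stable f Z' ∧
      (∀ y ∈ Y, u • y ∈ Z' → y ∈ Z') ∧ ∀ y ∈ Z', u ^ m • y ∈ Z := by
  let D : ℕ →o Submodule R M :=
    ⟨fun n => Y ⊓ Z.comap (LinearMap.lsmul R M (u ^ n)), monotone_nat_of_le_succ fun n x hx =>
      ⟨hx.1, by
        have := Z.smul_mem u hx.2
        simpa [pow_succ', mul_smul] using this⟩⟩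
  have hD : ∀ n x, x ∈ D n ↔ x ∈ Y ∧ u ^ n • x ∈ Z := fun n x => Iff.rfl
  obtain ⟨m, hm⟩ := monotone_stabilizes_iff_noetherian.2 (inferInstance : IsNoetherian R M) D
  refine ⟨D m, m, fun z hz => (hD _ _).2 ⟨hZY hz, Z.smul_mem _ hz⟩, inf_le_left, ?_, ?_, ?_⟩
  · intro y hy
    rw [hD] at hy
    have hq : m ≤ q * m := Nat.le_mul_of_pos_left m (by have := hR.two_le; omega)
    rw [hm (q * m) hq, hD]
    refine ⟨hY y hy.1, ?_⟩
    have := hZ _ hy.2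
    rwa [f.map_smulₛₗ, map_pow, hR.map_u, ← pow_mul] at this
  · intro y hy hu
    rw [hm (m + 1) (Nat.le_succ m), hD]
    exact ⟨hy, by rw [pow_succ, mul_smul]; exact hu.2⟩
  · intro y hy
    exact hy.2

/-- A stable submodule of `Y / W` inherits the property of having nondegenerate Frobenius. -/
theorem IsPP.sub [IsNoetherian R M] (hR : FrobeniusDatum φ p u E e q) (h : IsPP p u f Y W)
    (hWZ : W ≤ Z) (hZY : Z ≤ Y) (hZ : Stable f Z) : IsPP p u f Z W where
  toIsPM := h.toIsPM.sub hWZ hZY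
  stable_left := hZ
  stable_right := h.stable_right
  nondeg := by
    obtain ⟨Z', m, hZZ', hZ'Y, hZ', hu, hm⟩ := hR.exists_saturation h.stable_left hZ hZY
    obtain ⟨k, hk⟩ := (h.sub_saturated hR (h.quotient (hWZ.trans hZZ') hZ'Y hZ' hu)
      (hWZ.trans hZZ')).nondeg
    -- The factor `u ^ k` brings `y` into `W + f(Z')` for the saturation `Z'`. Then `u ^ (q * m) = φ
    -- (u ^ m)` can be moved inside `f`, where `u ^ m` carries `Z'` into `Z`.
    refine ⟨q * m + k, fun y hy => ?_⟩
    rw [pow_add, mul_smul]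
    obtain ⟨w, hw, z, hz, hwz⟩ := Submodule.mem_sup.1 (hk y (hZZ' hy))
    rw [← hwz, smul_add]
    refine Submodule.add_mem_sup (W.smul_mem _ hw) ?_
    have h1 : φ (u ^ m) • frobSpan f Z' ≤ frobSpan f Z := by
      rw [← frobSpan_smul]
      exact frobSpan_mono (smul_pointwise_le.2 hm)
    rw [map_pow, hR.map_u, ← pow_mul] at h1
    exact h1 (Submodule.smul_mem_pointwise_smul _ _ _ hz)

omit [IsDomain (R ⧸ Ideal.span {p})] [IsDiscreteValuationRing (R ⧸ Ideal.span {p})] in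
theorem sup_frobSpan_sup (hW : Stable f W) : W ⊔ frobSpan f (Y ⊔ W) = W ⊔ frobSpan f Y := by
  rw [frobSpan_sup, sup_comm (frobSpan f Y), ← sup_assoc, sup_eq_left.2 hW.frobSpan_le]

omit [IsDomain (R ⧸ Ideal.span {p})] [IsDiscreteValuationRing (R ⧸ Ideal.span {p})] in
-- Transport along the isomorphism `Y / (Y ∩ W) ≅ (Y + W) / W`, which respects Frobenius; `rank_sup`
-- and `degree_sup` are the matching statements for the invariants.
theorem IsPP.inf (h : IsPP p u f (Y ⊔ W) W) (hY : Stable f Y) : IsPP p u f Y (Y ⊓ W) where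
  le := inf_le_left
  p_mem y hy := ⟨Y.smul_mem _ hy, h.p_mem y (Submodule.mem_sup_left hy)⟩
  u_tf y hy hu := ⟨hy, h.u_tf y (Submodule.mem_sup_left hy) hu.2⟩
  stable_left := hY
  stable_right := hY.inf h.stable_right
  nondeg := by
    obtain ⟨k, hk⟩ := h.nondeg
    refine ⟨k, fun y hy => ?_⟩
    have h1 := hk y (Submodule.mem_sup_left hy)
    rw [sup_frobSpan_sup h.stable_right] at h1
    rw [sup_comm, inf_comm, ← sup_inf_assoc_of_le _ hY.frobSpan_le, sup_comm]
    exact ⟨h1, Y.smul_mem _ hy⟩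

omit [IsDomain (R ⧸ Ideal.span {p})] [IsDiscreteValuationRing (R ⧸ Ideal.span {p})] in
theorem rank_sup (u : R) (Y W : Submodule R M) : rank u (Y ⊔ W) W = rank u Y (Y ⊓ W) := by
  rw [rank, rank, relLength_sup_sup (smul_pointwise_le_self u Y)]
  rw [Submodule.smul_sup', sup_comm (u • Y), ← sup_assoc,
    sup_eq_left.2 (smul_pointwise_le_self u W)]

omit [IsDomain (R ⧸ Ideal.span {p})] [IsDiscreteValuationRing (R ⧸ Ideal.span {p})] in
theorem degree_sup (hY : Stable f Y) (hW : Stable f W) :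
    degree f (Y ⊔ W) W = degree f Y (Y ⊓ W) := by
  rw [degree, degree, relLength_sup_sup hY.frobSpan_le (sup_frobSpan_sup hW)]

/-! ### Multiplication by `p` on subquotients of a `p`-torsion free quotient -/

section MulP

variable {A B C : Submodule R M}

omit [IsDomain (R ⧸ Ideal.span {p})] [IsDiscreteValuationRing (R ⧸ Ideal.span {p})] in
theorem mem_sup_smul {x : M} : x ∈ B ⊔ p • A ↔ ∃ a ∈ A, x - p • a ∈ B := by
  constructor
  · intro hx
    obtain ⟨b, hb, y, hy, rfl⟩ := Submodule.mem_sup.1 hx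
    obtain ⟨a, ha, rfl⟩ := Submodule.mem_smul_pointwise_iff_exists _ _ _ |>.1 hy
    exact ⟨a, ha, by simpa using hb⟩
  · rintro ⟨a, ha, hx⟩
    have := Submodule.add_mem_sup hx (Submodule.smul_mem_pointwise_smul a p A ha)
    simpa using this

omit [IsDomain (R ⧸ Ideal.span {p})] [IsDiscreteValuationRing (R ⧸ Ideal.span {p})] in
theorem mem_of_smul_mem_sup_smul (hBC : B ≤ C) (hCA : C ≤ A) (hp : ∀ x ∈ A, p • x ∈ B → x ∈ B)
    {x : M} (hx : x ∈ A) (hpx : p • x ∈ B ⊔ p • C) : x ∈ C := by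
  obtain ⟨c, hc, h⟩ := mem_sup_smul.1 hpx
  rw [← smul_sub] at h
  have := C.add_mem (hBC (hp _ (A.sub_mem hx (hCA hc)) h)) hc
  simpa using this

omit [IsDomain (R ⧸ Ideal.span {p})] [IsDiscreteValuationRing (R ⧸ Ideal.span {p})] in
-- As `A / B` has no `p`-torsion, multiplication by `p` identifies `A / C` with `(B + pA) / (B +
-- pC)`. It commutes with Frobenius since `φ p = p`, which later gives the same for rank and degree.
theorem relLength_sup_smul (hBC : B ≤ C) (hCA : C ≤ A) (hp : ∀ x ∈ A, p • x ∈ B → x ∈ B) :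
    relLength (B ⊔ p • A) (B ⊔ p • C) = relLength A C := by
  refine (relLength_eq_of_map (LinearMap.lsmul R M p) ?_ ?_).symm
  · have : A.map (LinearMap.lsmul R M p) = p • A := rfl
    rw [this, ← sup_assoc, sup_comm (p • A), sup_assoc, sup_eq_left.2 (smul_pointwise_mono p hCA)]
  · ext x
    constructor
    · rintro ⟨hx, hx'⟩
      exact mem_of_smul_mem_sup_smul hBC hCA hp hx hx'
    · intro hx
      exact ⟨hCA hx, Submodule.mem_sup_right (Submodule.smul_mem_pointwise_smul _ _ _ hx)⟩

omit [IsDomain (R ⧸ Ideal.span {p})] [IsDiscreteValuationRing (R ⧸ Ideal.span {p})] in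
theorem rank_sup_smul (hBC : B ≤ C) (hCA : C ≤ A) (hp : ∀ x ∈ A, p • x ∈ B → x ∈ B) :
    rank u (B ⊔ p • A) (B ⊔ p • C) = rank u A C := by
  rw [rank, rank, ← relLength_sup_smul (hBC.trans le_sup_left)
    (sup_le hCA (smul_pointwise_le_self _ _)) hp]
  congr 2
  rw [Submodule.smul_sup', Submodule.smul_sup', smul_comm u p, sup_assoc, sup_comm (p • C),
    sup_assoc, ← sup_assoc, sup_eq_left.2 (smul_pointwise_le_self u B), sup_comm (p • u • A)]

theorem degree_sup_smul (hR : FrobeniusDatum φ p u E e q) (hB : Stable f B) (hA : Stable f A)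
    (hBC : B ≤ C) (hCA : C ≤ A) (hp : ∀ x ∈ A, p • x ∈ B → x ∈ B) :
    degree f (B ⊔ p • A) (B ⊔ p • C) = degree f A C := by
  rw [degree, degree, ← relLength_sup_smul (hBC.trans le_sup_left)
    (sup_le hCA hA.frobSpan_le) hp]
  congr 2
  rw [frobSpan_sup, frobSpan_smul, hR.map_p, Submodule.smul_sup', sup_assoc, sup_comm (p • C),
    sup_assoc, ← sup_assoc, sup_eq_left.2 hB.frobSpan_le, sup_comm (p • frobSpan f A)]

theorem IsPP.sup_smul (hR : FrobeniusDatum φ p u E e q) (h : IsPP p u f A C) (hB : Stable f B)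
    (hBC : B ≤ C) (hp : ∀ x ∈ A, p • x ∈ B → x ∈ B) :
    IsPP p u f (B ⊔ p • A) (B ⊔ p • C) where
  le := sup_le_sup_left (smul_pointwise_mono p h.le) _
  p_mem y hy := by
    obtain ⟨a, ha, hb⟩ := mem_sup_smul.1 hy
    refine mem_sup_smul.2 ⟨p • a, h.p_mem a ha, ?_⟩
    rw [← smul_sub]; exact B.smul_mem _ hb
  u_tf y hy hu := by
    obtain ⟨a, ha, hb⟩ := mem_sup_smul.1 hy
    refine mem_sup_smul.2 ⟨a, ?_, hb⟩
    refine h.u_tf a ha (mem_of_smul_mem_sup_smul hBC h.le hp (A.smul_mem _ ha) ?_)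
    have h1 := sub_mem hu (Submodule.mem_sup_left (T := p • C) (B.smul_mem u hb))
    rw [smul_sub, sub_sub_cancel] at h1
    rwa [smul_comm]
  stable_left := hB.sup (h.stable_left.smul_dvd (by rw [hR.map_p]))
  stable_right := hB.sup (h.stable_right.smul_dvd (by rw [hR.map_p]))
  nondeg := by
    obtain ⟨k, hk⟩ := h.nondeg
    refine ⟨k, fun y hy => ?_⟩
    obtain ⟨a, ha, hb⟩ := mem_sup_smul.1 hy
    have h1 : y = (y - p • a) + p • a := by abel
    rw [h1, smul_add]
    refine add_mem (Submodule.mem_sup_left (Submodule.mem_sup_left (B.smul_mem _ hb))) ?_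
    rw [smul_comm]
    have h2 := Submodule.smul_mem_pointwise_smul _ p _ (hk a ha)
    rw [Submodule.smul_sup'] at h2
    have h3 : p • frobSpan f A = frobSpan f (p • A) := by rw [frobSpan_smul, hR.map_p]
    rw [h3] at h2
    have h4 : p • C ⊔ frobSpan f (p • A) ≤ (B ⊔ p • C) ⊔ frobSpan f (B ⊔ p • A) :=
      sup_le_sup le_sup_right (frobSpan_mono le_sup_right)
    exact h4 h2

end MulP

/-! ### Comparison of a submodule with the ambient module -/

omit [IsDomain (R ⧸ Ideal.span {p})] [IsDiscreteValuationRing (R ⧸ Ideal.span {p})] in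
-- The matrix of the inclusion `Z / W → Y / W`; its columns are independent modulo `p` because the
-- inclusion is injective.
theorem IsPBasis.exists_matrix_linearIndependent {n n' : ℕ} {b : Fin n → M} (hb : IsPBasis p Y W b) (hZY : Z ≤ Y)
    {b' : Fin n' → M} (hb' : IsPBasis p Z W b') (hPM : IsPM p u Y W) :
    ∃ B : Matrix (Fin n) (Fin n') R, (∀ j, b' j - ∑ i, B i j • b i ∈ W) ∧
      LinearIndependent (R ⧸ Ideal.span {p})
        fun j i => Ideal.Quotient.mk (Ideal.span {p}) (B i j) := by
  obtain ⟨B, hB⟩ := hb.exists_matrix fun j => hZY (hb'.mem j)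
  refine ⟨B, hB, ?_⟩
  rw [Fintype.linearIndependent_iff]
  intro g hg j
  choose c hc using fun j => Ideal.Quotient.mk_surjective (g j)
  rw [← hc, mk_eq_zero_iff_dvd]
  refine hb'.dvd c ?_ j
  have h1 : ∀ i, p ∣ ∑ j, c j * B i j := by
    intro i
    rw [← mk_eq_zero_iff_dvd, map_sum]
    have := congrFun hg i
    simpa [hc] using this
  have h2 := hPM.sum_mem hb.mem h1
  have h3 : ∑ j, c j • b' j = ∑ j, c j • (b' j - ∑ i, B i j • b i) +
      ∑ i, (∑ j, c j * B i j) • b i := by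
    simp only [smul_sub, Finset.sum_sub_distrib, Finset.sum_smul, Finset.smul_sum, smul_smul]
    rw [Finset.sum_comm (f := fun i j => (c j * B i j) • b i)]
    abel
  rw [h3]
  exact W.add_mem (W.sum_mem fun j _ => W.smul_mem _ (hB j)) h2

theorem IsPM.rank_le [IsNoetherian R M] (hR : FrobeniusDatum φ p u E e q) (hY : IsPM p u Y W)
    (hWZ : W ≤ Z) (hZY : Z ≤ Y) : rank u Z W ≤ rank u Y W := by
  have hZ := hY.sub hWZ hZY
  obtain ⟨n, b, hb⟩ := hY.exists_isPBasis hR.irreducible_u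
  obtain ⟨n', b', hb'⟩ := hZ.exists_isPBasis hR.irreducible_u
  rw [hY.rank_eq hR hb, hZ.rank_eq hR hb']
  obtain ⟨B, -, hli⟩ := hb.exists_matrix_linearIndependent hZY hb' hY
  simpa using hli.fintype_card_le_finrank

omit [IsDomain (R ⧸ Ideal.span {p})] [IsDiscreteValuationRing (R ⧸ Ideal.span {p})] in
theorem sum_mul_smul {ι κ l : Type*} [Fintype ι] [Fintype κ] (B : Matrix ι κ R)
    (A : Matrix κ l R) (b : ι → M) (j : l) :
    ∑ i, (B * A) i j • b i = ∑ k, A k j • ∑ i, B i k • b i := by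
  simp only [Finset.smul_sum]
  rw [Finset.sum_comm]
  refine Finset.sum_congr rfl fun i _ => ?_
  rw [Matrix.mul_apply, Finset.sum_smul]
  exact Finset.sum_congr rfl fun x _ => by rw [smul_smul, mul_comm]

/-- If `B` is the matrix of the inclusion and `A`, `A'` are the matrices of Frobenius on `Y / W` and
`Z / W`, then `B A' ≡ A φ(B)` modulo `p`. With `v` the valuation of `det B`, which is the length of
`Y / Z`, this reads `v + deg Z = deg Y + q v`. Since `q ≥ 2`, shrinking a lattice without changing
its rank raises the degree, strictly unless `v = 0`. -/
theorem IsPP.degree_le [IsLocalRing R] [IsNoetherian R M] (hR : FrobeniusDatum φ p u E e q)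
    (hY : IsPP p u f Y W) (hZ : IsPP p u f Z W) (hZY : Z ≤ Y) (hr : rank u Z W = rank u Y W) :
    degree f Y W ≤ degree f Z W ∧ (degree f Y W = degree f Z W → Z = Y) := by
  obtain ⟨n, b, hb⟩ := hY.exists_isPBasis hR.irreducible_u
  obtain ⟨n', b', hb'⟩ := hZ.exists_isPBasis hR.irreducible_u
  rw [hY.rank_eq hR hb, hZ.rank_eq hR hb'] at hr
  subst hr
  obtain ⟨B, hB, hli⟩ := hb.exists_matrix_linearIndependent hZY hb' hY.toIsPM
  obtain ⟨A, hA, hAdet, hAl⟩ := hY.exists_matrix hR hb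
  obtain ⟨A', hA', hAdet', hAl'⟩ := hZ.exists_matrix hR hb'
  have hBdet : ¬ p ∣ B.det := by
    rw [← mk_eq_zero_iff_dvd]
    have h1 : Ideal.Quotient.mk (Ideal.span {p}) B.det
        = (B.map (Ideal.Quotient.mk (Ideal.span {p}))).det := RingHom.map_det _ B
    rw [h1]
    intro h0
    obtain ⟨v, hv, hBv⟩ := Matrix.exists_mulVec_eq_zero_iff.2 h0
    refine hv (funext fun j => Fintype.linearIndependent_iff.1 hli v ?_ j)
    rw [← hBv]
    ext i
    simp [Matrix.mulVec, dotProduct, mul_comm]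
  have hl := hb.relLength_sup_span hY.toIsPM hB hBdet
  have hmat : ∀ i j, p ∣ (B * A' - A * B.map φ) i j := by
    intro i j
    refine hb.dvd (fun i => (B * A' - A * B.map φ) i j) ?_ i
    have h1 : f (b' j) - ∑ i, (B * A') i j • b i ∈ W := by
      rw [sum_mul_smul]
      have := W.add_mem (hA' j) (W.sum_mem fun l (_ : l ∈ Finset.univ) =>
        W.smul_mem (A' l j) (hB l))
      simpa only [smul_sub, Finset.sum_sub_distrib, sub_add_sub_cancel] using this
    have h2 : f (b' j) - ∑ i, (A * B.map φ) i j • b i ∈ W := by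
      rw [sum_mul_smul]
      have h3 := hY.stable_right _ (hB j)
      rw [map_sub, map_sum] at h3
      simp only [f.map_smulₛₗ] at h3
      have := W.add_mem h3 (W.sum_mem fun l (_ : l ∈ Finset.univ) =>
        W.smul_mem (φ (B l j)) (hA l))
      simpa only [smul_sub, Finset.sum_sub_distrib, sub_add_sub_cancel, Matrix.map_apply] using this
    have h3 := W.sub_mem h2 h1
    simpa only [Matrix.sub_apply, sub_smul, Finset.sum_sub_distrib, sub_sub_sub_cancel_left] using h3
  have hdet : uVal p (B.det * A'.det) = uVal p (A.det * φ B.det) := by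
    rw [RingHom.map_det, RingHom.mapMatrix_apply, ← Matrix.det_mul, ← Matrix.det_mul]
    refine uVal_eq_of_dvd_sub ?_
    rw [← mk_eq_zero_iff_dvd, map_sub, sub_eq_zero, RingHom.map_det, RingHom.map_det]
    congr 1
    ext i j
    have := mk_eq_zero_iff_dvd.2 (hmat i j)
    rwa [Matrix.sub_apply, map_sub, sub_eq_zero] at this
  rw [uVal_mul, uVal_mul, hR.uVal_map, ← hAl, ← hAl', ← hY.coe_degree hR, ← hZ.coe_degree hR,
    ← ENat.natCast_toNat (mt uVal_eq_top_iff.1 hBdet)] at hdet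
  set v := (uVal p B.det).toNat with hv
  have hdet' : v + degree f Z W = degree f Y W + q * v := by exact_mod_cast hdet
  have h2 : 2 * v ≤ q * v := Nat.mul_le_mul_right v hR.two_le
  refine ⟨by omega, fun heq => le_antisymm hZY ?_⟩
  have hv0 : v = 0 := by omega
  have h3 : relLength Y (W ⊔ Submodule.span R (Set.range b')) = 0 := by
    rw [hl, ← ENat.natCast_toNat (mt uVal_eq_top_iff.1 hBdet), ← hv, hv0, Nat.cast_zero]
  refine (relLength_eq_zero_iff.1 h3).trans (sup_le hZ.le (Submodule.span_le.2 ?_))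
  rintro _ ⟨i, rfl⟩
  exact hb'.mem i

end KisinHN

namespace KisinHN

variable {R : Type*} [CommRing R] {φ : R →+* R} {p u E : R} {e q : ℕ}
variable {M : Type*} [AddCommGroup M] [Module R M]

/-! ### Destabilizing submodules -/

/-- A natural number encoding the slope `d / r` and then, in the opposite order, the rank `r`. -/
def slopeKey (N d r : ℕ) : ℕ := d * (N.factorial / r) * (N + 1) + (N - r)

/-- Ranks are at most `N`, so `N !` clears every denominator and `d * (N ! / r)` is `N !` times the
slope. The factor `N + 1` makes room for the second entry `N - r ≤ N` of a lexicographic order. -/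
theorem slopeKey_le_iff {N d r d' r' : ℕ} (hr : 0 < r) (hrN : r ≤ N) (hr' : 0 < r')
    (hrN' : r' ≤ N) : slopeKey N d r ≤ slopeKey N d' r' ↔
      d * r' < d' * r ∨ (d * r' = d' * r ∧ r' ≤ r) := by
  have h1 : N.factorial / r * r = N.factorial := Nat.div_mul_cancel (Nat.dvd_factorial hr hrN)
  have h2 : N.factorial / r' * r' = N.factorial := Nat.div_mul_cancel (Nat.dvd_factorial hr' hrN')
  have hN := Nat.factorial_pos N
  have h3 : d * (N.factorial / r) * (r * r') = d * r' * N.factorial := by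
    calc _ = d * r' * (N.factorial / r * r) := by ring
      _ = _ := by rw [h1]
  have h4 : d' * (N.factorial / r') * (r * r') = d' * r * N.factorial := by
    calc _ = d' * r * (N.factorial / r' * r') := by ring
      _ = _ := by rw [h2]
  have h5 : d * (N.factorial / r) < d' * (N.factorial / r') ↔ d * r' < d' * r := by
    rw [← Nat.mul_lt_mul_right (Nat.mul_pos hr hr'), h3, h4, Nat.mul_lt_mul_right hN]
  have h6 : d * (N.factorial / r) = d' * (N.factorial / r') ↔ d * r' = d' * r := by
    rw [← Nat.mul_left_inj (Nat.mul_pos hr hr').ne', h3, h4, Nat.mul_left_inj hN.ne']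
  rw [← h5, ← h6]
  unfold slopeKey
  set a := d * (N.factorial / r)
  set a' := d' * (N.factorial / r')
  constructor
  · intro h
    rcases lt_trichotomy a a' with h7 | h7 | h7
    · exact Or.inl h7
    · refine Or.inr ⟨h7, ?_⟩
      rw [h7] at h; omega
    · have : (a' + 1) * (N + 1) ≤ a * (N + 1) := Nat.mul_le_mul_right _ h7
      rw [add_mul] at this
      omega
  · rintro (h | ⟨h, h'⟩)
    · have : (a + 1) * (N + 1) ≤ a' * (N + 1) := Nat.mul_le_mul_right _ h
      rw [add_mul] at this
      omega
    · rw [h]; omega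

theorem slopeKey_eq_iff {N d r d' r' : ℕ} (hr : 0 < r) (hrN : r ≤ N) (hr' : 0 < r')
    (hrN' : r' ≤ N) : slopeKey N d r = slopeKey N d' r' ↔ d * r' = d' * r ∧ r = r' := by
  rw [le_antisymm_iff, slopeKey_le_iff hr hrN hr' hrN', slopeKey_le_iff hr' hrN' hr hrN]
  omega

variable (u) in
/-- Among the nonzero stable submodules of `X / W`, the submodule `Y / W` has the least slope,
and the largest rank among those of that slope. -/
structure Destabilizing (f : M →ₛₗ[φ] M) (X W Y : Submodule R M) : Prop where
  lt : W < Y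
  le : Y ≤ X
  stable : Stable f Y
  min : ∀ C : Submodule R M, Stable f C → W < C → C ≤ X →
    degree f Y W * rank u C W < degree f C W * rank u Y W ∨
      (degree f Y W * rank u C W = degree f C W * rank u Y W ∧ rank u C W ≤ rank u Y W)

variable [IsDomain (R ⧸ Ideal.span {p})] [IsDiscreteValuationRing (R ⧸ Ideal.span {p})]
variable {f : M →ₛₗ[φ] M} {W X Y : Submodule R M}

variable [IsNoetherian R M]

/-- Slope and rank are encoded by a natural number, so a minimizer exists by well-foundedness;
uniqueness of the minimizer is not needed. -/
theorem IsPP.exists_destabilizing (hR : FrobeniusDatum φ p u E e q) (h : IsPP p u f X W)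
    (hne : W ≠ X) : ∃ Y, Destabilizing u f X W Y := by
  have hX : W < X := lt_of_le_of_ne h.le hne
  obtain ⟨Y, ⟨hYs, hWY, hYX⟩, hmin⟩ := WellFounded.has_min
    (InvImage.wf (fun C => slopeKey (rank u X W) (degree f C W) (rank u C W)) Nat.lt_wfRel.wf)
    {C : Submodule R M | Stable f C ∧ W < C ∧ C ≤ X} ⟨X, h.stable_left, hX, le_rfl⟩
  refine ⟨Y, hWY, hYX, hYs, fun C hCs hWC hCX => ?_⟩
  have h1 := hmin C ⟨hCs, hWC, hCX⟩
  have hpos : ∀ C : Submodule R M, W < C → C ≤ X → 0 < rank u C W ∧ rank u C W ≤ rank u X W :=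
    fun C hWC hCX => ⟨(h.toIsPM.sub hWC.le hCX).rank_pos hR hWC.ne,
      h.toIsPM.rank_le hR hWC.le hCX⟩
  exact (slopeKey_le_iff (hpos Y hWY hYX).1 (hpos Y hWY hYX).2 (hpos C hWC hCX).1
    (hpos C hWC hCX).2).1 (not_lt.1 h1)

/-- Let `Z` be the `u`-saturation of `Y` in `X`. Some `u ^ m` carries `Z` into `Y`, so both have the
same rank over `W`. If `Z` were larger than `Y`, its degree would be smaller by `IsPP.degree_le`,
and so would its slope, against the choice of `Y`. -/
theorem Destabilizing.u_tf [IsLocalRing R] (hR : FrobeniusDatum φ p u E e q)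
    (h : IsPP p u f X W) (hY : Destabilizing u f X W Y) : ∀ x ∈ X, u • x ∈ Y → x ∈ Y := by
  obtain ⟨Z, m, hYZ, hZX, hZ, hu, hm⟩ := hR.exists_saturation h.stable_left hY.stable hY.le
  have hWZ : W ≤ Z := hY.lt.le.trans hYZ
  have hPZ := h.sub hR hWZ hZX hZ
  have hPY := h.sub hR hY.lt.le hY.le hY.stable
  have h1 : rank u Z W ≤ rank u Y W := by
    obtain ⟨n, b, hb⟩ := hPZ.exists_isPBasis hR.irreducible_u
    have hCY : W ⊔ u ^ m • Z ≤ Y := sup_le hY.lt.le (smul_pointwise_le.2 hm)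
    have hPC : IsPM p u (W ⊔ u ^ m • Z) W := h.toIsPM.sub le_sup_left (hCY.trans hY.le)
    -- The multiples `u ^ m • b i` of a basis of `Z / W` form a basis of a submodule of `Y / W`,
    -- which bounds the rank of `Z / W` by that of `Y / W`.
    have hb' : IsPBasis p (W ⊔ u ^ m • Z) W (fun i => u ^ m • b i) := by
      refine ⟨fun i => Submodule.mem_sup_right
        (Submodule.smul_mem_pointwise_smul _ _ _ (hb.mem i)), ?_, ?_⟩
      · refine sup_le le_sup_left (smul_pointwise_le.2 fun z hz => ?_)
        obtain ⟨c, hc⟩ := hb.exists_coeff hz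
        have h2 : u ^ m • z = u ^ m • (z - ∑ i, c i • b i) + ∑ i, c i • u ^ m • b i := by
          rw [smul_sub, Finset.smul_sum]
          simp only [smul_comm (u ^ m)]
          abel
        rw [h2]
        exact Submodule.add_mem_sup (W.smul_mem _ hc) (Submodule.sum_mem _ fun i _ =>
          Submodule.smul_mem _ _ (Submodule.subset_span ⟨i, rfl⟩))
      · intro c hc
        refine hb.dvd c ?_
        have h2 : ∑ i, c i • u ^ m • b i = u ^ m • ∑ i, c i • b i := by
          rw [Finset.smul_sum]
          simp only [smul_comm (u ^ m)]
        rw [h2] at hc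
        have h3 : ∑ i, c i • b i ∈ Z := Z.sum_mem fun i _ => Z.smul_mem _ (hb.mem i)
        have key : ∀ (k : ℕ) (x : M), x ∈ Z → u ^ k • x ∈ W → x ∈ W := by
          intro k
          induction k with
          | zero => intro x _ hx; simpa using hx
          | succ k ih =>
            intro x hxZ hx
            rw [pow_succ, mul_smul] at hx
            exact hPZ.u_tf x hxZ (ih _ (Z.smul_mem _ hxZ) hx)
        exact key m _ h3 hc
    rw [hPZ.rank_eq hR hb, ← hPC.rank_eq hR hb']
    exact hPY.toIsPM.rank_le hR le_sup_left hCY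
  have h2 : rank u Y W = rank u Z W := le_antisymm (hPZ.toIsPM.rank_le hR hY.lt.le hYZ) h1
  obtain ⟨h3, h4⟩ := hPZ.degree_le hR hPY hYZ h2
  have hpos := hPY.toIsPM.rank_pos hR hY.lt.ne
  have h5 : degree f Y W ≤ degree f Z W := by
    have := hY.min Z hZ (hY.lt.trans_le hYZ) hZX
    rw [← h2] at this
    rcases this with h6 | h6
    · exact (Nat.lt_of_mul_lt_mul_right h6).le
    · exact (Nat.eq_of_mul_eq_mul_right hpos h6.1).le
  rw [h4 (le_antisymm h3 h5)]
  exact hu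

omit [IsNoetherian R M] in
omit [IsDomain (R ⧸ Ideal.span {p})] [IsDiscreteValuationRing (R ⧸ Ideal.span {p})] in
theorem rank_self (u : R) (Y : Submodule R M) : rank u Y Y = 0 := by
  rw [rank, relLength_eq_zero_iff.2 le_sup_left, ENat.toNat_zero]

omit [IsNoetherian R M] in
omit [IsDomain (R ⧸ Ideal.span {p})] [IsDiscreteValuationRing (R ⧸ Ideal.span {p})] in
theorem degree_self (f : M →ₛₗ[φ] M) (Y : Submodule R M) : degree f Y Y = 0 := by
  rw [degree, relLength_eq_zero_iff.2 le_sup_left, ENat.toNat_zero]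

/-! ### The elementary modification along a destabilizing submodule -/

section Step

variable [IsLocalRing R] {B : Submodule R M}

/-- The input of one modification: `X / B` is `p`-torsion free and `Y` destabilizes its reduction.
The output is the lattice `Y`, which lies between `B + pX` and `X`. -/
structure StepData (p u : R) (f : M →ₛₗ[φ] M) (B X Y : Submodule R M) : Prop where
  stable_bot : Stable f B
  bot_le : B ≤ X
  p_tf : ∀ x ∈ X, p • x ∈ B → x ∈ B
  isPP : IsPP p u f X (B ⊔ p • X)
  destabilizing : Destabilizing u f X (B ⊔ p • X) Y

namespace StepData

variable (hR : FrobeniusDatum φ p u E e q) (h : StepData p u f B X Y)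

omit [IsNoetherian R M] [IsLocalRing R] [IsDomain (R ⧸ Ideal.span {p})]
  [IsDiscreteValuationRing (R ⧸ Ideal.span {p})] in
include h in
theorem bot_le' : B ≤ Y := le_sup_left.trans h.destabilizing.lt.le

include hR h

theorem isPP_quotient : IsPP p u f X Y :=
  h.isPP.quotient h.destabilizing.lt.le h.destabilizing.le h.destabilizing.stable
    (h.destabilizing.u_tf hR h.isPP)

omit [IsLocalRing R] in
theorem isPP_sub : IsPP p u f Y (B ⊔ p • X) :=
  h.isPP.sub hR h.destabilizing.lt.le h.destabilizing.le h.destabilizing.stable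

theorem isPP_mul : IsPP p u f (B ⊔ p • X) (B ⊔ p • Y) :=
  (h.isPP_quotient hR).sup_smul hR h.stable_bot h.bot_le' h.p_tf

/-- The reduction of `Y / B` is an extension of `Y / (B + pX)` by `(B + pX) / (B + pY) ≅ X / Y`.
These are the two constituents of the reduction of `X / B` in the opposite order, which is why rank
and degree do not change. -/
theorem isPP_modification : IsPP p u f Y (B ⊔ p • Y) :=
  (h.isPP_sub hR).ext (h.isPP_mul hR) fun _ hy =>
    Submodule.mem_sup_right (Submodule.smul_mem_pointwise_smul _ _ _ hy)

theorem rank_modification : rank u Y (B ⊔ p • Y) = rank u X (B ⊔ p • X) := by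
  rw [(h.isPP_modification hR).rank_add hR (h.isPP_sub hR) (h.isPP_mul hR),
    rank_sup_smul h.bot_le' h.destabilizing.le h.p_tf,
    h.isPP.rank_add hR (h.isPP_quotient hR) (h.isPP_sub hR), add_comm]

theorem degree_modification : degree f Y (B ⊔ p • Y) = degree f X (B ⊔ p • X) := by
  rw [(h.isPP_modification hR).degree_add hR (h.isPP_sub hR) (h.isPP_mul hR),
    degree_sup_smul hR h.stable_bot h.isPP.stable_left h.bot_le' h.destabilizing.le h.p_tf,
    h.isPP.degree_add hR (h.isPP_quotient hR) (h.isPP_sub hR), add_comm]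

/-- The slopes of the stable submodules of the modification are at least the slope of the
destabilizing submodule; in the extremal case the destabilizing submodule splits off. -/
theorem slope_le {C : Submodule R M} (hC : Stable f C) (hlt : B ⊔ p • Y < C) (hCY : C ≤ Y) :
    degree f Y (B ⊔ p • X) * rank u C (B ⊔ p • Y) <
        degree f C (B ⊔ p • Y) * rank u Y (B ⊔ p • X) ∨
      (degree f Y (B ⊔ p • X) * rank u C (B ⊔ p • Y) =
          degree f C (B ⊔ p • Y) * rank u Y (B ⊔ p • X) ∧
        rank u C (B ⊔ p • Y) ≤ rank u Y (B ⊔ p • X) ∧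
        (rank u C (B ⊔ p • Y) = rank u Y (B ⊔ p • X) →
          C ⊔ (B ⊔ p • X) = Y ∧ C ⊓ (B ⊔ p • X) ≤ B ⊔ p • Y)) := by
  set W := B ⊔ p • X with hW
  have hD : Destabilizing u f X W Y := h.destabilizing
  have hCW : C ⊔ W ≤ Y := sup_le hCY hD.lt.le
  have hP2 : IsPP p u f (C ⊔ W) W :=
    (h.isPP_sub hR).sub hR le_sup_right hCW (hC.sup h.isPP.stable_right)
  have hPC := (h.isPP_modification hR).sub hR hlt.le hCY hC
  have hle : B ⊔ p • Y ≤ C ⊓ W :=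
    le_inf hlt.le (sup_le_sup_left (smul_pointwise_mono p hD.le) _)
  have hP1 := (h.isPP_modification hR).sub hR hle (inf_le_left.trans hCY)
    (hC.inf h.isPP.stable_right)
  -- Rank and degree of `C / (B + pY)` are cut into the contribution of its image `(C + W) / W` in
  -- `Y / W` and that of its part `(C ∩ W) / (B + pY)` inside `W / (B + pY)`.
  have hrC := hPC.rank_add hR (hP2.inf hC) hP1
  have hdC := hPC.degree_add hR (hP2.inf hC) hP1
  rw [← rank_sup] at hrC
  rw [← degree_sup hC h.isPP.stable_right] at hdC
  -- Under `X / Y ≅ W / (B + pY)`, multiplication by `p`, the part `C ∩ W` corresponds to `Z / Y`.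
  -- This makes `Z` a stable submodule of `X`, to which the choice of `Y` applies.
  let Z : Submodule R M := X ⊓ C.comap (LinearMap.lsmul R M p)
  have hZmem : ∀ x, x ∈ Z ↔ x ∈ X ∧ p • x ∈ C := fun x => Iff.rfl
  have hZs : Stable f Z := by
    intro x hx
    rw [hZmem] at hx ⊢
    refine ⟨h.isPP.stable_left x hx.1, ?_⟩
    have := hC _ hx.2
    rwa [f.map_smulₛₗ, hR.map_p] at this
  have hYZ : Y ≤ Z := fun y hy => (hZmem y).2 ⟨hD.le hy, hlt.le (Submodule.mem_sup_right
    (Submodule.smul_mem_pointwise_smul _ _ _ hy))⟩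
  have hZX : Z ≤ X := inf_le_left
  have hCZ : C ⊓ W = B ⊔ p • Z := by
    apply le_antisymm
    · rintro x ⟨hx, hx'⟩
      obtain ⟨a, ha, hb⟩ := mem_sup_smul.1 hx'
      refine mem_sup_smul.2 ⟨a, (hZmem a).2 ⟨ha, ?_⟩, hb⟩
      have := C.sub_mem hx (hlt.le (Submodule.mem_sup_left hb))
      simpa using this
    · refine sup_le (le_inf (le_sup_left.trans hlt.le) le_sup_left) (le_inf ?_ ?_)
      · exact smul_pointwise_le.2 fun z hz => hz.2
      · exact (smul_pointwise_mono p hZX).trans le_sup_right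
  have hpZ : ∀ x ∈ Z, p • x ∈ B → x ∈ B := fun x hx => h.p_tf x (hZX hx)
  rw [hCZ, rank_sup_smul h.bot_le' hYZ hpZ] at hrC
  rw [hCZ, degree_sup_smul hR h.stable_bot hZs h.bot_le' hYZ hpZ] at hdC
  have hr : 0 < rank u Y W := (h.isPP_sub hR).toIsPM.rank_pos hR hD.lt.ne
  have hPZ : IsPP p u f Z Y := (h.isPP_quotient hR).sub hR hYZ hZX hZs
  -- If `Z ≠ Y`, then `Z / W` has larger rank than `Y / W`; as `Y` has the largest rank among
  -- submodules of least slope, the slope of `Z / W`, hence that of `Z / Y`, is strictly larger than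
  -- that of `Y / W`.
  have hZ1 : (Z = Y ∧ rank u Z Y = 0 ∧ degree f Z Y = 0) ∨
      degree f Y W * rank u Z Y < degree f Z Y * rank u Y W := by
    by_cases hZY : Z = Y
    · left
      refine ⟨hZY, ?_, ?_⟩
      · rw [hZY, rank_self]
      · rw [hZY, degree_self]
    · right
      have hpos := hPZ.toIsPM.rank_pos hR (Ne.symm hZY)
      have hPZW := h.isPP.sub hR (hD.lt.le.trans hYZ) hZX hZs
      have h1 := hD.min Z hZs (hD.lt.trans_le hYZ) hZX
      rw [hPZW.rank_add hR hPZ (h.isPP_sub hR), hPZW.degree_add hR hPZ (h.isPP_sub hR)] at h1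
      simp only [← hW] at h1
      rw [mul_add, add_mul] at h1
      omega
  have hC2 : (rank u (C ⊔ W) W = 0 ∧ degree f (C ⊔ W) W = 0) ∨
      degree f Y W * rank u (C ⊔ W) W ≤ degree f (C ⊔ W) W * rank u Y W := by
    by_cases hCW' : W = C ⊔ W
    · left
      rw [← hCW', rank_self, degree_self]
      exact ⟨rfl, rfl⟩
    · right
      rcases hD.min (C ⊔ W) (hC.sup h.isPP.stable_right) (lt_of_le_of_ne le_sup_right hCW')
        (hCW.trans hD.le) with h1 | h1
      · exact h1.le
      · exact h1.1.le
  have hr2 : rank u (C ⊔ W) W ≤ rank u Y W := (h.isPP_sub hR).toIsPM.rank_le hR le_sup_right hCW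
  rw [hrC, hdC, mul_add, add_mul]
  rcases hZ1 with ⟨hZY, hZr, hZd⟩ | hlt1
  · rw [hZr, hZd]
    simp only [mul_zero, zero_mul, add_zero]
    have h2 : degree f Y W * rank u (C ⊔ W) W ≤ degree f (C ⊔ W) W * rank u Y W := by
      rcases hC2 with h3 | h3
      · rw [h3.1, h3.2]; simp
      · exact h3
    rcases h2.lt_or_eq with h3 | h3
    · exact Or.inl h3
    -- Equality of slopes forces `Z = Y`, so `C ∩ W` is as small as possible. If also the ranks
    -- agree, then `C + W` has the rank and degree of `Y` over `W`, and `IsPP.degree_le` gives `C +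
    -- W = Y`.
    · refine Or.inr ⟨h3, hr2, fun h4 => ⟨?_, ?_⟩⟩
      · rw [h4] at h3
        exact ((h.isPP_sub hR).degree_le hR hP2 hCW h4).2 (Nat.eq_of_mul_eq_mul_right hr h3)
      · rw [hCZ, hZY]
  · left
    rcases hC2 with h3 | h3
    · rw [h3.1, h3.2]; simpa using hlt1
    · exact add_lt_add_of_le_of_lt h3 hlt1

end StepData

end Step

end KisinHN

namespace KisinHN

variable {R : Type*} [CommRing R] {φ : R →+* R} {p u E : R} {e q : ℕ}
variable {M : Type*} [AddCommGroup M] [Module R M]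

/-! ### Flat subquotients -/

variable (p u) in
/-- `Y / Z` is flat: `(p, u)` is a regular sequence on it. -/
structure IsFlatPair (Y Z : Submodule R M) : Prop where
  le : Z ≤ Y
  p_tf : ∀ y ∈ Y, p • y ∈ Z → y ∈ Z
  isPM : IsPM p u Y (Z ⊔ p • Y)

variable (E) in
/-- The cokernel of the linearized Frobenius of `Y` is killed by a power of `E`. -/
def GoodFrob (f : M →ₛₗ[φ] M) (Y : Submodule R M) : Prop :=
  ∃ h : ℕ, ∀ y ∈ Y, E ^ h • y ∈ frobSpan f Y

theorem GoodFrob.of_inf_le {f : M →ₛₗ[φ] M} {Y Z : Submodule R M} (h : GoodFrob E f Y)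
    (hZY : Z ≤ Y) (hinj : Z ⊓ frobSpan f Y ≤ frobSpan f Z) : GoodFrob E f Z := by
  obtain ⟨k, hk⟩ := h
  exact ⟨k, fun z hz => hinj ⟨Z.smul_mem _ hz, hk z (hZY hz)⟩⟩

variable [IsDomain (R ⧸ Ideal.span {p})] [IsDiscreteValuationRing (R ⧸ Ideal.span {p})]
variable {f : M →ₛₗ[φ] M} {W X Y Z : Submodule R M}

/-- On `Y / Z`, which is killed by `p`, the element `E ^ k` acts as `u ^ (e * k)`. -/
theorem IsPM.isPP (hR : FrobeniusDatum φ p u E e q) (h : IsPM p u Y Z) (hY : Stable f Y)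
    (hZ : Stable f Z) (hG : ∃ h : ℕ, ∀ y ∈ Y, E ^ h • y ∈ Z ⊔ frobSpan f Y) :
    IsPP p u f Y Z where
  toIsPM := h
  stable_left := hY
  stable_right := hZ
  nondeg := by
    obtain ⟨k, hk⟩ := hG
    refine ⟨e * k, fun y hy => ?_⟩
    obtain ⟨c, hc⟩ := hR.dvd_E_pow_sub k
    have h1 : u ^ (e * k) • y = E ^ k • y - c • p • y := by
      rw [smul_smul, mul_comm c, ← hc, ← sub_smul, sub_sub_cancel]
    rw [h1]
    exact sub_mem (hk y hy) (Submodule.mem_sup_left (Z.smul_mem _ (h.p_mem y hy)))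

theorem GoodFrob.sup (h : GoodFrob E f Y) (Z : Submodule R M) :
    ∃ h : ℕ, ∀ y ∈ Y, E ^ h • y ∈ Z ⊔ frobSpan f Y := by
  obtain ⟨k, hk⟩ := h
  exact ⟨k, fun y hy => Submodule.mem_sup_right (hk y hy)⟩

theorem stable_sup_smul (hR : FrobeniusDatum φ p u E e q) (hY : Stable f Y) (hZ : Stable f Z) :
    Stable f (Z ⊔ p • Y) :=
  hZ.sup (hY.smul_dvd (by rw [hR.map_p]))

section Nakayama

variable [IsLocalRing R] [IsNoetherian R M]

theorem le_of_le_sup_smul (hR : FrobeniusDatum φ p u E e q) (h : Y ≤ Z ⊔ p • Y) : Y ≤ Z := by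
  refine Submodule.le_of_le_smul_of_le_jacobson_bot (I := Ideal.span {p})
    (IsNoetherian.noetherian Y) ?_ ?_
  · refine (IsLocalRing.le_maximalIdeal ?_).trans (IsLocalRing.maximalIdeal_le_jacobson _)
    rw [Ne, Ideal.span_singleton_eq_top]
    exact hR.prime_p.not_isUnit
  · rwa [Submodule.ideal_span_singleton_smul]

theorem IsFlatPair.le_sup_span (hR : FrobeniusDatum φ p u E e q) {n : ℕ} {b : Fin n → M}
    (hb : IsPBasis p Y (Z ⊔ p • Y) b) : Y ≤ Z ⊔ Submodule.span R (Set.range b) := by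
  refine le_of_le_sup_smul hR (hb.le.trans ?_)
  exact sup_le (sup_le (le_sup_left.trans le_sup_left) le_sup_right)
    (le_sup_right.trans le_sup_left)

end Nakayama

section Domain

variable [IsDomain R] [IsNoetherianRing R]

theorem FrobeniusDatum.eq_zero_of_forall_dvd (hR : FrobeniusDatum φ p u E e q) {c : R}
    (hc : ∀ n : ℕ, p ^ n ∣ c) : c = 0 := by
  by_contra h
  obtain ⟨n, hn⟩ := FiniteMultiplicity.of_not_isUnit hR.prime_p.not_isUnit h
  exact hn (hc _)

/-- A family that is independent modulo `p` in a `p`-torsion free subquotient is independent. -/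
theorem IsFlatPair.eq_zero_of_sum_mem (hR : FrobeniusDatum φ p u E e q)
    (h : IsFlatPair p u Y Z) {n : ℕ} {g : Fin n → M} (hg : ∀ i, g i ∈ Y)
    (hdvd : ∀ c : Fin n → R, ∑ i, c i • g i ∈ Z → ∀ i, p ∣ c i)
    {c : Fin n → R} (hc : ∑ i, c i • g i ∈ Z) : c = 0 := by
  have key : ∀ (k : ℕ) (c : Fin n → R), ∑ i, c i • g i ∈ Z → ∀ i, p ^ k ∣ c i := by
    intro k
    induction k with
    | zero => intro c _ i; simp
    | succ k ih =>
      intro c hc i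
      choose d hd using hdvd c hc
      have h1 : ∑ i, c i • g i = p • ∑ i, d i • g i := by
        rw [Finset.smul_sum]
        exact Finset.sum_congr rfl fun i _ => by rw [smul_smul, ← hd]
      rw [h1] at hc
      rw [hd i, pow_succ']
      exact mul_dvd_mul_left p (ih d (h.p_tf _ (Y.sum_mem fun i _ => Y.smul_mem _ (hg i)) hc) i)
  exact funext fun i => hR.eq_zero_of_forall_dvd fun k => key k c hc i

variable [IsLocalRing R] [IsNoetherian R M]

/-- The `p`-torsion free counterpart of `IsPP.inf_frobSpan_le`: a relation between the `f (b j)`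
modulo `Z` has coefficients divisible by `p`, can be divided by `p` and used again, so the
coefficients vanish. -/
theorem IsFlatPair.inf_frobSpan_le (hR : FrobeniusDatum φ p u E e q) (h : IsFlatPair p u Y Z)
    (hZ : Stable f Z) (hPP : IsPP p u f Y (Z ⊔ p • Y)) : Z ⊓ frobSpan f Y ≤ frobSpan f Z := by
  obtain ⟨n, b, hb⟩ := hPP.exists_isPBasis hR.irreducible_u
  obtain ⟨A, hA, hdet, -⟩ := hPP.exists_matrix hR hb
  have h1 : frobSpan f Y ≤ frobSpan f Z ⊔ Submodule.span R (Set.range (f ∘ b)) := by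
    refine (frobSpan_mono (IsFlatPair.le_sup_span hR hb)).trans ?_
    rw [frobSpan_sup, frobSpan_span, Set.range_comp]
  rintro x ⟨hx, hx'⟩
  obtain ⟨z, hz, w, hw, rfl⟩ := Submodule.mem_sup.1 (h1 hx')
  obtain ⟨c, rfl⟩ := (Submodule.mem_span_range_iff_exists_fun R).1 hw
  have h2 : ∑ j, c j • (f ∘ b) j ∈ Z := by
    have := Z.sub_mem hx (hZ.frobSpan_le hz)
    simpa using this
  have h3 : c = 0 := h.eq_zero_of_sum_mem hR (fun i => hPP.stable_left _ (hb.mem i))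
    (fun c hc => hb.dvd_of_sum_mem hA hdet (Submodule.mem_sup_left hc)) h2
  simpa [h3] using hz

end Domain

/-! ### Convergence -/

/-- Convergence of the series `∑ p ^ i • z i` inside `X`: it is summed coefficientwise on finitely
many generators, using `p`-adic precompleteness of `R`. The remainders are kept as `p ^ n` times
elements of `X` itself. -/
theorem FrobeniusDatum.exists_sum [IsNoetherian R M] (hR : FrobeniusDatum φ p u E e q)
    (z : ℕ → M) (hz : ∀ i, z i ∈ X) :
    ∃ s ∈ X, ∀ n, ∃ w ∈ X, s - ∑ i ∈ Finset.range n, p ^ i • z i = p ^ n • w := by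
  obtain ⟨k, g, hg⟩ := Submodule.fg_iff_exists_fin_generating_family.1
    (IsNoetherian.noetherian X)
  have h1 : ∀ i, ∃ c : Fin k → R, ∑ j, c j • g j = z i := fun i =>
    (Submodule.mem_span_range_iff_exists_fun R).1 (hg ▸ hz i)
  choose c hc using h1
  have hgX : ∀ j, g j ∈ X := fun j => hg ▸ Submodule.subset_span ⟨j, rfl⟩
  have h2 : ∀ j, ∃ L : R, ∀ n, p ^ n ∣ L - ∑ i ∈ Finset.range n, p ^ i * c i j := by
    intro j
    obtain ⟨L, hL⟩ := hR.precomplete.prec (f := fun n => ∑ i ∈ Finset.range n, p ^ i * c i j) (by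
      intro m n hmn
      rw [SModEq.sub_mem, Ideal.span_singleton_pow, smul_eq_mul, Ideal.mul_top,
        Ideal.mem_span_singleton, ← dvd_neg, neg_sub, ← Finset.sum_Ico_eq_sub _ hmn]
      exact Finset.dvd_sum fun i hi => Dvd.dvd.mul_right
        (pow_dvd_pow _ (Finset.mem_Ico.1 hi).1) _)
    refine ⟨L, fun n => ?_⟩
    have := hL n
    rwa [SModEq.sub_mem, Ideal.span_singleton_pow, smul_eq_mul, Ideal.mul_top,
        Ideal.mem_span_singleton, ← dvd_neg, neg_sub] at this
  choose L hL using h2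
  refine ⟨∑ j, L j • g j, X.sum_mem fun j _ => X.smul_mem _ (hgX j), fun n => ?_⟩
  choose d hd using fun j => hL j n
  refine ⟨∑ j, d j • g j, X.sum_mem fun j _ => X.smul_mem _ (hgX j), ?_⟩
  have h3 : ∑ i ∈ Finset.range n, p ^ i • z i =
      ∑ j, (∑ i ∈ Finset.range n, p ^ i * c i j) • g j := by
    simp only [← hc, Finset.smul_sum, Finset.sum_smul, smul_smul]
    rw [Finset.sum_comm]
  rw [h3, ← Finset.sum_sub_distrib, Finset.smul_sum]
  exact Finset.sum_congr rfl fun j _ => by rw [← sub_smul, hd, smul_smul]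

end KisinHN

namespace KisinHN

variable {R : Type*} [CommRing R] {φ : R →+* R} {p u E : R} {e q : ℕ}
variable {M : Type*} [AddCommGroup M] [Module R M]
variable {f : M →ₛₗ[φ] M} {A B W X Y Z : Submodule R M}

/-! ### The limit of a sequence of modifications -/

section Limit

/-- A sequence of lattices `X (n + 1) ⊆ X n` over `B` such that
`X (n + 2) / (B + p X (n + 1)) → X (n + 1) / (B + p X n)` is bijective. -/
structure IsSplitSeq (p : R) (B : Submodule R M) (X : ℕ → Submodule R M) : Prop where
  bot_le : ∀ n, B ≤ X n
  p_tf : ∀ x ∈ X 0, p • x ∈ B → x ∈ B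
  anti : ∀ n, X (n + 1) ≤ X n
  smul_le : ∀ n, p • X n ≤ X (n + 1)
  sup_eq : ∀ n, X (n + 2) ⊔ (B ⊔ p • X n) = X (n + 1)
  inf_le : ∀ n, X (n + 2) ⊓ (B ⊔ p • X n) ≤ B ⊔ p • X (n + 1)

variable {X : ℕ → Submodule R M} (h : IsSplitSeq p B X)
include h

namespace IsSplitSeq

theorem antitone : Antitone X := antitone_nat_of_succ_le h.anti

theorem pow_smul_mem (i n : ℕ) {x : M} (hx : x ∈ X n) : p ^ i • x ∈ X (n + i) := by
  induction i with
  | zero => simpa using hx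
  | succ i ih =>
    rw [pow_succ', mul_smul]
    exact h.smul_le _ (Submodule.smul_mem_pointwise_smul _ _ _ ih)

/-- Write `x = y + p z` modulo `B` with `y ∈ X (n + 2)` and `z ∈ X n`, then decompose `z` in the
same way. Each round trades one index of `z` for one factor `p`, and the parts split off, multiplied
by powers of `p`, stay in `X (n + 2)`. -/
theorem exists_approx (n : ℕ) {x : M} (hx : x ∈ X (n + 1)) :
    ∃ y ∈ X (n + 2), ∃ z ∈ X 0, x - y = p ^ (n + 1) • z := by
  have key : ∀ j, j ≤ n → ∃ y ∈ X (n + 2), ∃ z ∈ X (n - j), x - y = p ^ (j + 1) • z := by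
    intro j
    induction j with
    | zero =>
      intro _
      rw [← h.sup_eq] at hx
      obtain ⟨y, hy, w, hw, rfl⟩ := Submodule.mem_sup.1 hx
      obtain ⟨z, hz, hb⟩ := mem_sup_smul.1 hw
      exact ⟨y + (w - p • z), add_mem hy (h.bot_le _ hb), z, hz, by simp⟩
    | succ j ih =>
      intro hj
      obtain ⟨y, hy, z, hz, hyz⟩ := ih (by omega)
      obtain ⟨m, hm⟩ : ∃ m, n - j = m + 1 := ⟨n - j - 1, by omega⟩
      rw [hm, ← h.sup_eq] at hz
      obtain ⟨z', hz', w, hw, rfl⟩ := Submodule.mem_sup.1 hz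
      obtain ⟨z'', hz'', hb⟩ := mem_sup_smul.1 hw
      have h1 := h.pow_smul_mem (j + 1) (m + 2) hz'
      rw [show m + 2 + (j + 1) = n + 2 by omega] at h1
      refine ⟨y + p ^ (j + 1) • z' + p ^ (j + 1) • (w - p • z''),
        add_mem (add_mem hy h1) (Submodule.smul_mem _ _ (h.bot_le _ hb)), z'', ?_, ?_⟩
      · rwa [show n - (j + 1) = m by omega]
      · rw [pow_succ p (j + 1), mul_smul, ← sub_sub, ← sub_sub, hyz, smul_add, smul_sub]
        abel
  simpa using key n le_rfl

theorem inf_sup_le (n : ℕ) : X (n + 1) ⊓ (B ⊔ p • X 0) ≤ B ⊔ p • X n := by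
  induction n with
  | zero => exact inf_le_right
  | succ n ih =>
    rintro x ⟨hx, hx'⟩
    exact h.inf_le n ⟨hx, ih ⟨h.anti _ hx, hx'⟩⟩

/-- If `x = p y` modulo `B` lies in every `X n`, then for each `n` also `x = p z` modulo `B` with `z
∈ X n`. Absence of `p`-torsion gives `y - z ∈ B`, so `y ∈ X n` for every `n`. -/
theorem iInf_inf_le : (⨅ n, X n) ⊓ (B ⊔ p • X 0) ≤ B ⊔ p • ⨅ n, X n := by
  rintro x ⟨hx, hx'⟩
  obtain ⟨y, hy, hb⟩ := mem_sup_smul.1 hx'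
  refine mem_sup_smul.2 ⟨y, ?_, hb⟩
  replace hx : x ∈ ⨅ n, X n := hx
  rw [Submodule.mem_iInf] at hx ⊢
  intro n
  obtain ⟨z, hz, hb'⟩ := mem_sup_smul.1 (h.inf_sup_le n ⟨hx (n + 1), hx'⟩)
  have h1 : y - z ∈ B := by
    refine h.p_tf _ (sub_mem hy (h.antitone (Nat.zero_le n) hz)) ?_
    have := sub_mem hb' hb
    rwa [sub_sub_sub_cancel_left, ← smul_sub] at this
  have := add_mem (h.bot_le n h1) hz
  simpa using this

variable [IsDomain (R ⧸ Ideal.span {p})] [IsDiscreteValuationRing (R ⧸ Ideal.span {p})]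
  [IsNoetherian R M]

/-- An element `x` of `X 1` is corrected step by step to `s n ∈ X (n + 1)`, with total correction `p
∑ p ^ i z i`. The series converges to some `t ∈ X 0`, and `x - p t` lies in every term of the
sequence. -/
theorem iInf_sup_eq (hR : FrobeniusDatum φ p u E e q) :
    (⨅ n, X n) ⊔ (B ⊔ p • X 0) = X 1 := by
  apply le_antisymm
  · exact sup_le (iInf_le _ 1) (sup_le (h.bot_le 1) (h.smul_le 0))
  · intro x hx
    choose! next hnext z hz hsub using fun n (x : M) (hx : x ∈ X (n + 1)) => h.exists_approx n hx
    let s : ℕ → M := fun n => Nat.rec x (fun n y => next n y) n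
    have hs : ∀ n, s n ∈ X (n + 1) := by
      intro n
      induction n with
      | zero => exact hx
      | succ n ih => exact hnext n _ ih
    obtain ⟨t, ht, htw⟩ := hR.exists_sum (fun i => z i (s i)) fun i => hz i _ (hs i)
    have hsum : ∀ n, x - s n = p • ∑ i ∈ Finset.range n, p ^ i • z i (s i) := by
      intro n
      induction n with
      | zero => simp [s]
      | succ n ih =>
        rw [Finset.sum_range_succ, smul_add, ← ih, smul_smul, ← pow_succ', ← hsub n _ (hs n)]
        simp only [s]
        abel
    have hlim : x - p • t ∈ ⨅ n, X n := by
      rw [Submodule.mem_iInf]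
      intro n
      obtain ⟨w, hw, htw⟩ := htw n
      -- The tail of the series is `p ^ (n + 1)` times an element of `X 0`, hence lies in `X (n +
      -- 1)`.
      have h1 : x - p • t = s n - p ^ (n + 1) • w := by
        have : x = s n + p • ∑ i ∈ Finset.range n, p ^ i • z i (s i) := by rw [← hsum]; abel
        rw [pow_succ', mul_smul, ← htw, smul_sub]
        nth_rw 1 [this]
        abel
      rw [h1]
      refine sub_mem (h.anti _ (hs n)) (h.antitone (Nat.le_succ n) ?_)
      simpa using h.pow_smul_mem (n + 1) 0 hw
    have := Submodule.add_mem_sup hlim (Submodule.mem_sup_right (S := B)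
      (Submodule.smul_mem_pointwise_smul t p (X 0) ht))
    simpa using this

end IsSplitSeq

end Limit

/-! ### Existence of the first step of the filtration -/

section Exists

variable (E u p) in
/-- The lattices of `A / B` considered in the construction: those reached from `A` by
modifications, all of whose stable submodules modulo `p` have slope larger than `μ`. -/
structure Admissible (f : M →ₛₗ[φ] M) (A B : Submodule R M) (μ : ℚ) (N D : ℕ)
    (X : Submodule R M) : Prop where
  bot_le : B ≤ X
  le : X ≤ A
  isPP : IsPP p u f X (B ⊔ p • X)
  good : GoodFrob E f X
  pow_smul : ∃ a : ℕ, ∀ x ∈ A, p ^ a • x ∈ X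
  u_tf : ∀ x ∈ A, u • x ∈ X → x ∈ X
  rank_eq : rank u X (B ⊔ p • X) = N
  degree_eq : degree f X (B ⊔ p • X) = D
  slope_lt : ∀ C : Submodule R M, Stable f C → B ⊔ p • X < C → C ≤ X →
    μ * rank u C (B ⊔ p • X) < degree f C (B ⊔ p • X)

variable [IsDomain (R ⧸ Ideal.span {p})] [IsDiscreteValuationRing (R ⧸ Ideal.span {p})]
  [IsNoetherian R M] [IsLocalRing R] {μ : ℚ} {N D : ℕ}

/-- The bound `μ` survives because, by `StepData.slope_le`, submodules of the new reduction have
slope at least that of `Y / (B + pX)`, which exceeds `μ` since `Y` is a stable submodule of `X`. -/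
theorem Admissible.modification (hR : FrobeniusDatum φ p u E e q)
    (hX : Admissible p u E f A B μ N D X) (h : StepData p u f B X Y) :
    Admissible p u E f A B μ N D Y where
  bot_le := h.bot_le'
  le := h.destabilizing.le.trans hX.le
  isPP := h.isPP_modification hR
  good := hX.good.of_inf_le h.destabilizing.le ((h.isPP_quotient hR).inf_frobSpan_le hR)
  pow_smul := by
    obtain ⟨a, ha⟩ := hX.pow_smul
    refine ⟨a + 1, fun x hx => ?_⟩
    rw [pow_succ', mul_smul]
    exact h.destabilizing.lt.le (Submodule.mem_sup_right
      (Submodule.smul_mem_pointwise_smul _ _ _ (ha x hx)))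
  u_tf x hx hu := (h.isPP_quotient hR).u_tf x (hX.u_tf x hx (h.destabilizing.le hu)) hu
  rank_eq := by rw [h.rank_modification hR, hX.rank_eq]
  degree_eq := by rw [h.degree_modification hR, hX.degree_eq]
  slope_lt C hC hlt hle := by
    have h1 := hX.slope_lt Y h.destabilizing.stable h.destabilizing.lt h.destabilizing.le
    have hr : 0 < rank u Y (B ⊔ p • X) :=
      (h.isPP_sub hR).toIsPM.rank_pos hR h.destabilizing.lt.ne
    have hr' : 0 < rank u C (B ⊔ p • Y) :=
      ((h.isPP_modification hR).toIsPM.sub hlt.le hle).rank_pos hR hlt.ne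
    have h2 : degree f Y (B ⊔ p • X) * rank u C (B ⊔ p • Y) ≤
        degree f C (B ⊔ p • Y) * rank u Y (B ⊔ p • X) := by
      rcases h.slope_le hR hC hlt hle with h3 | h3
      · exact h3.le
      · exact h3.1.le
    have h2' : (degree f Y (B ⊔ p • X) : ℚ) * rank u C (B ⊔ p • Y) ≤
        degree f C (B ⊔ p • Y) * rank u Y (B ⊔ p • X) := by exact_mod_cast h2
    have hr0 : (0 : ℚ) < rank u Y (B ⊔ p • X) := by exact_mod_cast hr
    have hr0' : (0 : ℚ) < rank u C (B ⊔ p • Y) := by exact_mod_cast hr'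
    have h3 := mul_lt_mul_of_pos_right h1 hr0'
    refine lt_of_mul_lt_mul_right ?_ hr0.le
    calc _ = μ * rank u Y (B ⊔ p • X) * rank u C (B ⊔ p • Y) := by ring
      _ < _ := h3
      _ ≤ _ := h2'

omit [IsDomain (R ⧸ Ideal.span {p})] [IsDiscreteValuationRing (R ⧸ Ideal.span {p})]
  [IsNoetherian R M] [IsLocalRing R] in
theorem Admissible.stepData (hB : Stable f B) (hp : ∀ x ∈ A, p • x ∈ B → x ∈ B)
    (hX : Admissible p u E f A B μ N D X) (hY : Destabilizing u f X (B ⊔ p • X) Y) :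
    StepData p u f B X Y :=
  ⟨hB, hX.bot_le, fun x hx => hp x (hX.le hx), hX.isPP, hY⟩

/-- There is an infinite sequence of modifications in which every destabilizing submodule
splits off. -/
theorem exists_isSplitSeq (hR : FrobeniusDatum φ p u E e q) (hB : Stable f B)
    (hp : ∀ x ∈ A, p • x ∈ B → x ∈ B) (hN : 0 < N) (hA : Admissible p u E f A B μ N D A) :
    ∃ X : ℕ → Submodule R M, IsSplitSeq p B X ∧ ∀ n, Admissible p u E f A B μ N D (X n) ∧
      Destabilizing u f (X n) (B ⊔ p • X n) (X (n + 1)) := by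
  have hex : ∀ X, Admissible p u E f A B μ N D X →
      ∃ Y, Destabilizing u f X (B ⊔ p • X) Y := by
    intro X hX
    refine hX.isPP.exists_destabilizing hR fun h => ?_
    have := hX.rank_eq
    rw [h, rank_self] at this
    omega
  let key : Submodule R M × Submodule R M → ℕ := fun s =>
    slopeKey N (degree f s.2 (B ⊔ p • s.1)) (rank u s.2 (B ⊔ p • s.1))
  let S : Set (Submodule R M × Submodule R M) := {s | Admissible p u E f A B μ N D s.1 ∧
    Destabilizing u f s.1 (B ⊔ p • s.1) s.2}
  have hpos : ∀ s ∈ S, 0 < rank u s.2 (B ⊔ p • s.1) ∧ rank u s.2 (B ⊔ p • s.1) ≤ N := by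
    rintro ⟨X, Y⟩ ⟨hX, hY⟩
    refine ⟨(hX.isPP.toIsPM.sub hY.lt.le hY.le).rank_pos hR hY.lt.ne, ?_⟩
    rw [← hX.rank_eq]
    exact hX.isPP.toIsPM.rank_le hR hY.lt.le hY.le
  -- The degree of `X / Y` is nonnegative, so that of the destabilizing submodule is at most `D`;
  -- `D` is the same for all admissible lattices.
  have hbdd : BddAbove (key '' S) := by
    refine ⟨D * N.factorial * (N + 1) + N, ?_⟩
    rintro _ ⟨⟨X, Y⟩, ⟨hX, hY⟩, rfl⟩
    have hs := hX.stepData hB hp hY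
    have h1 := hX.isPP.degree_add hR (hs.isPP_quotient hR) (hs.isPP_sub hR)
    have h2 : degree f Y (B ⊔ p • X) ≤ D := by
      rw [← hX.degree_eq, h1]; exact Nat.le_add_left _ _
    exact add_le_add (Nat.mul_le_mul_right _ (Nat.mul_le_mul h2 (Nat.div_le_self _ _)))
      (Nat.sub_le _ _)
  have hne : (key '' S).Nonempty := by
    obtain ⟨Y, hY⟩ := hex A hA
    exact ⟨_, (A, Y), ⟨hA, hY⟩, rfl⟩
  -- Start from a pair of largest key. A modification never lowers the key, so the key stays at its
  -- maximum and the extremal case of `StepData.slope_le` occurs at every later step.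
  obtain ⟨s₀, hs₀, hmax⟩ := Nat.sSup_mem hne hbdd
  have hstep : ∀ s : {s // s ∈ S ∧ key s = sSup (key '' S)},
      ∃ t : {s // s ∈ S ∧ key s = sSup (key '' S)}, t.1.1 = s.1.2 ∧
        t.1.2 ⊔ (B ⊔ p • s.1.1) = s.1.2 ∧ t.1.2 ⊓ (B ⊔ p • s.1.1) ≤ B ⊔ p • s.1.2 := by
    rintro ⟨⟨X, Y⟩, ⟨hX, hY⟩, hk⟩
    have hs := hX.stepData hB hp hY
    have hY' := hX.modification hR hs
    obtain ⟨Z, hZ⟩ := hex Y hY'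
    have hmem : (Y, Z) ∈ S := ⟨hY', hZ⟩
    have h1 : key (Y, Z) ≤ key (X, Y) := hk ▸ le_csSup hbdd ⟨_, hmem, rfl⟩
    have hpos1 := hpos _ hmem
    have hpos2 := hpos (X, Y) ⟨hX, hY⟩
    have h2 := hs.slope_le hR hZ.stable hZ.lt hZ.le
    have h3 : key (X, Y) ≤ key (Y, Z) := by
      refine (slopeKey_le_iff hpos2.1 hpos2.2 hpos1.1 hpos1.2).2 ?_
      rcases h2 with h2 | h2
      · exact Or.inl h2
      · exact Or.inr ⟨h2.1, h2.2.1⟩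
    have h4 := (slopeKey_eq_iff hpos2.1 hpos2.2 hpos1.1 hpos1.2).1 (le_antisymm h3 h1)
    have h5 : Z ⊔ (B ⊔ p • X) = Y ∧ Z ⊓ (B ⊔ p • X) ≤ B ⊔ p • Y := by
      rcases h2 with h2 | h2
      · exact absurd h4.1 h2.ne
      · exact h2.2.2 h4.2.symm
    exact ⟨⟨(Y, Z), hmem, (le_antisymm h1 h3).trans hk⟩, rfl, h5⟩
  choose next hnext using hstep
  let s : ℕ → {s // s ∈ S ∧ key s = sSup (key '' S)} := fun n =>
    Nat.rec ⟨s₀, hs₀, hmax⟩ (fun _ t => next t) n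
  have hs1 : ∀ n, (s (n + 1)).1.1 = (s n).1.2 := fun n => (hnext (s n)).1
  refine ⟨fun n => (s n).1.1, ?_, fun n => ⟨(s n).2.1.1, ?_⟩⟩
  · have hD : ∀ n, Destabilizing u f (s n).1.1 (B ⊔ p • (s n).1.1) (s (n + 1)).1.1 := by
      intro n; rw [hs1]; exact (s n).2.1.2
    refine ⟨fun n => (s n).2.1.1.bot_le, fun x hx => hp x ((s 0).2.1.1.le hx),
      fun n => (hD n).le, fun n => le_sup_right.trans (hD n).lt.le, fun n => ?_, fun n => ?_⟩
    · have := (hnext (s n)).2.1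
      change (s (n + 1)).1.2 ⊔ _ = _ at this
      rw [← hs1 (n + 1), ← hs1 n] at this; exact this
    · have := (hnext (s n)).2.2
      change (s (n + 1)).1.2 ⊓ _ ≤ _ at this
      rw [← hs1 (n + 1), ← hs1 n] at this; exact this
  · change Destabilizing u f (s n).1.1 _ (s (n + 1)).1.1
    rw [hs1]; exact (s n).2.1.2

end Exists

end KisinHN

namespace KisinHN

variable {R : Type*} [CommRing R] {φ : R →+* R} {p u E : R} {e q : ℕ}
variable {M : Type*} [AddCommGroup M] [Module R M]
variable {f : M →ₛₗ[φ] M} {A B W X Y Z : Submodule R M}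

/-! ### The filtration -/

variable (p u E) in
/-- `Y / Z` is a semistable flat Kisin module. -/
structure HNStep (f : M →ₛₗ[φ] M) (Y Z : Submodule R M) : Prop where
  lt : Z < Y
  stable_left : Stable f Y
  stable_right : Stable f Z
  flat : IsFlatPair p u Y Z
  good : GoodFrob E f Y
  isPP : IsPP p u f Y (Z ⊔ p • Y)
  semistable : ∀ C : Submodule R M, Stable f C → Z ⊔ p • Y < C → C ≤ Y →
    degree f Y (Z ⊔ p • Y) * rank u C (Z ⊔ p • Y) ≤ degree f C (Z ⊔ p • Y) * rank u Y (Z ⊔ p • Y)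

variable (p u) in
/-- The slope of `Y / (Z + p Y)`. -/
noncomputable def stepSlope (f : M →ₛₗ[φ] M) (Y Z : Submodule R M) : ℚ :=
  degree f Y (Z ⊔ p • Y) / rank u Y (Z ⊔ p • Y)

variable [IsDomain (R ⧸ Ideal.span {p})] [IsDiscreteValuationRing (R ⧸ Ideal.span {p})]
  [IsNoetherian R M] [IsLocalRing R] {μ : ℚ} {N D : ℕ}

omit [IsDiscreteValuationRing (R ⧸ Ideal.span {p})] [IsDomain (R ⧸ Ideal.span {p})]
  [IsNoetherian R M] [IsLocalRing R] in
theorem isFlatPair_of_inf_le (hBZ : B ≤ Z) (hZX : Z ≤ X) (hp : ∀ x ∈ X, p • x ∈ B → x ∈ B)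
    (hinf : Z ⊓ (B ⊔ p • X) ≤ B ⊔ p • Z) (hPM : IsPM p u X (Z ⊔ p • X)) : IsFlatPair p u X Z where
  le := hZX
  isPM := hPM
  p_tf x hx hpx := by
    obtain ⟨z, hz, hb⟩ := mem_sup_smul.1 (hinf ⟨hpx, Submodule.mem_sup_right
      (Submodule.smul_mem_pointwise_smul _ _ _ hx)⟩)
    rw [← smul_sub] at hb
    have := add_mem (hBZ (hp _ (sub_mem hx (hZX hz)) hb)) hz
    simpa using this

/-- With `F` the intersection of a split sequence, `F / (B + pF)` is the destabilizing submodule `X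
1 / (B + p X 0)`, so `F / B` is semistable. The reduction of `X 0 / F` is `X 0 / X 1`, all of whose
nonzero stable submodules have larger slope; the slope of `F / B` is therefore a valid bound for the
next round on `X 0 / F`, of smaller rank. -/
theorem exists_first_step [IsDomain R] [IsNoetherianRing R] (hR : FrobeniusDatum φ p u E e q)
    (hB : Stable f B)
    (hp : ∀ x ∈ A, p • x ∈ B → x ∈ B) (hN : 0 < N) (hA : Admissible p u E f A B μ N D A) :
    ∃ F X, HNStep p u E f F B ∧ X ≤ A ∧ (∃ a : ℕ, ∀ x ∈ A, p ^ a • x ∈ X) ∧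
      (∀ x ∈ A, u • x ∈ X → x ∈ X) ∧ IsFlatPair p u X F ∧ μ < stepSlope p u f F B ∧
      rank u X (F ⊔ p • X) < N ∧
      Admissible p u E f X F (stepSlope p u f F B) (rank u X (F ⊔ p • X))
        (degree f X (F ⊔ p • X)) X := by
  obtain ⟨X, hX, hXA⟩ := exists_isSplitSeq hR hB hp hN hA
  obtain ⟨hX0, hD⟩ := hXA 0
  rw [Nat.zero_add] at hD
  have hs := hX0.stepData hB hp hD
  set F := ⨅ n, X n with hF
  have hBF : B ≤ F := le_iInf fun n => hX.bot_le n
  have hFX : F ≤ X 0 := iInf_le _ 0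
  have hsup : F ⊔ (B ⊔ p • X 0) = X 1 := hX.iInf_sup_eq hR
  have hsup' : F ⊔ p • X 0 = X 1 := by rw [← hsup, ← sup_assoc, sup_eq_left.2 hBF]
  have hinf : F ⊓ (B ⊔ p • X 0) = B ⊔ p • F := le_antisymm hX.iInf_inf_le
    (le_inf (sup_le hBF (smul_pointwise_le_self _ _))
      (sup_le_sup_left (smul_pointwise_mono p hFX) _))
  have hFs : Stable f F := Stable.iInf fun n => (hXA n).1.isPP.stable_left
  have hPX1 : IsPP p u f (X 0) (F ⊔ p • X 0) := by rw [hsup']; exact hs.isPP_quotient hR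
  have hpX : ∀ x ∈ X 0, p • x ∈ B → x ∈ B := fun x hx => hp x (hX0.le hx)
  have hflat : IsFlatPair p u (X 0) F := isFlatPair_of_inf_le hBF hFX hpX hinf.le hPX1.toIsPM
  have hgood : GoodFrob E f F := hX0.good.of_inf_le hFX (hflat.inf_frobSpan_le hR hFs hPX1)
  have hPMF : IsPM p u F (B ⊔ p • F) :=
    ⟨sup_le hBF (smul_pointwise_le_self _ _), fun y hy => Submodule.mem_sup_right
      (Submodule.smul_mem_pointwise_smul _ _ _ hy), fun y hy hu => hinf.le ⟨hy,
        hX0.isPP.u_tf y (hFX hy) ((sup_le_sup_left (smul_pointwise_mono p hFX) _) hu)⟩⟩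
  have hPPF : IsPP p u f F (B ⊔ p • F) :=
    hPMF.isPP hR hFs (stable_sup_smul hR hFs hB) (hgood.sup _)
  have hrank : rank u F (B ⊔ p • F) = rank u (X 1) (B ⊔ p • X 0) := by
    rw [← hsup, rank_sup, hinf]
  have hdeg : degree f F (B ⊔ p • F) = degree f (X 1) (B ⊔ p • X 0) := by
    rw [← hsup, degree_sup hFs hX0.isPP.stable_right, hinf]
  have hBF' : B < F := by
    refine lt_of_le_of_ne hBF fun h => hD.lt.ne ?_
    rw [← hsup, ← h, ← sup_assoc, sup_idem]
  have hrpos : 0 < rank u (X 1) (B ⊔ p • X 0) := (hs.isPP_sub hR).toIsPM.rank_pos hR hD.lt.ne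
  have hrpos' : (0 : ℚ) < rank u (X 1) (B ⊔ p • X 0) := by exact_mod_cast hrpos
  refine ⟨F, X 0, ⟨hBF', hFs, hB, ?_, hgood, hPPF, ?_⟩, hX0.le, hX0.pow_smul, hX0.u_tf, hflat,
    ?_, ?_, hFX, le_rfl, hPX1, hX0.good, ⟨0, fun x hx => by simpa using hx⟩,
    fun x hx _ => hx, rfl, rfl, ?_⟩
  · exact ⟨hBF, fun x hx => hpX x (hFX hx), hPMF⟩
  · intro C hC hlt hCF
    -- Thus `C / (B + pF)` is isomorphic to its image in `X 0 / (B + p X 0)`, where the minimality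
    -- of the slope of `X 1` can be used.
    have hCinf : C ⊓ (B ⊔ p • X 0) = B ⊔ p • F :=
      le_antisymm ((inf_le_inf_right _ hCF).trans hinf.le)
        (le_inf hlt.le (hinf.symm.le.trans inf_le_right))
    rw [hrank, hdeg, ← hCinf, ← rank_sup, ← degree_sup hC hX0.isPP.stable_right]
    have hlt' : B ⊔ p • X 0 < C ⊔ (B ⊔ p • X 0) := by
      refine right_lt_sup.2 fun h => hlt.not_ge ?_
      rw [← hCinf]; exact le_inf le_rfl h
    rcases hD.min (C ⊔ (B ⊔ p • X 0)) (hC.sup hX0.isPP.stable_right) hlt'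
      (sup_le (hCF.trans hFX) hX0.isPP.le) with h1 | h1
    · exact h1.le
    · exact h1.1.le
  · rw [stepSlope, hrank, hdeg, lt_div_iff₀ hrpos']
    exact hX0.slope_lt _ hD.stable hD.lt hD.le
  · have := hX0.isPP.rank_add hR (hs.isPP_quotient hR) (hs.isPP_sub hR)
    rw [hX0.rank_eq] at this
    rw [hsup']
    omega
  · intro C hC hlt hCX
    rw [stepSlope, hrank, hdeg, div_mul_eq_mul_div, div_lt_iff₀ hrpos']
    rw [hsup'] at hlt ⊢
    norm_cast
    have hPC : IsPP p u f C (X 1) := (hs.isPP_quotient hR).sub hR hlt.le hCX hC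
    have hPC' := hPC.toIsPM.rank_pos hR hlt.ne
    have hPCW := hX0.isPP.sub hR (hD.lt.le.trans hlt.le) hCX hC
    -- As `C` strictly contains `X 1`, its rank over `B + p X 0` is larger, so the equality case of
    -- minimality is excluded and the slope of `C / X 1` is strictly larger.
    have h1 := hD.min C hC (hD.lt.trans hlt) hCX
    rw [hPCW.rank_add hR hPC (hs.isPP_sub hR), hPCW.degree_add hR hPC (hs.isPP_sub hR),
      mul_add, add_mul] at h1
    omega

/-- Every flat `A / B` contains, up to `p`-isogeny, the top of a filtration with semistable flat
graded pieces and increasing slopes. -/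
theorem exists_filtration [IsDomain R] [IsNoetherianRing R] (hR : FrobeniusDatum φ p u E e q)
    (N : ℕ) : ∀ (A B : Submodule R M) (μ : ℚ) (D : ℕ), Stable f B →
      (∀ x ∈ A, p • x ∈ B → x ∈ B) → Admissible p u E f A B μ N D A →
      ∃ (r : ℕ) (X : ℕ → Submodule R M), X 0 = B ∧ X r ≤ A ∧
        (∀ i < r, HNStep p u E f (X (i + 1)) (X i)) ∧
        (∀ i < r, μ < stepSlope p u f (X (i + 1)) (X i)) ∧
        (∀ i, i + 1 < r →
          stepSlope p u f (X (i + 1)) (X i) < stepSlope p u f (X (i + 2)) (X (i + 1))) ∧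
        (∃ a : ℕ, ∀ x ∈ A, p ^ a • x ∈ X r) ∧ ∀ x ∈ A, u • x ∈ X r → x ∈ X r := by
  induction N using Nat.strong_induction_on with
  | _ N ih =>
  intro A B μ D hB hp hA
  rcases Nat.eq_zero_or_pos N with rfl | hN
  -- In rank zero the reduction of `A / B` vanishes, and Nakayama's lemma gives `A = B`: the empty
  -- filtration.
  · have hle : A ≤ B := by
      refine le_of_le_sup_smul hR ?_
      by_contra h
      have := hA.isPP.toIsPM.rank_pos hR fun h' => h h'.ge
      rw [hA.rank_eq] at this
      omega
    exact ⟨0, fun _ => B, rfl, hA.bot_le, by simp, by simp, by simp,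
      ⟨0, fun x hx => by simpa using hle hx⟩, fun x hx _ => hle hx⟩
  · obtain ⟨F, X₀, hstep, hXA, ⟨a, ha⟩, hu, hflat, hμ, hlt, hX₀⟩ :=
      exists_first_step hR hB hp hN hA
    obtain ⟨r, X, h0, hr, hsteps, hslope, hmono, ⟨a', ha'⟩, hu'⟩ :=
      ih _ hlt X₀ F _ _ hstep.stable_left hflat.p_tf hX₀
    -- The filtration of `X₀ / F` is prolonged downwards by `B`. The recursive call was made with
    -- the slope of `F / B` as lower bound, which gives the strict inequality at the junction.
    refine ⟨r + 1, fun i => Nat.casesOn i B X, rfl, hr.trans hXA, ?_, ?_, ?_,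
      ⟨a' + a, fun x hx => ?_⟩, fun x hx hux => hu' x (hu x hx (hr hux)) hux⟩
    · rintro (_ | i) hi
      · change HNStep p u E f (X 0) B
        rwa [h0]
      · exact hsteps i (by omega)
    · rintro (_ | i) hi
      · change μ < stepSlope p u f (X 0) B
        rwa [h0]
      · exact hμ.trans (hslope i (by omega))
    · rintro (_ | i) hi
      · have := hslope 0 (by omega)
        change stepSlope p u f (X 0) B < stepSlope p u f (X 1) (X 0)
        rwa [h0] at this ⊢
      · exact hmono i (by omega)
    · rw [pow_add, mul_smul]
      exact ha' _ (ha x hx)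

end KisinHN

namespace KisinHN

variable {R : Type*} [CommRing R] {φ : R →+* R} {p u E : R} {e q : ℕ}
variable {M : Type*} [AddCommGroup M] [Module R M] {N : Type*} [AddCommGroup N] [Module R N]
variable {f : M →ₛₗ[φ] M} {g : N →ₛₗ[φ] N} {Y Z : Submodule R M}

/-! ### Subquotients as modules -/

/-- `j : Y → N` identifies `N`, with its Frobenius `g`, with `Y / Z`. -/
structure IsModel (f : M →ₛₗ[φ] M) (Y Z : Submodule R M) (g : N →ₛₗ[φ] N) (j : Y →ₗ[R] N) :
    Prop where
  surjective : Function.Surjective j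
  le : Z ≤ Y
  stable : Stable f Y
  map_eq_zero_iff : ∀ y : Y, j y = 0 ↔ (y : M) ∈ Z
  comm : ∀ y y' : Y, (y' : M) = f y → j y' = g (j y)

/-- The preimage in `Y` of a submodule of `Y / Z`. -/
def pull (j : Y →ₗ[R] N) (C : Submodule R N) : Submodule R M := (C.comap j).map Y.subtype

theorem mem_pull {j : Y →ₗ[R] N} {C : Submodule R N} {x : M} :
    x ∈ pull j C ↔ ∃ hx : x ∈ Y, j ⟨x, hx⟩ ∈ C := by
  simp [pull]

theorem coe_mem_pull {j : Y →ₗ[R] N} {C : Submodule R N} {y : Y} :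
    (y : M) ∈ pull j C ↔ j y ∈ C := by
  simp [mem_pull]

theorem pull_le (j : Y →ₗ[R] N) (C : Submodule R N) : pull j C ≤ Y := fun _ hx =>
  (mem_pull.1 hx).1

theorem pull_top (j : Y →ₗ[R] N) : pull j ⊤ = Y := by ext; simp [mem_pull]

namespace IsModel

variable {j : Y →ₗ[R] N} (h : IsModel f Y Z g j) {A B C : Submodule R N}
include h

theorem pull_bot : pull j ⊥ = Z := by
  ext x
  simp only [mem_pull, Submodule.mem_bot, h.map_eq_zero_iff]
  exact ⟨fun hx => hx.2, fun hx => ⟨h.le hx, hx⟩⟩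

theorem le_pull (C : Submodule R N) : Z ≤ pull j C := by
  rw [← h.pull_bot]
  exact fun x hx => by
    obtain ⟨hx, h0⟩ := mem_pull.1 hx
    exact mem_pull.2 ⟨hx, by rw [(Submodule.mem_bot R).1 h0]; exact C.zero_mem⟩

theorem pull_le_pull_iff : pull j A ≤ pull j B ↔ A ≤ B := by
  constructor
  · intro hAB x hx
    obtain ⟨y, rfl⟩ := h.surjective x
    exact coe_mem_pull.1 (hAB (coe_mem_pull.2 hx))
  · intro hAB x hx
    obtain ⟨hx, h0⟩ := mem_pull.1 hx
    exact mem_pull.2 ⟨hx, hAB h0⟩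

theorem pull_lt_pull_iff : pull j A < pull j B ↔ A < B := by
  simp only [lt_iff_le_not_ge, h.pull_le_pull_iff]

theorem pull_sup : pull j (A ⊔ B) = pull j A ⊔ pull j B := by
  apply le_antisymm
  · intro x hx
    obtain ⟨hx, h0⟩ := mem_pull.1 hx
    obtain ⟨a, ha, b, hb, hab⟩ := Submodule.mem_sup.1 h0
    obtain ⟨y, rfl⟩ := h.surjective a
    have h1 : j (⟨x, hx⟩ - y) = b := by rw [map_sub, ← hab, add_sub_cancel_left]
    refine Submodule.mem_sup.2 ⟨y, coe_mem_pull.2 ha, x - y, ?_, by abel⟩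
    exact coe_mem_pull (y := ⟨x, hx⟩ - y).2 (h1 ▸ hb)
  · exact sup_le (h.pull_le_pull_iff.2 le_sup_left) (h.pull_le_pull_iff.2 le_sup_right)

theorem pull_smul (a : R) : pull j (a • A) = Z ⊔ a • pull j A := by
  apply le_antisymm
  · intro x hx
    obtain ⟨hx, h0⟩ := mem_pull.1 hx
    obtain ⟨n, hn, hab⟩ := (Submodule.mem_smul_pointwise_iff_exists _ _ _).1 h0
    obtain ⟨y, rfl⟩ := h.surjective n
    refine Submodule.mem_sup.2 ⟨x - a • y, ?_, a • y,
      Submodule.smul_mem_pointwise_smul _ _ _ (coe_mem_pull.2 hn), by abel⟩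
    refine (h.map_eq_zero_iff (⟨x, hx⟩ - a • y)).1 ?_
    rw [map_sub, map_smul, hab, sub_self]
  · refine sup_le (h.le_pull _) (smul_pointwise_le.2 fun x hx => ?_)
    obtain ⟨hx, h0⟩ := mem_pull.1 hx
    refine coe_mem_pull (y := a • (⟨x, hx⟩ : Y)).2 ?_
    rw [map_smul]
    exact Submodule.smul_mem_pointwise_smul _ _ _ h0

theorem pull_span (s : Set Y) :
    pull j (Submodule.span R (j '' s)) = Z ⊔ Submodule.span R (Subtype.val '' s) := by
  have h1 : Submodule.span R (Subtype.val '' s) = (Submodule.span R s).map Y.subtype := by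
    rw [Submodule.map_span]; rfl
  rw [h1, ← Submodule.map_span]
  apply le_antisymm
  · intro x hx
    obtain ⟨hx, y, hy, hyx⟩ := mem_pull.1 hx
    refine Submodule.mem_sup.2 ⟨x - y, ?_, y, ⟨y, hy, rfl⟩, by abel⟩
    refine (h.map_eq_zero_iff (⟨x, hx⟩ - y)).1 ?_
    rw [map_sub, hyx, sub_self]
  · refine sup_le (h.le_pull _) ?_
    rintro _ ⟨y, hy, rfl⟩
    exact coe_mem_pull.2 ⟨y, hy, rfl⟩

theorem pull_frobSpan : pull j (frobSpan g A) = Z ⊔ frobSpan f (pull j A) := by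
  have h1 : g '' (A : Set N) = j '' {y | (y : M) ∈ f '' (pull j A)} := by
    ext x
    constructor
    · rintro ⟨a, ha, rfl⟩
      obtain ⟨y, rfl⟩ := h.surjective a
      exact ⟨⟨f y, h.stable _ y.2⟩, ⟨y, coe_mem_pull.2 ha, rfl⟩, h.comm _ _ rfl⟩
    · rintro ⟨y, ⟨x, hx, hxy⟩, rfl⟩
      obtain ⟨hx', h0⟩ := mem_pull.1 hx
      exact ⟨_, h0, (h.comm ⟨x, hx'⟩ y hxy.symm).symm⟩
  have h2 : Subtype.val '' {y : Y | (y : M) ∈ f '' (pull j A)} = f '' (pull j A) := by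
    ext x
    constructor
    · rintro ⟨y, hy, rfl⟩; exact hy
    · rintro ⟨y, hy, rfl⟩
      exact ⟨⟨f y, h.stable _ (pull_le j A hy)⟩, ⟨y, hy, rfl⟩, rfl⟩
  rw [frobSpan, h1, h.pull_span, h2, frobSpan]

theorem stable_pull_iff : Stable f (pull j C) ↔ Stable g C := by
  constructor
  · intro hC x hx
    obtain ⟨y, rfl⟩ := h.surjective x
    rw [← h.comm y ⟨f y, h.stable _ y.2⟩ rfl]
    exact coe_mem_pull.1 (hC _ (coe_mem_pull.2 hx))
  · intro hC x hx
    obtain ⟨hx', h0⟩ := mem_pull.1 hx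
    refine mem_pull.2 ⟨h.stable _ hx', ?_⟩
    rw [h.comm ⟨x, hx'⟩ _ rfl]
    exact hC _ h0

theorem relLength_pull (hBA : B ≤ A) : relLength (pull j A) (pull j B) = relLength A B := by
  trans relLength (A.comap j) (B.comap j)
  · refine (relLength_eq_of_map Y.subtype (?_ : _ ⊔ pull j B = pull j A) ?_).symm
    · exact sup_eq_left.2 (h.pull_le_pull_iff.2 hBA)
    · rw [pull, Submodule.comap_map_eq_of_injective Y.injective_subtype]
      exact inf_eq_right.2 (Submodule.comap_mono hBA)
  · refine relLength_eq_of_map j ?_ (inf_eq_right.2 (Submodule.comap_mono hBA))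
    rw [Submodule.map_comap_eq_of_surjective h.surjective, sup_eq_left.2 hBA]

theorem rank_pull (u : R) (hCA : C ≤ A) : rank u (pull j A) (pull j C) = rank u A C := by
  rw [rank, rank, ← h.relLength_pull (sup_le hCA (smul_pointwise_le_self _ _)), h.pull_sup,
    h.pull_smul, ← sup_assoc, sup_eq_left.2 (h.le_pull C)]

theorem degree_pull (hA : Stable g A) (hCA : C ≤ A) :
    degree f (pull j A) (pull j C) = degree g A C := by
  rw [degree, degree, ← h.relLength_pull (sup_le hCA hA.frobSpan_le), h.pull_sup,
    h.pull_frobSpan, ← sup_assoc, sup_eq_left.2 (h.le_pull C)]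

theorem isPM_of_pull (hP : IsPM p u (pull j A) (pull j C)) : IsPM p u A C where
  le := h.pull_le_pull_iff.1 hP.le
  p_mem x hx := by
    obtain ⟨y, rfl⟩ := h.surjective x
    rw [← map_smul]
    exact coe_mem_pull.1 (hP.p_mem _ (coe_mem_pull.2 hx))
  u_tf x hx hu := by
    obtain ⟨y, rfl⟩ := h.surjective x
    rw [← map_smul] at hu
    exact coe_mem_pull.1 (hP.u_tf _ (coe_mem_pull.2 hx) (coe_mem_pull.2 hu))

theorem isPP_of_pull (hP : IsPP p u f (pull j A) (pull j C)) : IsPP p u g A C where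
  toIsPM := h.isPM_of_pull hP.toIsPM
  stable_left := h.stable_pull_iff.1 hP.stable_left
  stable_right := h.stable_pull_iff.1 hP.stable_right
  nondeg := by
    obtain ⟨k, hk⟩ := hP.nondeg
    refine ⟨k, fun x hx => ?_⟩
    obtain ⟨y, rfl⟩ := h.surjective x
    have := hk _ (coe_mem_pull.2 hx)
    rw [← sup_eq_left.2 (h.le_pull C), sup_assoc, ← h.pull_frobSpan, ← h.pull_sup] at this
    rw [← map_smul]
    exact coe_mem_pull.1 this

theorem isPP (hP : IsPP p u f Y Z) : IsPP p u g ⊤ ⊥ :=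
  h.isPP_of_pull (by rwa [pull_top, h.pull_bot])

theorem isFlatPair (hF : IsFlatPair p u Y Z) : IsFlatPair p u (⊤ : Submodule R N) ⊥ where
  le := bot_le
  p_tf x _ hx := by
    obtain ⟨y, rfl⟩ := h.surjective x
    rw [← map_smul, Submodule.mem_bot, h.map_eq_zero_iff] at hx
    exact (h.map_eq_zero_iff y).2 (hF.p_tf _ y.2 hx)
  isPM := h.isPM_of_pull (by
    have := hF.isPM
    rwa [pull_top, h.pull_sup, h.pull_smul, h.pull_bot, pull_top, ← sup_assoc, sup_idem])

theorem goodFrob (hG : GoodFrob E f Y) : GoodFrob E g ⊤ := by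
  obtain ⟨k, hk⟩ := hG
  refine ⟨k, fun x _ => ?_⟩
  obtain ⟨y, rfl⟩ := h.surjective x
  rw [← map_smul, ← coe_mem_pull, h.pull_frobSpan, pull_top]
  exact Submodule.mem_sup_right (hk _ y.2)

end IsModel

/-- The Frobenius of `Y / Z`. -/
def subquotientFrob (f : M →ₛₗ[φ] M) {Y Z : Submodule R M} (hY : Stable f Y) (hZ : Stable f Z) :
    (Y ⧸ Z.submoduleOf Y) →ₛₗ[φ] (Y ⧸ Z.submoduleOf Y) :=
  (Z.submoduleOf Y).mapQ (Z.submoduleOf Y) (f.restrict hY) fun _ hy => hZ _ hy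

theorem isModel_subquotient (hY : Stable f Y) (hZ : Stable f Z) (hZY : Z ≤ Y) :
    IsModel f Y Z (subquotientFrob f hY hZ) (Z.submoduleOf Y).mkQ where
  surjective := Submodule.mkQ_surjective _
  le := hZY
  stable := hY
  map_eq_zero_iff y := by rw [Submodule.mkQ_apply, Submodule.Quotient.mk_eq_zero]; rfl
  comm y y' h := by
    have : y' = ⟨f y, hY _ y.2⟩ := Subtype.ext h
    subst this
    rfl

theorem isModel_self (hY : Stable f Y) : IsModel f Y ⊥ (f.restrict hY) LinearMap.id where
  surjective := Function.surjective_id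
  le := bot_le
  stable := hY
  map_eq_zero_iff y := by simp
  comm y y' h := Subtype.ext h

theorem isModel_range (l : N →ₗ[R] M) (hl : Function.Injective l) (hc : ∀ x, l (g x) = f (l x)) :
    IsModel f (LinearMap.range l) ⊥ g (LinearEquiv.ofInjective l hl).symm.toLinearMap where
  surjective := LinearEquiv.surjective _
  le := bot_le
  stable := by
    rintro _ ⟨x, rfl⟩
    exact ⟨g x, hc x⟩
  map_eq_zero_iff y := by simp
  comm y y' h := by
    obtain ⟨x, rfl⟩ := (LinearEquiv.ofInjective l hl).surjective y
    obtain ⟨x', rfl⟩ := (LinearEquiv.ofInjective l hl).surjective y'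
    simp only [LinearEquiv.ofInjective_apply, ← hc] at h
    simpa using hl h

/-! ### Extensions of flat subquotients -/

/-- Regularity of the sequence `(p, u)` passes to extensions. If `u y = p a` modulo `X`, then `y = p
a'` modulo `Z` by flatness of `Y / Z`, whence `p (a - u a') ∈ Z` and `a - u a' ∈ Z`. So `y - p a'`
is an element of `Z` to which flatness of `Z / X` applies. -/
theorem IsFlatPair.trans {X : Submodule R M} (h : IsFlatPair p u Y Z) (h' : IsFlatPair p u Z X) :
    IsFlatPair p u Y X where
  le := h'.le.trans h.le
  p_tf y hy hpy := h'.p_tf y (h.p_tf y hy (h'.le hpy)) hpy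
  isPM := by
    refine ⟨sup_le (h'.le.trans h.le) (smul_pointwise_le_self _ _), fun y hy =>
      Submodule.mem_sup_right (Submodule.smul_mem_pointwise_smul _ _ _ hy), fun y hy hu => ?_⟩
    obtain ⟨a, ha, hb⟩ := mem_sup_smul.1 hu
    obtain ⟨a', ha', hb'⟩ := mem_sup_smul.1 (h.isPM.u_tf y hy ((sup_le_sup_right h'.le _) hu))
    have h1 : p • (a - u • a') ∈ Z := by
      have := sub_mem (Z.smul_mem u hb') (h'.le hb)
      convert this using 1
      rw [smul_sub, smul_sub, smul_comm p u]
      abel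
    have h2 := h.p_tf _ (sub_mem ha (Y.smul_mem _ ha')) h1
    have h3 : u • (y - p • a') ∈ X ⊔ p • Z := by
      refine mem_sup_smul.2 ⟨_, h2, ?_⟩
      convert hb using 1
      rw [smul_sub, smul_sub, smul_comm p u]
      abel
    have h4 := h'.isPM.u_tf _ hb' h3
    have := add_mem ((sup_le_sup_left (smul_pointwise_mono p h.le) X) h4)
      (Submodule.mem_sup_right (S := X) (Submodule.smul_mem_pointwise_smul _ p _ ha'))
    simpa using this

end KisinHN

namespace KisinHN

open Kisin

universe u v w

/-! ### The linearized Frobenius -/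

section Linearize

variable {R : Type u} [CommRing R] {φ : R →+* R} {E : R} {N : Type v} [AddCommGroup N] [Module R N]
variable {P : Type w} [AddCommGroup P] [Module R P]

theorem pullback_induction {motive : Pullback φ N → Prop} (x : Pullback φ N)
    (zero : motive 0) (tmul : ∀ a n, motive (Pullback.tmul φ a n))
    (add : ∀ x y, motive x → motive y → motive (x + y)) : motive x :=
  TensorProduct.induction_on (R := R) (M := Twisted φ) (N := N) x zero tmul add

theorem tmul_eq_smul (a : R) (n : N) : Pullback.tmul φ a n = a • Pullback.tmul φ 1 n := by
  rw [Pullback.smul_tmul, mul_one]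

theorem tmul_add (a : R) (n m : N) :
    Pullback.tmul φ a (n + m) = Pullback.tmul φ a n + Pullback.tmul φ a m :=
  TensorProduct.tmul_add (R := R) (show Twisted φ from a) n m

theorem tmul_zero (a : R) : Pullback.tmul φ a (0 : N) = 0 :=
  TensorProduct.tmul_zero (R := R) N (show Twisted φ from a)

theorem zero_tmul (n : N) : Pullback.tmul φ 0 n = 0 := by
  rw [tmul_eq_smul, zero_smul]

theorem pullback_hom_ext {l l' : Pullback φ N →ₗ[R] P}
    (h : ∀ x, l (Pullback.tmul φ 1 x) = l' (Pullback.tmul φ 1 x)) : l = l' := by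
  ext x
  induction x using pullback_induction with
  | zero => simp
  | tmul a n => rw [tmul_eq_smul, map_smul, map_smul, h]
  | add x y hx hy => rw [map_add, map_add, hx, hy]

/-- The linear map `φ^* N → N` attached to a semilinear map `g`. -/
def linearize (g : N →ₛₗ[φ] N) : Pullback φ N →ₗ[R] N :=
  let l : Twisted φ ⊗[R] N →+ N := TensorProduct.liftAddHom
    { toFun := fun a => ((show R from a) • g.toAddMonoidHom : N →+ N)
      map_zero' := by ext n; exact zero_smul R (g n)
      map_add' := fun a b => by ext n; exact add_smul (show R from a) (show R from b) (g n) }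
    (fun r a n => by
      change (φ r * (show R from a)) • g n = (show R from a) • g (r • n)
      rw [g.map_smulₛₗ, smul_smul, mul_comm])
  { toFun := l
    map_add' := l.map_add
    map_smul' := fun r x => by
      induction x using pullback_induction with
      | zero => rw [smul_zero]; exact l.map_zero.trans (smul_zero r).symm
      | tmul a n => exact mul_smul r a (g n)
      | add x y hx hy =>
        rw [smul_add]
        exact (l.map_add _ _).trans (by rw [hx, hy]; exact ((smul_add r _ _).symm.trans
          (congrArg (r • ·) (l.map_add x y).symm))) }

@[simp]
theorem linearize_tmul (g : N →ₛₗ[φ] N) (a : R) (n : N) :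
    linearize g (Pullback.tmul φ a n) = a • g n := rfl

theorem range_linearize (g : N →ₛₗ[φ] N) : LinearMap.range (linearize g) = frobSpan g ⊤ := by
  apply le_antisymm
  · rintro _ ⟨x, rfl⟩
    induction x using pullback_induction with
    | zero => simp
    | tmul a n =>
      rw [linearize_tmul]
      exact Submodule.smul_mem _ _ (mem_frobSpan trivial)
    | add x y hx hy => rw [map_add]; exact add_mem hx hy
  · exact frobSpan_le fun n _ => ⟨Pullback.tmul φ 1 n, by simp⟩

end Linearize

/-! ### Localization at `E` -/

section Away

variable {R : Type u} [CommRing R] (E : R) {N : Type v} [AddCommGroup N] [Module R N]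
variable {P : Type w} [AddCommGroup P] [Module R P]

/-- The map `N → N[1/E]`. -/
noncomputable abbrev toAway (N : Type v) [AddCommGroup N] [Module R N] : N →ₗ[R] Away E N :=
  LocalizedModule.mkLinearMap (Submonoid.powers E) N

theorem bijective_pow_smul (r : ℕ) : Function.Bijective fun x : Away E N => E ^ r • x :=
  (Module.End.isUnit_iff _).1 (IsLocalizedModule.map_units (toAway E N)
    (⟨E ^ r, r, rfl⟩ : Submonoid.powers E))

variable {E}

theorem away_map_toAway (l : N →ₗ[R] P) (x : N) :
    Away.map E l (toAway E N x) = toAway E P (l x) :=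
  IsLocalizedModule.map_apply _ _ _ _ _

theorem exists_pow_smul_eq_toAway (y : Away E N) : ∃ (r : ℕ) (x : N), E ^ r • y = toAway E N x := by
  obtain ⟨⟨x, ⟨_, r, rfl⟩⟩, h⟩ := IsLocalizedModule.surj (Submonoid.powers E) (toAway E N) y
  exact ⟨r, x, h⟩

theorem toAway_eq_toAway_iff {x y : N} :
    toAway E N x = toAway E N y ↔ ∃ r : ℕ, E ^ r • x = E ^ r • y := by
  rw [IsLocalizedModule.eq_iff_exists (Submonoid.powers E)]
  constructor
  · rintro ⟨⟨_, r, rfl⟩, h⟩; exact ⟨r, h⟩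
  · rintro ⟨r, h⟩; exact ⟨⟨_, r, rfl⟩, h⟩

theorem pow_smul_eq_imp (hE : ∀ x : N, E • x = 0 → x = 0) (r : ℕ) {x : N} (h : E ^ r • x = 0) :
    x = 0 := by
  induction r with
  | zero => simpa using h
  | succ r ih =>
    rw [pow_succ', mul_smul] at h
    exact ih (hE _ h)

theorem toAway_injective (hE : ∀ x : N, E • x = 0 → x = 0) : Function.Injective (toAway E N) := by
  intro x y h
  obtain ⟨r, h⟩ := toAway_eq_toAway_iff.1 h
  rw [← sub_eq_zero] at h ⊢
  exact pow_smul_eq_imp hE r (by rwa [smul_sub])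

theorem away_hom_ext {l l' : Away E N →ₗ[R] Away E P}
    (h : ∀ x, l (toAway E N x) = l' (toAway E N x)) : l = l' := by
  ext y
  obtain ⟨r, x, hx⟩ := exists_pow_smul_eq_toAway y
  apply (bijective_pow_smul E (N := P) r).1
  simp only [← map_smul, hx, h]

theorem bijective_away_map_linearize {φ : R →+* R} {g : N →ₛₗ[φ] N} (hg : GoodFrob E g ⊤)
    (hinj : Function.Injective (linearize g)) :
    Function.Bijective (Away.map E (linearize g)) := by
  refine ⟨IsLocalizedModule.map_injective _ _ _ _ hinj, fun y => ?_⟩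
  obtain ⟨r, x, hx⟩ := exists_pow_smul_eq_toAway y
  obtain ⟨h, hh⟩ := hg
  have := hh x trivial
  rw [← range_linearize] at this
  obtain ⟨z, hz⟩ := this
  obtain ⟨z', hz'⟩ := (bijective_pow_smul E (N := Pullback φ N) (h + r)).2 (toAway E _ z)
  refine ⟨z', (bijective_pow_smul E (N := N) (h + r)).1 ?_⟩
  simp only at hz' ⊢
  rw [← map_smul, hz', away_map_toAway, hz, map_smul, ← hx, pow_add, mul_smul]

end Away

/-! ### Kisin modules and semilinear maps -/

section Eff

variable {p : ℕ} [Fact p.Prime] {k : Type u} [Field k] [CharP k p] {E : S p k}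

/-- The Frobenius of the twist `M(r)` is the linearization of `f : M → M`. -/
def IsEff (M : KisinModule.{u, w} p k E) (r : ℕ) (f : M →ₛₗ[frob p k] M) : Prop :=
  ∀ x : M, E ^ r • M.phi (toAway E _ (Pullback.tmul (frob p k) 1 x)) = toAway E M (f x)

/-- The Kisin module `N(-r)`, for an effective Kisin module `(N, g)`. -/
noncomputable def kisinOf (N : Type w) [AddCommGroup N] [Module (S p k) N] [Module.Finite (S p k) N]
    (hu : ∀ x : N, (PowerSeries.X : S p k) • x = 0 → x = 0) (r : ℕ) (g : N →ₛₗ[frob p k] N)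
    (hg : Function.Bijective (Away.map E (linearize g))) : KisinModule.{u, w} p k E where
  carrier := N
  u_torsion_free := hu
  phi := (LinearEquiv.ofBijective _ hg).trans
    (LinearEquiv.ofBijective (LinearMap.lsmul (S p k) (Away E N) (E ^ r))
      (bijective_pow_smul E r)).symm

theorem isEff_kisinOf (N : Type w) [AddCommGroup N] [Module (S p k) N] [Module.Finite (S p k) N]
    (hu : ∀ x : N, (PowerSeries.X : S p k) • x = 0 → x = 0) (r : ℕ) (g : N →ₛₗ[frob p k] N)
    (hg : Function.Bijective (Away.map E (linearize g))) : IsEff (kisinOf N hu r g hg) r g := by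
  intro x
  change N at x
  refine (LinearEquiv.apply_symm_apply
    (LinearEquiv.ofBijective (LinearMap.lsmul (S p k) (Away E N) (E ^ r))
      (bijective_pow_smul E r)) _).trans ?_
  refine (away_map_toAway (linearize g) (Pullback.tmul (frob p k) 1 x)).trans ?_
  exact congrArg (toAway E N) (one_smul (S p k) (g x))

variable {M N : KisinModule.{u, w} p k E}

omit [CharP k p] in
theorem away_pullback_hom_ext {N P : Type w} [AddCommGroup N] [Module (S p k) N]
    [AddCommGroup P] [Module (S p k) P] (r : ℕ)
    {l l' : Away E (Pullback (frob p k) N) →ₗ[S p k] Away E P}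
    (h : ∀ x : N, E ^ r • l (toAway E _ (Pullback.tmul (frob p k) 1 x)) =
      E ^ r • l' (toAway E _ (Pullback.tmul (frob p k) 1 x))) : l = l' := by
  refine away_hom_ext fun x => ?_
  have : l ∘ₗ toAway E _ = l' ∘ₗ toAway E _ :=
    pullback_hom_ext fun x => (bijective_pow_smul E (N := P) r).1 (h x)
  exact LinearMap.congr_fun this x

/-- A linear map that commutes with the Frobenii is a morphism. -/
def homOf {r : ℕ} {f : M →ₛₗ[frob p k] M} {g : N →ₛₗ[frob p k] N} (hf : IsEff M r f)
    (hg : IsEff N r g) (l : M →ₗ[S p k] N) (hl : ∀ x, l (f x) = g (l x)) :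
    KisinModule.Hom M N where
  lin := l
  comm := by
    have : N.phi.toLinearMap ∘ₗ Away.map E (Pullback.map (frob p k) l) =
        Away.map E l ∘ₗ M.phi.toLinearMap := by
      refine away_pullback_hom_ext r fun x => ?_
      simp only [LinearMap.comp_apply, LinearEquiv.coe_coe]
      rw [away_map_toAway, Pullback.map_tmul, hg, ← map_smul, hf, away_map_toAway, hl]
    exact fun x => LinearMap.congr_fun this x

theorem KisinModule_Hom_toAway (h : KisinModule.Hom M N) {r : ℕ} {g : N →ₛₗ[frob p k] N}
    (hg : IsEff N r g) (x : M) :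
    toAway E N (g (h.lin x)) =
      Away.map E h.lin (E ^ r • M.phi (toAway E _ (Pullback.tmul (frob p k) 1 x))) := by
  rw [← hg, map_smul, ← h.comm, away_map_toAway, Pullback.map_tmul]

/-- Without `E`-torsion the preimages `y` are unique, so choosing them produces a semilinear map. -/
theorem exists_isEff_of_forall (hE : ∀ x : M, E • x = 0 → x = 0) {r : ℕ}
    (h : ∀ x : M, ∃ y, E ^ r • M.phi (toAway E _ (Pullback.tmul (frob p k) 1 x)) = toAway E M y) :
    ∃ f : M →ₛₗ[frob p k] M, IsEff M r f := by
  choose f hf using h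
  have hinj := toAway_injective hE
  refine ⟨⟨⟨f, fun x y => hinj ?_⟩, fun a x => hinj ?_⟩, hf⟩
  · rw [map_add, ← hf, ← hf, ← hf, tmul_add, map_add, map_add, smul_add]
  · rw [map_smul, ← hf, ← hf, Pullback.tmul_smul, mul_one, tmul_eq_smul, map_smul, map_smul,
      smul_comm]

theorem exists_isEff (hE : ∀ x : M, E • x = 0 → x = 0) :
    ∃ (r : ℕ) (f : M →ₛₗ[frob p k] M), IsEff M r f := by
  obtain ⟨s, hs⟩ := Module.Finite.fg_top (R := S p k) (M := M)
  have h1 : ∀ x : M, ∃ (r : ℕ) (y : M),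
      E ^ r • M.phi (toAway E _ (Pullback.tmul (frob p k) 1 x)) = toAway E M y := fun x =>
    exists_pow_smul_eq_toAway _
  choose r y hy using h1
  refine ⟨s.sup r, exists_isEff_of_forall hE fun x => ?_⟩
  have hx : x ∈ Submodule.span (S p k) (s : Set M) := hs ▸ trivial
  induction hx using Submodule.span_induction with
  | mem x hx =>
    obtain ⟨d, hd⟩ := Nat.exists_eq_add_of_le' (Finset.le_sup (f := r) hx)
    exact ⟨E ^ d • y x, by rw [hd, pow_add, mul_smul, hy, map_smul]⟩
  | zero => exact ⟨0, by simp [tmul_zero]⟩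
  | add x x' _ _ hx hx' =>
    obtain ⟨y, hy⟩ := hx
    obtain ⟨y', hy'⟩ := hx'
    exact ⟨y + y', by rw [tmul_add, map_add, map_add, smul_add, hy, hy', map_add]⟩
  | smul a x _ hx =>
    obtain ⟨y, hy⟩ := hx
    exact ⟨frob p k a • y, by rw [Pullback.tmul_smul, mul_one, tmul_eq_smul, map_smul, map_smul,
      smul_comm, hy, map_smul]⟩

theorem IsEff.toAway_linearize {r : ℕ} {f : M →ₛₗ[frob p k] M} (hf : IsEff M r f)
    (z : Pullback (frob p k) M) : toAway E M (linearize f z) = E ^ r • M.phi (toAway E _ z) := by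
  have : toAway E M ∘ₗ linearize f = E ^ r • (M.phi.toLinearMap ∘ₗ toAway E _) :=
    pullback_hom_ext fun x => by simp [← hf x]
  exact LinearMap.congr_fun this z

/-- The Frobenius of a Kisin module without `E`-torsion is an isomorphism up to `E`. -/
theorem IsEff.goodFrob (hE : ∀ x : M, E • x = 0 → x = 0) {r : ℕ} {f : M →ₛₗ[frob p k] M}
    (hf : IsEff M r f) : GoodFrob E f ⊤ := by
  have h1 : ∀ x : M, ∃ h : ℕ, E ^ h • x ∈ frobSpan f ⊤ := by
    intro x
    obtain ⟨s, z, hz⟩ := exists_pow_smul_eq_toAway (M.phi.symm (toAway E M x))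
    refine ⟨r + s, ?_⟩
    rw [← range_linearize]
    refine ⟨z, toAway_injective hE ?_⟩
    rw [hf.toAway_linearize, ← hz, map_smul, LinearEquiv.apply_symm_apply, ← mul_smul, ← pow_add, map_smul]
  choose h hh using h1
  obtain ⟨s, hs⟩ := Module.Finite.fg_top (R := S p k) (M := M)
  refine ⟨s.sup h, fun x _ => ?_⟩
  have hx : x ∈ Submodule.span (S p k) (s : Set M) := hs ▸ trivial
  suffices Submodule.span (S p k) (s : Set M) ≤
      (frobSpan f ⊤).comap (LinearMap.lsmul (S p k) M (E ^ s.sup h)) from this hx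
  rw [Submodule.span_le]
  intro x hx
  obtain ⟨d, hd⟩ := Nat.exists_eq_add_of_le' (Finset.le_sup (f := h) hx)
  change E ^ s.sup h • x ∈ frobSpan f ⊤
  rw [hd, pow_add, mul_smul]
  exact Submodule.smul_mem _ _ (hh x)

end Eff

end KisinHN

namespace KisinHN

open Kisin

universe u v w

/-! ### The linearized Frobenius on a basis, and the effect of a twist on the degree -/

section Generic

variable {R : Type u} [CommRing R] {φ : R →+* R} {p u E : R} {e q : ℕ}
variable {N : Type v} [AddCommGroup N] [Module R N] {g : N →ₛₗ[φ] N}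

theorem exists_eq_sum_tmul {n : ℕ} {b : Fin n → N}
    (hb : ⊤ ≤ Submodule.span R (Set.range b)) (z : Pullback φ N) :
    ∃ c : Fin n → R, z = ∑ j, Pullback.tmul φ (c j) (b j) := by
  induction z using pullback_induction with
  | zero => exact ⟨0, by simp [zero_tmul]⟩
  | tmul a x =>
    obtain ⟨c, rfl⟩ := (Submodule.mem_span_range_iff_exists_fun R).1 (hb (trivial : x ∈ ⊤))
    refine ⟨fun j => φ (c j) * a, ?_⟩
    have h1 : ∀ s : Finset (Fin n), Pullback.tmul φ a (∑ j ∈ s, c j • b j) =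
        ∑ j ∈ s, Pullback.tmul φ (φ (c j) * a) (b j) := by
      intro s
      induction s using Finset.induction_on with
      | empty => simp [tmul_zero]
      | insert i s hi ih =>
        rw [Finset.sum_insert hi, Finset.sum_insert hi, tmul_add, ih, Pullback.tmul_smul]
    exact h1 _
  | add x y hx hy =>
    obtain ⟨c, rfl⟩ := hx
    obtain ⟨d, rfl⟩ := hy
    refine ⟨fun j => c j + d j, ?_⟩
    rw [← Finset.sum_add_distrib]
    refine Finset.sum_congr rfl fun j _ => ?_
    rw [tmul_eq_smul (c j + d j), add_smul, ← tmul_eq_smul, ← tmul_eq_smul]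

variable [IsDomain (R ⧸ Ideal.span {p})] [IsDiscreteValuationRing (R ⧸ Ideal.span {p})]
  [IsNoetherian R N]

/-- The coefficients of a relation are divisible by `p = φ p`; the factor `p` crosses the tensor
sign and kills `b j`. -/
theorem IsPP.linearize_injective (hR : FrobeniusDatum φ p u E e q) (h : IsPP p u g ⊤ ⊥) :
    Function.Injective (linearize g) := by
  obtain ⟨n, b, hb⟩ := h.exists_isPBasis hR.irreducible_u
  obtain ⟨A, hA, hdet, -⟩ := h.exists_matrix hR hb
  refine (injective_iff_map_eq_zero _).2 fun z hz => ?_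
  obtain ⟨c, rfl⟩ := exists_eq_sum_tmul (by simpa using hb.le) z
  simp only [map_sum, linearize_tmul] at hz
  choose d hd using hb.dvd_of_sum_mem (g := g ∘ b) hA hdet ((Submodule.mem_bot R).2 hz)
  refine Finset.sum_eq_zero fun j _ => ?_
  rw [hd j, ← hR.map_p, ← Pullback.tmul_smul, (Submodule.mem_bot R).1 (h.p_mem (b j) trivial),
    tmul_zero]

omit [IsNoetherian R N] in
theorem IsPP.goodFrob (hR : FrobeniusDatum φ p u E e q) (h : IsPP p u g ⊤ ⊥) :
    GoodFrob E g ⊤ := by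
  obtain ⟨k, hk⟩ := h.nondeg
  refine ⟨k, fun x _ => ?_⟩
  obtain ⟨c, hc⟩ := hR.dvd_E_pow_sub k
  have h1 : E ^ k • x = u ^ (e * k) • x := by
    rw [← sub_eq_zero, ← sub_smul, hc, mul_comm, mul_smul,
      (Submodule.mem_bot R).1 (h.p_mem x trivial), smul_zero]
  have h2 := hk x trivial
  rw [bot_sup_eq] at h2
  rw [h1]
  -- Since `e ≥ 1`, the exponent `e * k` by which `E ^ k` acts is at least the exponent `k` of
  -- nondegeneracy.
  obtain ⟨d, hd⟩ := Nat.exists_eq_add_of_le' (Nat.le_mul_of_pos_left k hR.e_pos)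
  rw [hd, pow_add, mul_smul]
  exact Submodule.smul_mem _ _ h2

omit [IsNoetherian R N] [IsDomain (R ⧸ Ideal.span {p})]
  [IsDiscreteValuationRing (R ⧸ Ideal.span {p})] in
theorem pow_smul_mem_imp {Y Z : Submodule R N} (h : IsPM p u Y Z) (n : ℕ) {x : N} (hx : x ∈ Y)
    (hu : u ^ n • x ∈ Z) : x ∈ Z := by
  induction n with
  | zero => simpa using hu
  | succ n ih =>
    rw [pow_succ', mul_smul] at hu
    exact ih (h.u_tf _ (Y.smul_mem _ hx) hu)

omit [IsNoetherian R N] in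
theorem IsPM.mem_of_E_pow_smul_mem (hR : FrobeniusDatum φ p u E e q) {Y Z : Submodule R N}
    (h : IsPM p u Y Z) (n : ℕ) {x : N} (hx : x ∈ Y) (hE : E ^ n • x ∈ Z) : x ∈ Z := by
  obtain ⟨c, hc⟩ := hR.dvd_E_pow_sub n
  refine pow_smul_mem_imp h (e * n) hx ?_
  have h1 : u ^ (e * n) • x = E ^ n • x - c • p • x := by
    rw [smul_smul, mul_comm c, ← hc, ← sub_smul, sub_sub_cancel]
  rw [h1]
  exact sub_mem hE (Z.smul_mem _ (h.p_mem x hx))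

/-- The degree of a twist. -/
theorem IsPP.degree_twist (hR : FrobeniusDatum φ p u E e q) {g₀ : N →ₛₗ[φ] N} {s : ℕ}
    {Y Z : Submodule R N} (hg : ∀ x, g x = E ^ s • g₀ x) (h : IsPP p u g Y Z)
    (hY : Stable g₀ Y) (hZ : Stable g₀ Z) :
    IsPP p u g₀ Y Z ∧ degree g Y Z = s * e * rank u Y Z + degree g₀ Y Z := by
  have h0 : IsPP p u g₀ Y Z := by
    refine ⟨h.toIsPM, hY, hZ, ?_⟩
    obtain ⟨k, hk⟩ := h.nondeg
    have hle : frobSpan g Y ≤ frobSpan g₀ Y := frobSpan_le fun y hy => by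
      rw [hg]
      exact Submodule.smul_mem _ _ (mem_frobSpan hy)
    exact ⟨k, fun y hy => sup_le_sup_left hle Z (hk y hy)⟩
  refine ⟨h0, ?_⟩
  obtain ⟨n, b, hb⟩ := h.exists_isPBasis hR.irreducible_u
  obtain ⟨A, hA, hdet, hlen⟩ := h0.exists_matrix hR hb
  have hA' : ∀ j, (g ∘ b) j - ∑ i, (E ^ s • A) i j • b i ∈ Z := by
    intro j
    have : (g ∘ b) j - ∑ i, (E ^ s • A) i j • b i = E ^ s • (g₀ (b j) - ∑ i, A i j • b i) := by
      simp [hg, smul_sub, Finset.smul_sum, mul_smul]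
    rw [this]
    exact Z.smul_mem _ (hA j)
  have hval : uVal p (E ^ s • A).det = s * e * n + uVal p A.det := by
    have hpow : ∀ m : ℕ, uVal p (E ^ m) = m * e := by
      intro m
      rw [uVal_eq_of_dvd_sub (hR.dvd_E_pow_sub m), hR.uVal_u_pow]
      push_cast
      ring
    rw [Matrix.det_smul, Fintype.card_fin, ← pow_mul, uVal_mul, hpow]
    push_cast
    ring
  have hdet' : ¬ p ∣ (E ^ s • A).det := by
    rw [← uVal_eq_top_iff, hval]
    rw [← uVal_eq_top_iff] at hdet
    intro h
    rcases WithTop.add_eq_top.1 h with h | h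
    · exact absurd h (by exact_mod_cast WithTop.coe_ne_top)
    · exact hdet h
  have h1 := hb.relLength_sup_span h.toIsPM hA' hdet'
  rw [← hb.sup_frobSpan h.toIsPM h.stable_right, hval, ← hlen, ← h0.coe_degree hR,
    ← h.coe_degree hR, ← h.toIsPM.rank_eq hR hb] at h1
  exact_mod_cast h1

section Flat

variable [IsDomain R] [IsNoetherianRing R] [IsLocalRing R]

/-- A flat module of finite type is free. -/
theorem IsFlatPair.exists_basis (hR : FrobeniusDatum φ p u E e q)
    (h : IsFlatPair p u (⊤ : Submodule R N) ⊥) {n : ℕ} {b : Fin n → N}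
    (hb : IsPBasis p (⊤ : Submodule R N) (⊥ ⊔ p • ⊤) b) :
    ∃ B : Module.Basis (Fin n) R N, ⇑B = b := by
  have h1 : LinearIndependent R b := by
    rw [Fintype.linearIndependent_iff]
    intro c hc
    refine congrFun (h.eq_zero_of_sum_mem hR (fun i => trivial) (fun c hc => ?_)
      ((Submodule.mem_bot R).2 hc))
    exact hb.dvd c (Submodule.mem_sup_left hc)
  exact ⟨Module.Basis.mk h1 (by simpa using IsFlatPair.le_sup_span hR hb), Module.Basis.coe_mk _ _⟩

theorem IsFlatPair.free (hR : FrobeniusDatum φ p u E e q)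
    (h : IsFlatPair p u (⊤ : Submodule R N) ⊥) : Module.Free R N := by
  obtain ⟨n, b, hb⟩ := h.isPM.exists_isPBasis hR.irreducible_u
  obtain ⟨B, -⟩ := h.exists_basis hR hb
  exact Module.Free.of_basis B

theorem IsFlatPair.linearize_injective (hR : FrobeniusDatum φ p u E e q)
    (h : IsFlatPair p u (⊤ : Submodule R N) ⊥) (hPP : IsPP p u g ⊤ (⊥ ⊔ p • ⊤)) :
    Function.Injective (linearize g) := by
  obtain ⟨n, b, hb⟩ := hPP.exists_isPBasis hR.irreducible_u
  obtain ⟨A, hA, hdet, -⟩ := hPP.exists_matrix hR hb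
  refine (injective_iff_map_eq_zero _).2 fun z hz => ?_
  obtain ⟨c, rfl⟩ := exists_eq_sum_tmul (by simpa using IsFlatPair.le_sup_span hR hb) z
  simp only [map_sum, linearize_tmul] at hz
  have h3 : c = 0 := h.eq_zero_of_sum_mem hR (g := g ∘ b) (fun i => trivial)
    (fun c hc => hb.dvd_of_sum_mem hA hdet (Submodule.mem_sup_left hc))
      ((Submodule.mem_bot R).2 hz)
  simp [h3, zero_tmul]

end Flat

end Generic

/-! ### The least effective twist and its cokernel of Frobenius -/

section Twist

variable {p : ℕ} [Fact p.Prime] {k : Type u} [Field k] [CharP k p] {E : S p k}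
variable {M : KisinModule.{u, w} p k E}

theorem IsEff.smul_frobLattice {r : ℕ} {f : M →ₛₗ[frob p k] M} (hf : IsEff M r f) :
    E ^ r • M.frobLattice = (frobSpan f ⊤).map (toAway E M) := by
  rw [← range_linearize, ← LinearMap.range_comp]
  ext y
  simp only [Submodule.mem_smul_pointwise_iff_exists, KisinModule.frobLattice, Submodule.mem_map,
    LinearMap.mem_range, LinearMap.comp_apply, hf.toAway_linearize]
  constructor
  · rintro ⟨_, ⟨_, ⟨z, rfl⟩, rfl⟩, rfl⟩
    exact ⟨z, rfl⟩
  · rintro ⟨z, rfl⟩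
    exact ⟨_, ⟨_, ⟨z, rfl⟩, rfl⟩, rfl⟩

/-- Degrees are defined with the least effective twist, whereas the argument uses one common twist
for several modules; the two Frobenii differ by a power of `E`. -/
theorem IsEff.exists_twistExponent (hE : ∀ x : M, E • x = 0 → x = 0) {r : ℕ}
    {f : M →ₛₗ[frob p k] M} (hf : IsEff M r f) : ∃ (s : ℕ) (f₀ : M →ₛₗ[frob p k] M),
      r = s + M.twistExponent ∧ IsEff M M.twistExponent f₀ ∧ ∀ x, f x = E ^ s • f₀ x := by
  have h1 : M.TwistEffective r := by
    rw [KisinModule.TwistEffective, hf.smul_frobLattice]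
    exact LinearMap.map_le_range
  have h2 : M.TwistEffective M.twistExponent := Nat.sInf_mem (s := {r | M.TwistEffective r}) ⟨r, h1⟩
  obtain ⟨s, hs⟩ := Nat.exists_eq_add_of_le' (Nat.sInf_le (s := {r | M.TwistEffective r}) h1)
  obtain ⟨f₀, hf₀⟩ := exists_isEff_of_forall hE (r := M.twistExponent) fun x => by
    obtain ⟨y, hy⟩ := h2 (Submodule.smul_mem_pointwise_smul
      (M.phi (toAway E _ (Pullback.tmul (frob p k) 1 x))) _ _ ⟨_, ⟨_, rfl⟩, rfl⟩)
    exact ⟨y, hy.symm⟩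
  refine ⟨s, f₀, hs, hf₀, fun x => toAway_injective hE ?_⟩
  rw [← hf, map_smul, ← hf₀, ← mul_smul, ← pow_add]
  congr 2

/-- The cokernel of the Frobenius of the least effective twist. -/
noncomputable def twistCokerEquiv (hE : ∀ x : M, E • x = 0 → x = 0) {f : M →ₛₗ[frob p k] M}
    (hf : IsEff M M.twistExponent f) : (M ⧸ frobSpan f ⊤) ≃ₗ[S p k] M.TwistCoker :=
  Submodule.Quotient.equiv _ _ (LinearEquiv.ofInjective (toAway E M) (toAway_injective hE)) (by
    rw [hf.smul_frobLattice]
    ext ⟨y, x, rfl⟩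
    simp only [Submodule.mem_map, mem_submoduleOf_iff]
    constructor
    · rintro ⟨z, hz, h⟩
      exact ⟨z, hz, congrArg Subtype.val h⟩
    · rintro ⟨z, hz, h⟩
      exact ⟨z, hz, Subtype.ext h⟩)

end Twist

end KisinHN

namespace KisinHN

open Kisin

universe u v w

/-! ### The ring `W(k)⟦u⟧` -/

section RingS

variable (p : ℕ) [Fact p.Prime] (k : Type u) [Field k] [CharP k p]

/-- Reduction modulo `p`. -/
noncomputable def reduction : S p k →+* k⟦X⟧ := PowerSeries.map WittVector.constantCoeff

omit [CharP k p] in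
theorem frob_natCast_p : frob p k (p : S p k) = p := map_natCast _ _

omit [CharP k p] in
theorem frob_X : frob p k PowerSeries.X = PowerSeries.X ^ p := by
  change PowerSeries.expand p (Fact.out : p.Prime).ne_zero (PowerSeries.map _ PowerSeries.X) = _
  rw [PowerSeries.map_X, PowerSeries.expand_X]

omit [CharP k p] in
theorem natCast_dvd_iff (n : ℕ) (f : S p k) :
    (p : S p k) ^ n ∣ f ↔ ∀ i, (p : WittVector p k) ^ n ∣ PowerSeries.coeff i f := by
  have hC : (p : S p k) ^ n = PowerSeries.C ((p : WittVector p k) ^ n) := by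
    rw [map_pow, map_natCast]
  rw [hC]
  constructor
  · rintro ⟨g, rfl⟩ i
    rw [PowerSeries.coeff_C_mul]
    exact Dvd.intro _ rfl
  · intro h
    choose g hg using h
    exact ⟨PowerSeries.mk g, by ext1 i; rw [PowerSeries.coeff_C_mul, PowerSeries.coeff_mk, hg]⟩

omit [CharP k p] in
theorem reduction_surjective : Function.Surjective (reduction p k) :=
  PowerSeries.map_surjective _ (WittVector.constantCoeff_surjective p)

variable [PerfectRing k p]

theorem constantCoeff_eq_zero_iff (a : WittVector p k) :
    WittVector.constantCoeff a = 0 ↔ (p : WittVector p k) ∣ a := by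
  rw [← RingHom.mem_ker, WittVector.ker_constantCoeff, Ideal.mem_span_singleton]

theorem ker_reduction : RingHom.ker (reduction p k) = Ideal.span {(p : S p k)} := by
  ext f
  rw [RingHom.mem_ker, Ideal.mem_span_singleton, ← pow_one (p : S p k), natCast_dvd_iff,
    PowerSeries.ext_iff]
  simp only [reduction, PowerSeries.coeff_map, map_zero, constantCoeff_eq_zero_iff, pow_one]

/-- `𝔖/p ≃ k⟦u⟧`. -/
noncomputable def quotientEquiv : (S p k ⧸ Ideal.span {(p : S p k)}) ≃+* k⟦X⟧ :=
  (Ideal.quotEquivOfEq (ker_reduction p k).symm).trans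
    (RingHom.quotientKerEquivOfSurjective (reduction_surjective p k))

theorem quotientEquiv_mk (f : S p k) :
    quotientEquiv p k (Ideal.Quotient.mk _ f) = reduction p k f := rfl

instance isDomain_quotient : IsDomain (S p k ⧸ Ideal.span {(p : S p k)}) :=
  (quotientEquiv p k).toMulEquiv.isDomain _

instance isDiscreteValuationRing_quotient :
    IsDiscreteValuationRing (S p k ⧸ Ideal.span {(p : S p k)}) :=
  IsDiscreteValuationRing.RingEquivClass.isDiscreteValuationRing (quotientEquiv p k).symm

omit [PerfectRing k p] in
theorem natCast_p_ne_zero : (p : S p k) ≠ 0 := by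
  intro h
  have h1 := congrArg (PowerSeries.constantCoeff (R := WittVector p k)) h
  rw [map_natCast, map_zero] at h1
  exact (WittVector.irreducible (k := k) p).ne_zero h1

theorem prime_natCast_p : Prime (p : S p k) := by
  rw [← Ideal.span_singleton_prime (natCast_p_ne_zero p k), ← Ideal.Quotient.isDomain_iff_prime]
  infer_instance

theorem irreducible_mk_X :
    Irreducible (Ideal.Quotient.mk (Ideal.span {(p : S p k)}) PowerSeries.X) := by
  rw [← MulEquiv.irreducible_iff (quotientEquiv p k), quotientEquiv_mk, reduction,
    PowerSeries.map_X]
  exact PowerSeries.X_irreducible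

theorem isPrecomplete_span_p : IsPrecomplete (Ideal.span {(p : S p k)}) (S p k) := by
  constructor
  intro f hf
  have h1 : ∀ i, ∃ L : WittVector p k, ∀ n, (p : WittVector p k) ^ n ∣
      PowerSeries.coeff i (f n) - L := by
    intro i
    have := (WittVector.isAdicCompleteIdealSpanP (p := p) (k := k)).toIsPrecomplete
    obtain ⟨L, hL⟩ := this.prec (f := fun n => PowerSeries.coeff i (f n)) (fun {m n} hmn => by
      have := hf hmn
      rw [SModEq.sub_mem, Ideal.span_singleton_pow, smul_eq_mul, Ideal.mul_top,
        Ideal.mem_span_singleton] at this ⊢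
      rw [← map_sub]
      exact (natCast_dvd_iff p k m _).1 this i)
    refine ⟨L, fun n => ?_⟩
    have := hL n
    rwa [SModEq.sub_mem, Ideal.span_singleton_pow, smul_eq_mul, Ideal.mul_top,
      Ideal.mem_span_singleton] at this
  choose L hL using h1
  refine ⟨PowerSeries.mk L, fun n => ?_⟩
  rw [SModEq.sub_mem, Ideal.span_singleton_pow, smul_eq_mul, Ideal.mul_top,
    Ideal.mem_span_singleton, natCast_dvd_iff]
  intro i
  rw [map_sub, PowerSeries.coeff_mk]
  exact hL i n

theorem frobeniusDatum {E : S p k} {e : ℕ} (he : 0 < e)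
    (hE : (p : S p k) ∣ E - PowerSeries.X ^ e) (hprime : Prime E) :
    FrobeniusDatum (frob p k) (p : S p k) PowerSeries.X E e p where
  prime_p := prime_natCast_p p k
  irreducible_u := irreducible_mk_X p k
  map_p := frob_natCast_p p k
  map_u := frob_X p k
  two_le := (Fact.out : p.Prime).two_le
  dvd_sub := hE
  e_pos := he
  prime_E := hprime
  precomplete := isPrecomplete_span_p p k

/-! ### Lengths over `ℤ_p` -/

theorem isLocalHom_padicToS : IsLocalHom (padicToS p k) := by
  constructor
  intro a ha
  by_contra h
  have h1 : a ∈ IsLocalRing.maximalIdeal ℤ_[p] := h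
  rw [PadicInt.maximalIdeal_eq_span_p, Ideal.mem_span_singleton] at h1
  obtain ⟨b, rfl⟩ := h1
  rw [map_mul, map_natCast] at ha
  exact (prime_natCast_p p k).not_isUnit (isUnit_of_mul_isUnit_left ha)

/-- The residue degree `[k : 𝔽_p]`. -/
noncomputable def resDeg : ℕ∞ :=
  letI : Algebra ℤ_[p] (S p k) := (padicToS p k).toAlgebra
  haveI : IsLocalHom (algebraMap ℤ_[p] (S p k)) := isLocalHom_padicToS p k
  Module.length (IsLocalRing.ResidueField ℤ_[p]) (IsLocalRing.ResidueField (S p k))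

theorem lengthZp_eq (T : Type v) [AddCommGroup T] [Module (S p k) T] :
    lengthZp p k T = Module.length (S p k) T * resDeg p k := by
  let : Algebra ℤ_[p] (S p k) := (padicToS p k).toAlgebra
  have : IsLocalHom (algebraMap ℤ_[p] (S p k)) := isLocalHom_padicToS p k
  let : Module ℤ_[p] T := Module.compHom T (padicToS p k)
  have : IsScalarTower ℤ_[p] (S p k) T := ⟨fun a b t => mul_smul (padicToS p k a) b t⟩
  exact IsLocalRing.length_restrictScalars ℤ_[p] (S p k) T

/-- The residue field of `𝔖`. -/
noncomputable def toResidue : S p k →+* k := WittVector.constantCoeff.comp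
  (PowerSeries.constantCoeff (R := WittVector p k))

omit [CharP k p] [PerfectRing k p] in
theorem toResidue_surjective : Function.Surjective (toResidue p k) := fun a => by
  obtain ⟨b, rfl⟩ := WittVector.constantCoeff_surjective p a
  exact ⟨PowerSeries.C b, by simp [toResidue]⟩

theorem nat_card_residueField : Nat.card (IsLocalRing.ResidueField (S p k)) = Nat.card k := by
  have h1 : RingHom.ker (toResidue p k) = IsLocalRing.maximalIdeal (S p k) :=
    IsLocalRing.eq_maximalIdeal (RingHom.ker_isMaximal_of_surjective _ (toResidue_surjective p k))
  exact Nat.card_congr ((Ideal.quotEquivOfEq h1.symm).trans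
    (RingHom.quotientKerEquivOfSurjective (toResidue_surjective p k))).toEquiv

theorem exists_resDeg [Finite k] : ∃ d : ℕ, resDeg p k = d ∧ Nat.card k = p ^ d := by
  let : Algebra ℤ_[p] (S p k) := (padicToS p k).toAlgebra
  have : IsLocalHom (algebraMap ℤ_[p] (S p k)) := isLocalHom_padicToS p k
  have : Finite (IsLocalRing.ResidueField (S p k)) := by
    have : Nat.card (IsLocalRing.ResidueField (S p k)) ≠ 0 := by
      rw [nat_card_residueField]; exact Nat.card_pos.ne'
    exact (Nat.card_ne_zero.1 this).2
  have : Finite (IsLocalRing.ResidueField ℤ_[p]) :=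
    Finite.of_equiv _ (PadicInt.residueField (p := p)).toEquiv.symm
  refine ⟨Module.finrank (IsLocalRing.ResidueField ℤ_[p])
        (IsLocalRing.ResidueField (S p k)), ?_, ?_⟩
  · exact Module.length_eq_finrank _ _
  · rw [← nat_card_residueField p k, Module.natCard_eq_pow_finrank
      (K := IsLocalRing.ResidueField ℤ_[p]),
      Nat.card_congr (PadicInt.residueField (p := p)).toEquiv, Nat.card_zmod]

end RingS

end KisinHN

namespace KisinHN

open Kisin

universe u v w

/-! ### Rank over `𝒪_ℰ` and slopes of Kisin modules killed by `p` -/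

section Rank

variable {p : ℕ} [Fact p.Prime] {k : Type u} [Field k] [CharP k p] [PerfectRing k p] {E : S p k}
  {e : ℕ}

variable (p k) in
/-- `𝔖[1/u]`. -/
abbrev Sinv : Type u := Localization.Away (PowerSeries.X : S p k)

/-- Inverting `u` creates no new divisibility by `p`, because `p` is prime and does not divide `u`.
-/
theorem dvd_algebraMap_iff (n : ℕ) (a : S p k) :
    (p : Sinv p k) ^ n ∣ algebraMap (S p k) (Sinv p k) a ↔ (p : S p k) ^ n ∣ a := by
  constructor
  · rintro ⟨b, hb⟩
    obtain ⟨⟨c, ⟨_, m, rfl⟩⟩, hc⟩ := IsLocalization.surj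
      (Submonoid.powers (PowerSeries.X : S p k)) b
    have h1 : algebraMap (S p k) (Sinv p k) (PowerSeries.X ^ m * a) =
        algebraMap (S p k) (Sinv p k) ((p : S p k) ^ n * c) := by
      rw [map_mul, map_mul, ← hc, hb, map_pow _ (p : S p k), map_natCast]
      simp only
      ring
    have hinj : Function.Injective (algebraMap (S p k) (Sinv p k)) :=
      IsLocalization.injective _ (powers_le_nonZeroDivisors_of_noZeroDivisors
        PowerSeries.X_prime.ne_zero)
    refine (prime_natCast_p p k).pow_dvd_of_dvd_mul_left n ?_ (Dvd.intro _ (hinj h1).symm)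
    intro h
    have h2 := (prime_natCast_p p k).dvd_of_dvd_pow h
    have h3 := (mk_eq_zero_iff_dvd (p := (p : S p k))).2 h2
    exact (irreducible_mk_X p k).ne_zero h3
  · rintro ⟨b, rfl⟩
    rw [map_mul, map_pow, map_natCast]
    exact Dvd.intro _ rfl

/-- The quotient `𝔖[1/u] / p` is the field `k((u))`: an element of `𝔖` not divisible by `p` is
associated modulo `p` to a power of `u`, and `u` is invertible here. -/
theorem isMaximal_span_Sinv : (Ideal.span {(p : Sinv p k)}).IsMaximal := by
  rw [Ideal.isMaximal_iff]
  constructor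
  · rw [Ideal.mem_span_singleton, ← map_one (algebraMap (S p k) (Sinv p k)),
      ← pow_one (p : Sinv p k), dvd_algebraMap_iff, pow_one]
    exact fun h => (prime_natCast_p p k).not_isUnit (isUnit_of_dvd_one h)
  · intro J x hJ hx hxJ
    obtain ⟨⟨a, s⟩, ha⟩ := IsLocalization.surj (Submonoid.powers (PowerSeries.X : S p k)) x
    simp only at ha
    have h1 : ¬ (p : S p k) ∣ a := by
      intro h
      rw [Ideal.mem_span_singleton] at hx
      rw [← pow_one (p : S p k), ← dvd_algebraMap_iff, pow_one, ← ha,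
        (IsLocalization.map_units (Sinv p k) s).dvd_mul_right] at h
      exact hx h
    obtain ⟨n, y, hy⟩ := IsDiscreteValuationRing.associated_pow_irreducible
      (fun h => h1 (mk_eq_zero_iff_dvd.1 h)) (irreducible_mk_X p k)
    obtain ⟨b, hb⟩ := Ideal.Quotient.mk_surjective (y : S p k ⧸ Ideal.span {(p : S p k)})
    rw [← hb, ← map_mul, ← map_pow, ← sub_eq_zero, ← map_sub, mk_eq_zero_iff_dvd] at hy
    obtain ⟨c, hc⟩ := hy
    have h2 : algebraMap (S p k) (Sinv p k) (PowerSeries.X ^ n) ∈ J := by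
      have : (PowerSeries.X ^ n : S p k) = a * b - p * c := by rw [← hc]; ring
      rw [this, map_sub, map_mul, map_mul, ← ha, map_natCast]
      exact J.sub_mem (J.mul_mem_right _ (J.mul_mem_right _ hxJ))
        (hJ (Ideal.mul_mem_right _ _ (Ideal.mem_span_singleton_self _)))
    have h3 := IsLocalization.map_units (Sinv p k)
      (⟨PowerSeries.X ^ n, n, rfl⟩ : Submonoid.powers (PowerSeries.X : S p k))
    rw [J.eq_top_of_isUnit_mem h2 h3]
    trivial

theorem isMaximal_span_OE : (Ideal.span {(p : OE p k)}).IsMaximal := by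
  let I := Ideal.span {(p : Sinv p k)}
  have h1 := AdicCompletion.ker_evalOneₐ_eq_map I ⟨{(p : Sinv p k)}, by simp [I]⟩
  rw [Ideal.map_span, Set.image_singleton, map_natCast] at h1
  have : I.IsMaximal := isMaximal_span_Sinv
  let := Ideal.Quotient.field I
  have h2 := RingHom.ker_isMaximal_of_surjective (AdicCompletion.evalOneₐ I).toRingHom
    (AdicCompletion.evalOneₐ_surjective I)
  rwa [h1] at h2

/-- Otherwise `p ^ n = 0` in `𝒪_ℰ` for some `n`. Reducing modulo `p ^ (n + 1)` would make `p ^ (n +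
1)` divide `p ^ n` in `𝔖`. -/
theorem nontrivial_EE : Nontrivial (EE p k) := by
  rw [← not_subsingleton_iff_nontrivial]
  intro h
  rw [IsLocalization.subsingleton_iff (M := Submonoid.powers (p : OE p k))] at h
  obtain ⟨n, hn⟩ := h
  let I := Ideal.span {(p : Sinv p k)}
  have h1 := congrArg (AdicCompletion.evalₐ I (n + 1)) hn
  simp only [map_pow, map_natCast, map_zero] at h1
  rw [← map_natCast (Ideal.Quotient.mk _), ← map_pow, Ideal.Quotient.eq_zero_iff_mem,
    Ideal.span_singleton_pow, Ideal.mem_span_singleton,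
    show (p : Sinv p k) ^ n = algebraMap (S p k) _ (p ^ n) by rw [map_pow, map_natCast],
    dvd_algebraMap_iff, pow_succ] at h1
  have := (mul_dvd_mul_iff_left (pow_ne_zero n (natCast_p_ne_zero p k))).1
    (h1.trans (mul_one _).symm.dvd)
  exact (prime_natCast_p p k).not_isUnit (isUnit_of_dvd_one this)

theorem length_OE_tensor :
    Module.length (OE p k) (OE p k ⊗[S p k] (S p k ⧸ Ideal.span {(p : S p k)})) = 1 := by
  rw [← (Algebra.TensorProduct.quotIdealMapEquivTensorQuot (OE p k)
    (Ideal.span {(p : S p k)})).toLinearEquiv.length_eq, Module.length_eq_one_iff,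
    Ideal.map_span, Set.image_singleton, map_natCast]
  have := isMaximal_span_OE (p := p) (k := k)
  exact isSimpleModule_iff_quot_maximal.2 ⟨_, this, ⟨LinearEquiv.refl _ _⟩⟩

omit [CharP k p] [PerfectRing k p] in
/-- A module killed by `p` without `u`-torsion is a sum of copies of `𝔖/p`. -/
theorem IsPBasis.exists_linearEquiv {N : Type v} [AddCommGroup N] [Module (S p k) N] {n : ℕ}
    {b : Fin n → N} (hb : IsPBasis (p : S p k) (⊤ : Submodule (S p k) N) ⊥ b)
    (hp : ∀ x : N, (p : S p k) • x = 0) :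
    Nonempty ((Fin n → S p k ⧸ Ideal.span {(p : S p k)}) ≃ₗ[S p k] N) := by
  let l : ∀ i, (S p k ⧸ Ideal.span {(p : S p k)}) →ₗ[S p k] N := fun i =>
    Submodule.liftQ _ (LinearMap.toSpanSingleton (S p k) N (b i)) (by
      rw [Submodule.span_le, Set.singleton_subset_iff]
      exact hp (b i))
  let L := LinearMap.lsum (S p k) (fun _ : Fin n => S p k ⧸ Ideal.span {(p : S p k)}) (S p k) l
  have hL : ∀ c : Fin n → S p k, L (fun i => Ideal.Quotient.mk _ (c i)) = ∑ i, c i • b i := by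
    intro c
    simp only [L, LinearMap.lsum_apply, LinearMap.sum_apply, LinearMap.comp_apply,
      LinearMap.proj_apply]
    rfl
  refine ⟨LinearEquiv.ofBijective L ⟨?_, fun x => ?_⟩⟩
  · refine (injective_iff_map_eq_zero _).2 fun x hx => ?_
    choose c hc using fun i => Ideal.Quotient.mk_surjective (x i)
    obtain rfl : (fun i => Ideal.Quotient.mk _ (c i)) = x := funext hc
    rw [hL] at hx
    funext i
    exact mk_eq_zero_iff_dvd.2 (hb.dvd c ((Submodule.mem_bot _).2 hx) i)
  · obtain ⟨c, hc⟩ := hb.exists_coeff (trivial : x ∈ ⊤)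
    refine ⟨_, (hL c).trans ?_⟩
    rw [Submodule.mem_bot, sub_eq_zero] at hc
    exact hc.symm

variable (hR : FrobeniusDatum (frob p k) (p : S p k) PowerSeries.X E e p)
include hR

variable {M : KisinModule.{u, w} p k E}

theorem torRank_eq (h : IsPM (p : S p k) PowerSeries.X (⊤ : Submodule (S p k) M) ⊥) :
    M.torRank = rank (PowerSeries.X : S p k) (⊤ : Submodule (S p k) M) ⊥ := by
  obtain ⟨n, b, hb⟩ := h.exists_isPBasis hR.irreducible_u
  obtain ⟨ε⟩ := hb.exists_linearEquiv fun x => (Submodule.mem_bot _).1 (h.p_mem x trivial)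
  rw [h.rank_eq hR hb, KisinModule.torRank,
    ← (TensorProduct.AlgebraTensorModule.congr (LinearEquiv.refl (OE p k) (OE p k)) ε).length_eq,
    (TensorProduct.piRight (S p k) (OE p k) (OE p k)
      (fun _ : Fin n => S p k ⧸ Ideal.span {(p : S p k)})).length_eq, Module.length_pi]
  simp [length_OE_tensor]

variable {d g r : ℕ} {f : M →ₛₗ[frob p k] M}

/-- Passing from `𝔖`-length to `ℤ_p`-length multiplies by `d = [k : 𝔽_p]`, which together with `1 /
g` leaves `1 / e`. Replacing the least effective twist by `r` adds `e` times the rank to the degree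
for each extra twist. So `r` may be any effective exponent. -/
theorem torSlope_eq (hd : resDeg p k = d) (hd0 : 0 < d) (hg : g = e * d) (hf : IsEff M r f)
    (h : IsPP (p : S p k) PowerSeries.X f (⊤ : Submodule (S p k) M) ⊥)
    (hr : 0 < rank (PowerSeries.X : S p k) (⊤ : Submodule (S p k) M) ⊥) :
    M.torSlope g = (degree f (⊤ : Submodule (S p k) M) ⊥ : ℚ) /
      (e * rank (PowerSeries.X : S p k) (⊤ : Submodule (S p k) M) ⊥) - r := by
  have hE : ∀ x : M, E • x = 0 → x = 0 := fun x hx => (Submodule.mem_bot (S p k)).1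
    (h.toIsPM.mem_of_E_pow_smul_mem hR 1 (x := x) trivial (by simpa using hx))
  obtain ⟨s, f₀, hs, hf₀, hff⟩ := hf.exists_twistExponent hE
  obtain ⟨h0, hdeg⟩ := h.degree_twist hR hff stable_top stable_bot
  have hlen : Module.length (S p k) M.TwistCoker = degree f₀ (⊤ : Submodule (S p k) M) ⊥ := by
    rw [← (twistCokerEquiv hE hf₀).length_eq, h0.coe_degree hR, bot_sup_eq, relLength_top_eq]
  have he : (e : ℚ) ≠ 0 := by exact_mod_cast hR.e_pos.ne'
  have hd' : (d : ℚ) ≠ 0 := by exact_mod_cast hd0.ne'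
  have hr' : (rank (PowerSeries.X : S p k) (⊤ : Submodule (S p k) M) ⊥ : ℚ) ≠ 0 := by
    exact_mod_cast hr.ne'
  rw [KisinModule.torSlope, KisinModule.torDeg, torRank_eq hR h.toIsPM, lengthZp_eq, hlen, hd,
    ← ENat.natCast_mul, ENat.toNat_natCast, hdeg, hg, hs]
  push_cast
  field_simp
  ring

end Rank

end KisinHN

namespace KisinHN

open Kisin

universe u v w

/-! ### The characteristic ideal of a cokernel -/

section CharIdeal

variable {R : Type u} [CommRing R] [IsDomain R] [IsNoetherianRing R] {E : R}

theorem height_span_singleton_of_prime (hE : Prime E) : (Ideal.span {E}).height = 1 := by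
  have hp : (Ideal.span {E}).IsPrime := (Ideal.span_singleton_prime hE.ne_zero).2 hE
  apply le_antisymm
  · refine Ideal.height_le_one_of_isPrincipal_of_mem_minimalPrimes (Ideal.span {E}) _ ?_
    rw [Ideal.minimalPrimes_eq_subsingleton_self]
    rfl
  · rw [Order.one_le_iff_ne_zero, Ne, Ideal.height_eq_zero_iff_eq_bot, Ideal.span_singleton_eq_bot]
    exact hE.ne_zero

/-- The localization at a principal prime is a discrete valuation ring with the expected
uniformizer. -/
theorem isDiscreteValuationRing_localization (hE : Prime E) [hp : (Ideal.span {E}).IsPrime] :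
    IsDiscreteValuationRing (Localization.AtPrime (Ideal.span {E})) ∧
      IsLocalRing.maximalIdeal (Localization.AtPrime (Ideal.span {E})) =
        Ideal.span {algebraMap R _ E} := by
  have h1 : IsLocalRing.maximalIdeal (Localization.AtPrime (Ideal.span {E})) =
        Ideal.span {algebraMap R _ E} := by
    rw [← Localization.AtPrime.map_eq_maximalIdeal, Ideal.map_span, Set.image_singleton]
  refine ⟨?_, h1⟩
  have : IsNoetherianRing (Localization.AtPrime (Ideal.span {E})) :=
    IsLocalization.isNoetherianRing (Ideal.span {E}).primeCompl _ inferInstance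
  have hne : algebraMap R (Localization.AtPrime (Ideal.span {E})) E ≠ 0 := by
    rw [Ne, FaithfulSMul.algebraMap_eq_zero_iff]
    exact hE.ne_zero
  have hnf : ¬ IsField (Localization.AtPrime (Ideal.span {E})) := fun h => hne ?_
  · have hpr : (IsLocalRing.maximalIdeal
        (Localization.AtPrime (Ideal.span {E}))).IsPrincipal := ⟨_, h1⟩
    exact ((IsDiscreteValuationRing.TFAE _ hnf).out 0 4).2 hpr
  rw [IsLocalRing.isField_iff_maximalIdeal_eq, h1, Ideal.span_singleton_eq_bot] at h
  exact h

omit [IsNoetherianRing R] in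
-- There is a matrix whose product with `A` is `E ^ h` times the identity, so `det A` divides a
-- power of the prime `E`.
theorem associated_det_pow (hE : Prime E) {n : ℕ} {A : Matrix (Fin n) (Fin n) R} {h : ℕ}
    (hA : ∀ x, E ^ h • x ∈ LinearMap.range A.mulVecLin) : ∃ d, Associated A.det (E ^ d) := by
  choose B hB using fun j => hA (Pi.single j 1)
  have h1 : A * (Matrix.of B).transpose = E ^ h • (1 : Matrix (Fin n) (Fin n) R) := by
    ext i j
    have := congrFun (hB j) i
    rw [Matrix.mulVecLin_apply] at this
    rw [Matrix.mul_apply]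
    simp only [Matrix.transpose_apply, Matrix.of_apply]
    refine this.trans ?_
    simp [Pi.single_apply, Matrix.one_apply]
  have h2 := congrArg Matrix.det h1
  rw [Matrix.det_mul, Matrix.det_smul, Matrix.det_one, mul_one, ← pow_mul] at h2
  obtain ⟨d, -, hd⟩ := (dvd_prime_pow hE _).1 (Dvd.intro _ h2)
  exact ⟨d, hd⟩

attribute [local instance] IsLocalizedModule.isScalarTower_module in
-- Localization at `(E)` is exact, so it turns the cokernel of `A` into the cokernel of the same
-- matrix over a discrete valuation ring with uniformizer `E`, where the length is the valuation of
-- the determinant.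
theorem length_localizedModule (hE : Prime E) [hp : (Ideal.span {E}).IsPrime] {n : ℕ}
    {A : Matrix (Fin n) (Fin n) R} {d : ℕ} (hd : Associated A.det (E ^ d)) {T : Type v}
    [AddCommGroup T] [Module R T] (ε : T ≃ₗ[R] ((Fin n → R) ⧸ LinearMap.range A.mulVecLin)) :
    Module.length (Localization.AtPrime (Ideal.span {E}))
      (LocalizedModule (Ideal.span {E}).primeCompl T) = d := by
  set P := Ideal.span {E}
  obtain ⟨hD, hmax⟩ := isDiscreteValuationRing_localization hE
  let ι : (Fin n → R) →ₗ[R] (Fin n → Localization.AtPrime P) :=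
    .pi fun i => Algebra.linearMap R (Localization.AtPrime P) ∘ₗ .proj i
  have hι : ∀ x i, ι x i = algebraMap R _ (x i) := fun x i => rfl
  let A' := A.map (algebraMap R (Localization.AtPrime P))
  have h1 : (LinearMap.range A.mulVecLin).localized' (Localization.AtPrime P) P.primeCompl ι =
      LinearMap.range A'.mulVecLin := by
    rw [Matrix.range_mulVecLin, Submodule.localized'_span, Matrix.range_mulVecLin,
      ← Set.range_comp]
    rfl
  let q := (LinearMap.range A.mulVecLin).toLocalizedQuotient' (Localization.AtPrime P)
    P.primeCompl ι
  let q' := q ∘ₗ ε.toLinearMap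
  have hq' : IsLocalizedModule P.primeCompl q' :=
    IsLocalizedModule.of_linearEquiv_right P.primeCompl q ε
  let ψ := (IsLocalizedModule.linearEquiv P.primeCompl
    (LocalizedModule.mkLinearMap P.primeCompl T) q').extendScalarsOfIsLocalization P.primeCompl
      (Localization.AtPrime P)
  have hdet : A'.det = algebraMap R _ A.det := (RingHom.map_det _ _).symm
  obtain ⟨c, hc⟩ := hd.symm
  have hirr : Irreducible (algebraMap R (Localization.AtPrime P) E) :=
    (IsDiscreteValuationRing.irreducible_iff_uniformizer _).2 hmax
  have h2 : A'.det = (Units.map (algebraMap R (Localization.AtPrime P)).toMonoidHom c : _) *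
      algebraMap R (Localization.AtPrime P) E ^ d := by
    rw [hdet, ← hc, map_mul, map_pow, mul_comm]
    rfl
  have h3 : A'.det ≠ 0 := by
    rw [h2]
    exact mul_ne_zero (Units.ne_zero _) (pow_ne_zero _ hirr.ne_zero)
  rw [ψ.length_eq, h1, length_quotient_range_mulVecLin A' h3,
    IsDiscreteValuationRing.addVal_def _ _ hirr d h2]

/-- Since `E ^ h` kills `T`, only height-one primes containing `E` contribute, and `(E)` is the only
one. -/
theorem charIdeal_eq (hE : Prime E) {n : ℕ} {A : Matrix (Fin n) (Fin n) R} {h : ℕ}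
    (hA : ∀ x, E ^ h • x ∈ LinearMap.range A.mulVecLin) {d : ℕ} (hd : Associated A.det (E ^ d))
    {T : Type v} [AddCommGroup T] [Module R T]
    (ε : T ≃ₗ[R] ((Fin n → R) ⧸ LinearMap.range A.mulVecLin)) :
    charIdeal R T = Ideal.span {E ^ d} := by
  have hp : (Ideal.span {E}).IsPrime := (Ideal.span_singleton_prime hE.ne_zero).2 hE
  rw [charIdeal, finprod_eq_single _
    ⟨⟨Ideal.span {E}, hp⟩, height_span_singleton_of_prime hE⟩]
  · simp only
    rw [length_localizedModule hE hd ε, ENat.toNat_natCast, Ideal.span_singleton_pow]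
  · rintro ⟨P, hP⟩ hne
    have hEP : E ∉ P.asIdeal := by
      intro hmem
      refine hne (Subtype.ext (PrimeSpectrum.ext ?_))
      exact Ideal.eq_span_singleton_of_height_eq_one hP hmem hE
    have : Subsingleton (LocalizedModule P.asIdeal.primeCompl T) := by
      rw [LocalizedModule.subsingleton_iff]
      intro t
      refine ⟨E ^ h, fun hmem => hEP (P.isPrime.mem_of_pow_mem _ hmem), ?_⟩
      obtain ⟨x, hx⟩ := Submodule.Quotient.mk_surjective _ (ε t)
      apply ε.injective
      rw [map_smul, map_zero, ← hx, ← Submodule.Quotient.mk_smul, Submodule.Quotient.mk_eq_zero]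
      exact hA x
    simp only
    rw [Module.length_eq_zero, ENat.toNat_zero, pow_zero]

end CharIdeal

/-! ### Slopes of flat Kisin modules -/

section FlatSlope

variable {p : ℕ} [Fact p.Prime] {k : Type u} [Field k] [CharP k p] [PerfectRing k p] {E : S p k}
  {e : ℕ} (hR : FrobeniusDatum (frob p k) (p : S p k) PowerSeries.X E e p)
  {M : KisinModule.{u, w} p k E} {r : ℕ} {f : M →ₛₗ[frob p k] M}
include hR

theorem flatRank_eq (hM : IsFlatPair (p : S p k) PowerSeries.X (⊤ : Submodule (S p k) M) ⊥) :
    M.flatRank = rank (PowerSeries.X : S p k) (⊤ : Submodule (S p k) M) (⊥ ⊔ (p : S p k) • ⊤) := by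
  obtain ⟨n, b, hb⟩ := hM.isPM.exists_isPBasis hR.irreducible_u
  obtain ⟨B, -⟩ := hM.exists_basis hR hb
  have := nontrivial_EE (p := p) (k := k)
  rw [hM.isPM.rank_eq hR hb, KisinModule.flatRank,
    Module.finrank_eq_card_basis (B.baseChange (EE p k)), Fintype.card_fin]

/-- The determinant of Frobenius in a basis is a unit times `E ^ d`, where `(E ^ d)` is the
characteristic ideal of its cokernel. Modulo `p` it has `u`-adic valuation `d * e`, so the degree of
the reduction is `e` times the degree over `𝔖`. -/
theorem flatSlope_eq (hM : IsFlatPair (p : S p k) PowerSeries.X (⊤ : Submodule (S p k) M) ⊥)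
    (hE : ∀ x : M, E • x = 0 → x = 0) (hf : IsEff M r f)
    (hr : 0 < rank (PowerSeries.X : S p k) (⊤ : Submodule (S p k) M) (⊥ ⊔ (p : S p k) • ⊤)) :
    M.flatSlope = (degree f (⊤ : Submodule (S p k) M) (⊥ ⊔ (p : S p k) • ⊤) : ℚ) /
      (e * rank (PowerSeries.X : S p k) (⊤ : Submodule (S p k) M) (⊥ ⊔ (p : S p k) • ⊤)) - r := by
  obtain ⟨s, f₀, hs, hf₀, hff⟩ := hf.exists_twistExponent hE
  have hst : ∀ f : M →ₛₗ[frob p k] M,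
      Stable f ((⊥ : Submodule (S p k) M) ⊔ (p : S p k) • ⊤) := fun f =>
    stable_sup_smul hR stable_top stable_bot
  have hPP : IsPP (p : S p k) PowerSeries.X f (⊤ : Submodule (S p k) M) (⊥ ⊔ (p : S p k) • ⊤) :=
    hM.isPM.isPP hR stable_top (hst f) ((hf.goodFrob hE).sup _)
  obtain ⟨h0, hdeg⟩ := hPP.degree_twist hR hff stable_top (hst f₀)
  obtain ⟨n, b, hb⟩ := hM.isPM.exists_isPBasis hR.irreducible_u
  obtain ⟨B, hB⟩ := hM.exists_basis hR hb
  let A : Matrix (Fin n) (Fin n) (S p k) := Matrix.of fun i j => B.repr (f₀ (b j)) i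
  have hAcol : ∀ j, A.col j = B.equivFun (f₀ (b j)) := fun j => rfl
  have hmap : (frobSpan f₀ ⊤).map B.equivFun.toLinearMap = LinearMap.range A.mulVecLin := by
    rw [Matrix.range_mulVecLin, ← B.span_eq, hB, frobSpan_span, Submodule.map_span, ← Set.range_comp,
      ← Set.range_comp]
    rfl
  let ε := (twistCokerEquiv hE hf₀).symm.trans
    (Submodule.Quotient.equiv (frobSpan f₀ ⊤) (LinearMap.range A.mulVecLin) B.equivFun hmap)
  obtain ⟨h, hh⟩ := hf₀.goodFrob hE
  have hA : ∀ x, E ^ h • x ∈ LinearMap.range A.mulVecLin := by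
    intro x
    obtain ⟨y, rfl⟩ := B.equivFun.surjective x
    rw [← hmap, ← map_smul]
    exact Submodule.mem_map_of_mem (hh y trivial)
  obtain ⟨d, hd⟩ := associated_det_pow hR.prime_E hA
  have hchar := charIdeal_eq hR.prime_E hA hd ε
  -- The infimum in `KisinModule.flatDeg` is over a single exponent, because powers of the prime `E`
  -- generate distinct ideals.
  have hset : {d : ℕ | charIdeal (S p k) M.TwistCoker = Ideal.span {E ^ d}} = {d} := by
    ext d'
    rw [Set.mem_ofPred_eq, Set.mem_singleton_iff, hchar, Ideal.span_singleton_eq_span_singleton]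
    constructor
    · intro h
      exact ((pow_dvd_pow_iff hR.prime_E.ne_zero hR.prime_E.not_isUnit).1 h.symm.dvd).antisymm
        ((pow_dvd_pow_iff hR.prime_E.ne_zero hR.prime_E.not_isUnit).1 h.dvd)
    · rintro rfl; exact Associated.refl _
  have hval : uVal (p : S p k) A.det = (d * e : ℕ) := by
    obtain ⟨c, hc⟩ := hd.symm
    rw [← hc, uVal_mul, uVal_eq_zero_of_isUnit c.isUnit, add_zero,
      uVal_eq_of_dvd_sub (hR.dvd_E_pow_sub d), hR.uVal_u_pow, mul_comm]
  have hndvd : ¬ (p : S p k) ∣ A.det := by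
    rw [← uVal_eq_top_iff, hval]
    exact ENat.natCast_ne_top _
  have hlen := hb.relLength_sup_span hM.isPM (g := f₀ ∘ b) (A := A) (fun j => by
    have : ∑ i, A i j • b i = f₀ (b j) := by
      conv_rhs => rw [← B.sum_repr (f₀ (b j)), hB]
      rfl
    rw [Function.comp_apply, this, sub_self]
    exact zero_mem _) hndvd
  rw [← hb.sup_frobSpan hM.isPM (hst f₀), hval, ← h0.coe_degree hR] at hlen
  have hdeg₀ : degree f₀ (⊤ : Submodule (S p k) M) (⊥ ⊔ (p : S p k) • ⊤) = d * e := by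
    exact_mod_cast hlen
  have he : (e : ℚ) ≠ 0 := by exact_mod_cast hR.e_pos.ne'
  have hr' : (rank (PowerSeries.X : S p k) (⊤ : Submodule (S p k) M)
      (⊥ ⊔ (p : S p k) • ⊤) : ℚ) ≠ 0 := by exact_mod_cast hr.ne'
  rw [KisinModule.flatSlope, KisinModule.flatDeg, hset, csInf_singleton, flatRank_eq hR hM, hdeg,
    hdeg₀, hs]
  push_cast
  field_simp
  ring

end FlatSlope

end KisinHN

namespace KisinHN

open Kisin

universe u v w

/-! ### Kisin modules built from semilinear maps, and a criterion for semi-stability -/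

section Construct

variable {p : ℕ} [Fact p.Prime] {k : Type u} [Field k] {E : S p k}

theorem away_map_injective {N P : Type w} [AddCommGroup N] [Module (S p k) N]
    [AddCommGroup P] [Module (S p k) P] {l : N →ₗ[S p k] P} (hl : Function.Injective l) :
    Function.Injective (Away.map E l) :=
  IsLocalizedModule.map_injective _ _ _ _ hl

variable [CharP k p] [PerfectRing k p]
  {e : ℕ} (hR : FrobeniusDatum (frob p k) (p : S p k) PowerSeries.X E e p)
include hR

section Modules

variable {N : Type w} [AddCommGroup N] [Module (S p k) N] [Module.Finite (S p k) N]
  {g : N →ₛₗ[frob p k] N}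

theorem IsFlatPair.eq_zero_of_smul
    (hN : IsFlatPair (p : S p k) PowerSeries.X (⊤ : Submodule (S p k) N) ⊥) {a : S p k}
    (ha : a ≠ 0) {x : N} (hx : a • x = 0) : x = 0 := by
  have := hN.free hR
  exact (smul_eq_zero_iff_right ha).1 hx

omit [Module.Finite (S p k) N] in
theorem IsFlatPair.isPP (hN : IsFlatPair (p : S p k) PowerSeries.X (⊤ : Submodule (S p k) N) ⊥)
    (hg : GoodFrob E g ⊤) :
    IsPP (p : S p k) PowerSeries.X g (⊤ : Submodule (S p k) N) (⊥ ⊔ (p : S p k) • ⊤) :=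
  hN.isPM.isPP hR stable_top (stable_sup_smul hR stable_top stable_bot) (hg.sup _)

/-- The flat Kisin module attached to a free module with Frobenius. -/
noncomputable def flatKisin
    (hN : IsFlatPair (p : S p k) PowerSeries.X (⊤ : Submodule (S p k) N) ⊥)
    (hg : GoodFrob E g ⊤) (r : ℕ) : KisinModule.{u, w} p k E :=
  kisinOf N (fun _ => hN.eq_zero_of_smul hR PowerSeries.X_prime.ne_zero) r g
    (bijective_away_map_linearize hg (hN.linearize_injective hR (hN.isPP hR hg)))

theorem isEff_flatKisin
    (hN : IsFlatPair (p : S p k) PowerSeries.X (⊤ : Submodule (S p k) N) ⊥)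
    (hg : GoodFrob E g ⊤) (r : ℕ) : IsEff (flatKisin hR hN hg r) r g :=
  isEff_kisinOf _ _ _ _ _

theorem isFlat_flatKisin
    (hN : IsFlatPair (p : S p k) PowerSeries.X (⊤ : Submodule (S p k) N) ⊥)
    (hg : GoodFrob E g ⊤) (r : ℕ) : (flatKisin hR hN hg r).IsFlat := by
  have := hN.free hR
  exact (inferInstance : Module.Flat (S p k) N)

/-- The Kisin module attached to a module killed by `p` with Frobenius. -/
noncomputable def torKisin
    (hN : IsPP (p : S p k) PowerSeries.X g (⊤ : Submodule (S p k) N) ⊥) (r : ℕ) :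
    KisinModule.{u, w} p k E :=
  kisinOf N (fun x hx => (Submodule.mem_bot (S p k)).1
      (hN.u_tf x trivial ((Submodule.mem_bot (S p k)).2 hx))) r g
    (bijective_away_map_linearize (hN.goodFrob hR) (hN.linearize_injective hR))

theorem isEff_torKisin
    (hN : IsPP (p : S p k) PowerSeries.X g (⊤ : Submodule (S p k) N) ⊥) (r : ℕ) :
    IsEff (torKisin hR hN r) r g :=
  isEff_kisinOf _ _ _ _ _

end Modules

variable {Q : KisinModule.{u, w} p k E} {r d n : ℕ} {g : Q →ₛₗ[frob p k] Q}

/-- A strict subobject is isomorphic to its image `C`, and `C` is stable under `g`. Hence the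
subobject is effective at the same twist `r` as `Q`, and the two slope formulas differ only in
degree and rank. -/
theorem torSemistable_of (hd : resDeg p k = d) (hd0 : 0 < d) (hn : n = e * d) (hg : IsEff Q r g)
    (hPP : IsPP (p : S p k) PowerSeries.X g (⊤ : Submodule (S p k) Q) ⊥)
    (hpos : 0 < rank (PowerSeries.X : S p k) (⊤ : Submodule (S p k) Q) ⊥)
    (hss : ∀ C : Submodule (S p k) Q, Stable g C → ⊥ < C →
      degree g (⊤ : Submodule (S p k) Q) ⊥ * rank (PowerSeries.X : S p k) C ⊥ ≤
        degree g C ⊥ * rank (PowerSeries.X : S p k) (⊤ : Submodule (S p k) Q) ⊥) :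
    Q.TorSemistable n := by
  intro N h hh hnt
  obtain ⟨hinj, hu⟩ := hh
  let C := LinearMap.range h.lin
  have hE : ∀ x : Q, E • x = 0 → x = 0 := fun x hx => (Submodule.mem_bot (S p k)).1
    (hPP.toIsPM.mem_of_E_pow_smul_mem hR 1 (x := x) trivial (by simpa using hx))
  have hPMC : IsPM (p : S p k) PowerSeries.X (⊤ : Submodule (S p k) Q) C :=
    ⟨le_top, fun y hy => (bot_le : ⊥ ≤ C) (hPP.p_mem y hy), fun y _ hy => hu y hy⟩
  have hC : ∀ x : N, g (h.lin x) ∈ C := by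
    intro x
    -- A priori the Frobenius of the subobject lands in `N[1/E]`, so only `E ^ m • g (h.lin x)` is
    -- known to lie in `C`. On the quotient by `C`, killed by `p` and `u`-torsion free, `E` is
    -- injective.
    obtain ⟨m, z, hz⟩ := exists_pow_smul_eq_toAway
      (E ^ r • N.phi (toAway E _ (Pullback.tmul (frob p k) 1 x)))
    refine hPMC.mem_of_E_pow_smul_mem hR m trivial ⟨z, toAway_injective hE ?_⟩
    rw [map_smul, KisinModule_Hom_toAway h hg, ← map_smul, hz, away_map_toAway]
  let g' : N →ₛₗ[frob p k] N := (LinearEquiv.ofInjective h.lin hinj).symm.toLinearMap.comp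
    (LinearMap.codRestrict C (g.comp h.lin) hC)
  have hg' : ∀ x, h.lin (g' x) = g (h.lin x) := by
    intro x
    have := LinearEquiv.apply_symm_apply (LinearEquiv.ofInjective h.lin hinj)
      ⟨g (h.lin x), hC x⟩
    exact congrArg Subtype.val this
  have hEff : IsEff N r g' := by
    intro x
    apply away_map_injective hinj
    rw [away_map_toAway, hg', KisinModule_Hom_toAway h hg]
  have hmod := isModel_range h.lin hinj hg'
  have hCs : Stable g C := hmod.stable
  have hPC := hPP.sub hR bot_le (le_top : C ≤ ⊤) hCs
  have hrk := hmod.rank_pull (PowerSeries.X : S p k) (bot_le : ⊥ ≤ (⊤ : Submodule (S p k) N))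
  have hdg := hmod.degree_pull stable_top (bot_le : ⊥ ≤ (⊤ : Submodule (S p k) N))
  rw [pull_top, hmod.pull_bot] at hrk hdg
  have hCne : ⊥ < C := by
    refine bot_lt_iff_ne_bot.2 fun h0 => ?_
    obtain ⟨x, hx⟩ := exists_ne (0 : N)
    refine hx (hinj ?_)
    rw [map_zero]
    exact (Submodule.mem_bot (S p k)).1 (h0 ▸ ⟨x, rfl⟩ : h.lin x ∈ (⊥ : Submodule (S p k) Q))
  have hCpos := hPC.toIsPM.rank_pos hR hCne.ne
  rw [torSlope_eq hR hd hd0 hn hg hPP hpos,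
    torSlope_eq hR hd hd0 hn hEff (hmod.isPP hPC) (hrk ▸ hCpos), ← hrk, ← hdg]
  have he : (0 : ℚ) < e := by exact_mod_cast hR.e_pos
  have hpos' : (0 : ℚ) < rank (PowerSeries.X : S p k) (⊤ : Submodule (S p k) Q) ⊥ := by
    exact_mod_cast hpos
  have hCpos' : (0 : ℚ) < rank (PowerSeries.X : S p k) C ⊥ := by exact_mod_cast hCpos
  refine sub_le_sub_right ?_ _
  rw [mul_comm (e : ℚ), mul_comm (e : ℚ), ← div_div, ← div_div]
  refine div_le_div_of_nonneg_right ?_ he.le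
  rw [div_le_div_iff₀ hpos' hCpos']
  exact_mod_cast hss C hCs hCne

end Construct

/-! ### Kisin modules from subquotients -/

section Subquotients

variable {p : ℕ} [Fact p.Prime] {k : Type u} [Field k] [CharP k p] [PerfectRing k p] {E : S p k}
  {e : ℕ} (hR : FrobeniusDatum (frob p k) (p : S p k) PowerSeries.X E e p)
variable {M : Type w} [AddCommGroup M] [Module (S p k) M] [Module.Finite (S p k) M]
  {f : M →ₛₗ[frob p k] M} {Y Z : Submodule (S p k) M}
include hR

theorem IsFlatPair.mem_of_X_smul_mem (hYZ : IsFlatPair (p : S p k) PowerSeries.X Y Z)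
    (hY : Stable f Y) (hZ : Stable f Z) {y : M} (hy : y ∈ Y)
    (hu : (PowerSeries.X : S p k) • y ∈ Z) : y ∈ Z := by
  have hm := isModel_subquotient hY hZ hYZ.le
  refine (hm.map_eq_zero_iff ⟨y, hy⟩).1 ?_
  refine (hm.isFlatPair hYZ).eq_zero_of_smul hR (a := PowerSeries.X) PowerSeries.X_prime.ne_zero ?_
  rw [← map_smul, hm.map_eq_zero_iff]
  exact hu

/-- The graded piece `Y / Z`. -/
noncomputable def HNStep.kisin (h : HNStep (p : S p k) PowerSeries.X E f Y Z) (r : ℕ) :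
    KisinModule.{u, w} p k E :=
  flatKisin hR ((isModel_subquotient h.stable_left h.stable_right h.lt.le).isFlatPair h.flat)
    ((isModel_subquotient h.stable_left h.stable_right h.lt.le).goodFrob h.good) r

theorem HNStep.isEff_kisin (h : HNStep (p : S p k) PowerSeries.X E f Y Z) (r : ℕ) :
    IsEff (h.kisin hR r) r (subquotientFrob f h.stable_left h.stable_right) :=
  isEff_flatKisin hR _ _ _

theorem HNStep.rank_pos (h : HNStep (p : S p k) PowerSeries.X E f Y Z) :
    0 < rank (PowerSeries.X : S p k) Y (Z ⊔ (p : S p k) • Y) := by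
  refine h.isPP.toIsPM.rank_pos hR fun h0 => h.lt.not_ge ?_
  exact le_of_le_sup_smul hR h0.ge

/-- With a common `r` for all graded pieces, the increasing order of the `stepSlope`s carries over
to `μ_𝔖`. -/
theorem HNStep.flatSlope_kisin (h : HNStep (p : S p k) PowerSeries.X E f Y Z) (r : ℕ) :
    (h.kisin hR r).flatSlope = stepSlope (p : S p k) PowerSeries.X f Y Z / e - r := by
  have hm := isModel_subquotient h.stable_left h.stable_right h.lt.le
  have hN := hm.isFlatPair h.flat
  have hpull : pull (Z.submoduleOf Y).mkQ (⊥ ⊔ (p : S p k) • ⊤) = Z ⊔ (p : S p k) • Y := by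
    rw [hm.pull_sup, hm.pull_smul, hm.pull_bot, pull_top, ← sup_assoc, sup_idem]
  have hrk := hm.rank_pull (PowerSeries.X : S p k) hN.isPM.le
  have hdg := hm.degree_pull stable_top hN.isPM.le
  rw [pull_top, hpull] at hrk hdg
  have hpos := h.rank_pos hR
  rw [hrk] at hpos
  refine (flatSlope_eq (M := h.kisin hR r) hR hN (fun x hx =>
    hN.eq_zero_of_smul hR hR.prime_E.ne_zero hx) (h.isEff_kisin hR r) hpos).trans ?_
  rw [stepSlope, hrk, hdg, div_div, mul_comm (e : ℚ)]
  rfl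

/-- The reduction modulo `p` of `Y / Z` is realized as `Y / (Z + pY)`, whose stable submodules
correspond to the submodules `C` tested in `HNStep`. -/
theorem HNStep.flatSemistable_kisin {d n : ℕ} (hd : resDeg p k = d) (hd0 : 0 < d) (hn : n = e * d)
    (h : HNStep (p : S p k) PowerSeries.X E f Y Z) (r : ℕ) :
    (h.kisin hR r).FlatSemistable n := by
  have hZW : Z ≤ Z ⊔ (p : S p k) • Y := le_sup_left
  have hm := isModel_subquotient h.isPP.stable_left h.isPP.stable_right h.isPP.le
  have hPP := hm.isPP h.isPP
  have hEff := isEff_torKisin hR hPP r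
  let l : (Y ⧸ Z.submoduleOf Y) →ₗ[S p k] (Y ⧸ (Z ⊔ (p : S p k) • Y).submoduleOf Y) :=
    Submodule.mapQ _ _ LinearMap.id fun y hy => hZW hy
  have hl : ∀ x, l (subquotientFrob f h.stable_left h.stable_right x) =
      subquotientFrob f h.isPP.stable_left h.isPP.stable_right (l x) := by
    intro x
    obtain ⟨y, rfl⟩ := Submodule.Quotient.mk_surjective _ x
    rfl
  have hmodp : ∀ x, l x = 0 ↔ ∃ y, x = (p : S p k) • y := by
    intro x
    obtain ⟨y, rfl⟩ := Submodule.Quotient.mk_surjective _ x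
    change Submodule.Quotient.mk y = 0 ↔ _
    rw [Submodule.Quotient.mk_eq_zero, mem_submoduleOf_iff, mem_sup_smul]
    constructor
    · rintro ⟨a, ha, hb⟩
      refine ⟨Submodule.Quotient.mk ⟨a, ha⟩, ?_⟩
      rw [← Submodule.Quotient.mk_smul, Submodule.Quotient.eq]
      exact hb
    · rintro ⟨a, ha⟩
      obtain ⟨a, rfl⟩ := Submodule.Quotient.mk_surjective _ a
      rw [← Submodule.Quotient.mk_smul, Submodule.Quotient.eq] at ha
      exact ⟨a, a.2, ha⟩
  have hsurj : Function.Surjective l := by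
    intro x
    obtain ⟨y, rfl⟩ := Submodule.Quotient.mk_surjective _ x
    exact ⟨Submodule.Quotient.mk y, rfl⟩
  have hrk := hm.rank_pull (PowerSeries.X : S p k) (bot_le : ⊥ ≤ (⊤ : Submodule _ _))
  have hdg := hm.degree_pull stable_top (bot_le : ⊥ ≤ (⊤ : Submodule _ _))
  rw [pull_top, hm.pull_bot] at hrk hdg
  refine ⟨torKisin hR hPP r, homOf (h.isEff_kisin hR r) hEff l hl, ⟨hsurj, hmodp⟩,
    torSemistable_of hR hd hd0 hn hEff hPP (lt_of_lt_of_eq (h.rank_pos hR) hrk) ?_⟩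
  suffices hss : ∀ C : Submodule (S p k) (Y ⧸ (Z ⊔ (p : S p k) • Y).submoduleOf Y),
      Stable (subquotientFrob f h.isPP.stable_left h.isPP.stable_right) C → ⊥ < C →
      degree (subquotientFrob f h.isPP.stable_left h.isPP.stable_right) ⊤ ⊥ *
        rank (PowerSeries.X : S p k) C ⊥ ≤
      degree (subquotientFrob f h.isPP.stable_left h.isPP.stable_right) C ⊥ *
        rank (PowerSeries.X : S p k)
          (⊤ : Submodule (S p k) (Y ⧸ (Z ⊔ (p : S p k) • Y).submoduleOf Y)) ⊥ from hss
  intro C hC hlt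
  have hlt' := hm.pull_lt_pull_iff.2 hlt
  rw [hm.pull_bot] at hlt'
  have h1 := h.semistable _ (hm.stable_pull_iff.2 hC) hlt' (pull_le _ _)
  have hrk' := hm.rank_pull (PowerSeries.X : S p k) (bot_le : ⊥ ≤ C)
  have hdg' := hm.degree_pull hC (bot_le : ⊥ ≤ C)
  rw [hm.pull_bot] at hrk' hdg'
  rwa [hrk', hdg', hrk, hdg] at h1

end Subquotients

end KisinHN

namespace KisinHN

open Kisin

universe u v w

/-! ### Assembling the filtration and the isogeny -/

section TypeHN

variable {p : ℕ} [Fact p.Prime] {k : Type u} [Field k] [CharP k p] [PerfectRing k p] {E : S p k}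
  {e : ℕ} (hR : FrobeniusDatum (frob p k) (p : S p k) PowerSeries.X E e p)
include hR

omit hR in
theorem not_natCast_p_dvd_X : ¬ (p : S p k) ∣ PowerSeries.X := fun h =>
  (irreducible_mk_X p k).ne_zero (mk_eq_zero_iff_dvd.2 h)

omit hR in
theorem isFlatPair_of_free (M : Type w) [AddCommGroup M] [Module (S p k) M]
    [Module.Free (S p k) M] :
    IsFlatPair (p : S p k) PowerSeries.X (⊤ : Submodule (S p k) M) ⊥ where
  le := bot_le
  p_tf x _ hx := by
    rw [Submodule.mem_bot] at hx ⊢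
    exact (smul_eq_zero_iff_right (natCast_p_ne_zero p k)).1 hx
  isPM := by
    refine ⟨le_top, fun y _ => Submodule.mem_sup_right (Submodule.smul_mem_pointwise_smul _ _ _
      trivial), fun y _ hu => ?_⟩
    obtain ⟨a, -, ha⟩ := mem_sup_smul.1 hu
    rw [Submodule.mem_bot, sub_eq_zero] at ha
    let b := Module.Free.chooseBasis (S p k) M
    have h1 : ∀ i, (p : S p k) ∣ b.repr y i := by
      intro i
      have := congrArg (fun z => b.repr z i) ha
      simp only [map_smul, Finsupp.smul_apply, smul_eq_mul] at this
      exact ((prime_natCast_p p k).dvd_or_dvd (Dvd.intro _ this.symm)).resolve_left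
        not_natCast_p_dvd_X
    choose c hc using h1
    have h2 : y = (p : S p k) • ∑ i ∈ (b.repr y).support, c i • b i := by
      conv_lhs => rw [← b.linearCombination_repr y, Finsupp.linearCombination_apply, Finsupp.sum]
      rw [Finset.smul_sum]
      exact Finset.sum_congr rfl fun i _ => by rw [smul_smul, ← hc]
    rw [h2]
    exact Submodule.mem_sup_right (Submodule.smul_mem_pointwise_smul _ _ _ trivial)

omit [CharP k p] [PerfectRing k p] hR in
-- Since `(p, u)` is a regular sequence, so is `(p ^ a, u)`: `M / p ^ a` has no `u`-torsion. This
-- makes multiplication by `p ^ a` an isogeny.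
theorem exists_eq_pow_smul {M : Type w} [AddCommGroup M] [Module (S p k) M]
    (hM : IsFlatPair (p : S p k) PowerSeries.X (⊤ : Submodule (S p k) M) ⊥) (a : ℕ) :
    ∀ {x y : M}, (PowerSeries.X : S p k) • y = (p : S p k) ^ a • x →
      ∃ z, y = (p : S p k) ^ a • z := by
  induction a with
  | zero => intro x y _; exact ⟨y, by simp⟩
  | succ a ih =>
    intro x y h
    have h1 : (PowerSeries.X : S p k) • y ∈ (⊥ : Submodule (S p k) M) ⊔ (p : S p k) • ⊤ := by
      rw [h, pow_succ', mul_smul]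
      exact Submodule.mem_sup_right (Submodule.smul_mem_pointwise_smul _ _ _ trivial)
    obtain ⟨y', -, hy'⟩ := mem_sup_smul.1 (hM.isPM.u_tf y trivial h1)
    rw [Submodule.mem_bot, sub_eq_zero] at hy'
    subst hy'
    have h2 : (p : S p k) • ((PowerSeries.X : S p k) • y' - (p : S p k) ^ a • x) = 0 := by
      rw [smul_sub, smul_comm, h, pow_succ', mul_smul, sub_self]
    have h3 := hM.p_tf _ trivial ((Submodule.mem_bot _).2 h2)
    rw [Submodule.mem_bot, sub_eq_zero] at h3
    obtain ⟨z, hz⟩ := ih h3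
    exact ⟨z, by rw [hz, pow_succ', mul_smul]⟩

theorem exists_filtration_top {M : Type w} [AddCommGroup M] [Module (S p k) M]
    [Module.Finite (S p k) M] {f : M →ₛₗ[frob p k] M}
    (hM : IsFlatPair (p : S p k) PowerSeries.X (⊤ : Submodule (S p k) M) ⊥)
    (hf : GoodFrob E f ⊤) :
    ∃ (r : ℕ) (X : ℕ → Submodule (S p k) M), X 0 = ⊥ ∧
      (∀ i < r, HNStep (p : S p k) PowerSeries.X E f (X (i + 1)) (X i)) ∧
      (∀ i, i + 1 < r → stepSlope (p : S p k) PowerSeries.X f (X (i + 1)) (X i) <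
        stepSlope (p : S p k) PowerSeries.X f (X (i + 2)) (X (i + 1))) ∧
      ∃ a : ℕ, ∀ x, (p : S p k) ^ a • x ∈ X r := by
  have hPP := hM.isPP hR hf
  -- The initial lower bound `-1` on slopes holds trivially, as degrees are natural numbers.
  obtain ⟨r, X, h0, -, hstep, -, hslope, ⟨a, ha⟩, -⟩ := exists_filtration hR
    (rank (PowerSeries.X : S p k) (⊤ : Submodule (S p k) M) (⊥ ⊔ (p : S p k) • ⊤)) ⊤ ⊥ (-1)
    (degree f (⊤ : Submodule (S p k) M) (⊥ ⊔ (p : S p k) • ⊤)) stable_bot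
    (fun x _ hx => hM.p_tf x trivial hx)
    ⟨bot_le, le_rfl, hPP, hf, ⟨0, fun x _ => trivial⟩, fun x _ _ => trivial, rfl, rfl,
      fun C hC hlt hle => by
        have := (hPP.toIsPM.sub hlt.le hle).rank_pos hR hlt.ne
        have h1 : (0 : ℚ) < rank (PowerSeries.X : S p k) C (⊥ ⊔ (p : S p k) • ⊤) := by
          exact_mod_cast this
        have h2 : (0 : ℚ) ≤ degree f C (⊥ ⊔ (p : S p k) • ⊤) := Nat.cast_nonneg _
        linarith⟩
  exact ⟨r, X, h0, hstep, hslope, a, fun x => ha x trivial⟩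

omit [CharP k p] [PerfectRing k p] hR in
theorem flat_of_le {M : Type w} [AddCommGroup M] [Module (S p k) M] [Module.Finite (S p k) M]
    {f : M →ₛₗ[frob p k] M} {r : ℕ} {X : ℕ → Submodule (S p k) M}
    (h0 : X 0 = ⊥)
    (hstep : ∀ i < r, HNStep (p : S p k) PowerSeries.X E f (X (i + 1)) (X i)) {i j : ℕ}
    (hij : i ≤ j) (hj : j ≤ r) :
    IsFlatPair (p : S p k) PowerSeries.X (X j) (X i) ∧ Stable f (X j) ∧ GoodFrob E f (X j) := by
  induction j, hij using Nat.le_induction with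
  | base =>
    have hst : Stable f (X i) ∧ GoodFrob E f (X i) := by
      rcases i with _ | i
      · rw [h0]
        exact ⟨stable_bot, 0, fun y hy => by rw [(Submodule.mem_bot _).1 hy, smul_zero]; exact zero_mem _⟩
      · exact ⟨(hstep i hj).stable_left, (hstep i hj).good⟩
    refine ⟨⟨le_rfl, fun _ h _ => h, ?_⟩, hst⟩
    rw [sup_eq_left.2 (smul_pointwise_le_self _ _)]
    exact ⟨le_rfl, fun y hy => Submodule.smul_mem _ _ hy, fun _ h _ => h⟩
  | succ j hij ih =>
    have hs := hstep j hj
    exact ⟨hs.flat.trans (ih (by omega)).1, hs.stable_left, hs.good⟩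

/-- Every flat Kisin module is isogenous to one of type HN. -/
theorem exists_isTypeHN {d n : ℕ} (hd : resDeg p k = d) (hd0 : 0 < d) (hn : n = e * d)
    (M : KisinModule.{u, w} p k E) (hM : M.IsFlat) :
    ∃ N : KisinModule.{u, w} p k E, N.IsFlat ∧ N.IsTypeHN n ∧ M.Isogenous N := by
  have hfl : Module.Flat (S p k) M := hM
  have hfree : Module.Free (S p k) M := Module.free_of_flat_of_isLocalRing
  have hMF := isFlatPair_of_free (p := p) (k := k) M
  have hE : ∀ x : M, E • x = 0 → x = 0 := fun x hx => hMF.eq_zero_of_smul hR hR.prime_E.ne_zero hx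
  obtain ⟨s, f, hf⟩ := exists_isEff hE
  have hgood := hf.goodFrob hE
  obtain ⟨r, X, h0, hstep, hslope, a, ha⟩ := exists_filtration_top hR hMF hgood
  have hflat := @flat_of_le p _ k _ E M _ _ _ f r X h0 hstep
  have hmono : ∀ {i j : ℕ}, i ≤ j → j ≤ r → X i ≤ X j := fun hij hj => (hflat hij hj).1.le
  have hst : ∀ {j : ℕ}, j ≤ r → Stable f (X j) := fun hj => (hflat le_rfl hj).2.1
  have hF : ∀ {j : ℕ} (hj : j ≤ r), IsFlatPair (p : S p k) PowerSeries.X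
      (⊤ : Submodule (S p k) (X j)) ⊥ := fun hj => by
    have := (hflat (Nat.zero_le _) hj).1
    rw [h0] at this
    exact (isModel_self (hst hj)).isFlatPair this
  have hG : ∀ {j : ℕ} (hj : j ≤ r), GoodFrob E (f.restrict (hst hj)) ⊤ := fun hj =>
    (isModel_self (hst hj)).goodFrob (hflat le_rfl hj).2.2
  let F : ∀ j, j ≤ r → KisinModule.{u, w} p k E := fun j hj => flatKisin hR (hF hj) (hG hj) s
  have hFE : ∀ j (hj : j ≤ r), IsEff (F j hj) s (f.restrict (hst hj)) := fun j hj =>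
    isEff_flatKisin hR (hF hj) (hG hj) s
  let sub : ∀ j (hj : j ≤ r), KisinModule.Hom (F j hj) (F r le_rfl) := fun j hj =>
    homOf (hFE j hj) (hFE r le_rfl) (Submodule.inclusion (hmono hj le_rfl)) fun x => rfl
  have hmem : ∀ j (hj : j ≤ r) (x : X r), x ∈ LinearMap.range (Submodule.inclusion
      (hmono hj le_rfl)) ↔ (x : M) ∈ X j := fun j hj x => by
    rw [Submodule.range_inclusion]
    exact Iff.rfl
  let gr : ∀ i : Fin r, KisinModule.Hom (F (i + 1) i.2) ((hstep i i.2).kisin hR s) := fun i =>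
    homOf (hFE _ i.2) ((hstep i i.2).isEff_kisin hR s) (Submodule.mkQ _) fun x => rfl
  refine ⟨F r le_rfl, isFlat_flatKisin hR (hF le_rfl) (hG le_rfl) s, ?_, ?_⟩
  · refine ⟨r, fun i => F i (Nat.lt_succ_iff.1 i.2), fun i => sub i (Nat.lt_succ_iff.1 i.2),
      fun i => (hstep i i.2).kisin hR s, gr, fun i => ⟨?_, ?_⟩, ?_, ?_, fun i => ?_,
      fun i => ⟨Submodule.mkQ_surjective _, ?_⟩, fun i => ⟨isFlat_flatKisin hR _ _ s,
        (hstep i i.2).flatSemistable_kisin hR hd hd0 hn s⟩, ?_⟩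
    · exact Submodule.inclusion_injective (hmono (Nat.lt_succ_iff.1 i.2) le_rfl)
    · intro y hy
      have hi := Nat.lt_succ_iff.1 i.2
      exact (hmem i hi y).2 ((hflat hi le_rfl).1.mem_of_X_smul_mem hR (hst le_rfl) (hst hi) y.2
        ((hmem i hi _).1 hy))
    · refine (eq_bot_iff).2 ?_
      intro y hy
      have := (hmem 0 (Nat.zero_le _) y).1 hy
      rw [h0, Submodule.mem_bot] at this
      exact (Submodule.mem_bot _).2 (Subtype.ext this)
    · exact eq_top_iff.2 fun y _ => (hmem r le_rfl y).2 y.2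
    · have hlt := (hstep i i.2).lt
      obtain ⟨y, hy, hy'⟩ := SetLike.exists_of_lt hlt
      refine SetLike.lt_iff_le_and_exists.2 ⟨fun x hx => (hmem (i + 1) i.2 x).2 (hlt.le
        ((hmem i i.2.le x).1 hx)), ⟨y, hmono i.2 le_rfl hy⟩, (hmem (i + 1) i.2 _).2 hy,
        fun h => hy' ((hmem i i.2.le _).1 h)⟩
    · intro x
      refine (Submodule.Quotient.mk_eq_zero ((X i).submoduleOf (X (i + 1)))).trans ?_
      exact (hmem i i.2.le (Submodule.inclusion (hmono i.2 le_rfl) x)).symm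
    · have he : (0 : ℚ) < e := by exact_mod_cast hR.e_pos
      have key : ∀ i j : ℕ, i < j → j < r → stepSlope (p : S p k) PowerSeries.X f (X (i + 1)) (X i) <
          stepSlope (p : S p k) PowerSeries.X f (X (j + 1)) (X j) := by
        intro i j hij
        induction j, hij using Nat.le_induction with
        | base => intro hj; exact hslope i hj
        | succ j hij ih => intro hj; exact (ih (by omega)).trans (hslope j hj)
      intro i j hij
      simp only [HNStep.flatSlope_kisin]
      exact sub_lt_sub_right (div_lt_div_of_pos_right (key i j hij j.2) he) _
  -- The isogeny is multiplication by `p ^ a`, seen as a map into the lattice `X r`. The same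
  -- exponent kills its kernel and its cokernel, since `p ^ a • y` is the image of `y ∈ X r ⊆ M`.
  · let l : M →ₗ[S p k] X r := LinearMap.codRestrict (X r)
      (LinearMap.lsmul (S p k) M ((p : S p k) ^ a)) ha
    have hl : ∀ x, l (f x) = f.restrict (hst le_rfl) (l x) := by
      intro x
      apply Subtype.ext
      change (p : S p k) ^ a • f x = f ((p : S p k) ^ a • x)
      rw [f.map_smulₛₗ, map_pow, frob_natCast_p]
    have hker : ∀ x, l x = 0 → (p : S p k) ^ a • x = 0 := fun x hx => congrArg Subtype.val hx
    have hcoker : ∀ y : X r, (p : S p k) ^ a • y ∈ LinearMap.range l := fun y =>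
      ⟨(y : M), Subtype.ext rfl⟩
    have hu : ∀ y : X r, (PowerSeries.X : S p k) • y ∈ LinearMap.range l →
        y ∈ LinearMap.range l := by
      rintro y ⟨x, hx⟩
      obtain ⟨z, hz⟩ := exists_eq_pow_smul hMF a (congrArg Subtype.val hx).symm
      exact ⟨z, Subtype.ext hz.symm⟩
    exact ⟨homOf hf (hFE r le_rfl) l hl, ⟨a, hker⟩, ⟨a, hcoker⟩, hu⟩

end TypeHN

end KisinHN

namespace KisinHN

open Kisin

universe u v w

/-! ### The ring of integers -/

section SpectralNorm

variable (p : ℕ) [Fact p.Prime] (K : Type*) [Field K] [Algebra ℚ_[p] K] [Algebra ℤ_[p] K]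
  [IsScalarTower ℤ_[p] ℚ_[p] K] [FiniteDimensional ℚ_[p] K]

/-- The spectral norm is at most `1` exactly when the minimal polynomial over `ℚ_p` has coefficients
in `ℤ_p`. -/
theorem isIntegral_iff_spectralNorm_le_one (x : K) :
    IsIntegral ℤ_[p] x ↔ spectralNorm ℚ_[p] K x ≤ 1 := by
  have hx : IsIntegral ℚ_[p] x := Algebra.IsIntegral.isIntegral x
  rw [spectralNorm, spectralValue_le_one_iff (minpoly.monic hx)]
  constructor
  · intro h n
    rw [minpoly.isIntegrallyClosed_eq_field_fractions' ℚ_[p] h, Polynomial.coeff_map]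
    exact PadicInt.norm_le_one _
  · intro h
    have hl : minpoly ℚ_[p] x ∈ Polynomial.lifts (algebraMap ℤ_[p] ℚ_[p]) := by
      rw [Polynomial.lifts_iff_coeff_lifts]
      exact fun n => ⟨⟨_, h n⟩, rfl⟩
    obtain ⟨P, hP, -, hmon⟩ := Polynomial.lifts_and_natDegree_eq_and_monic hl (minpoly.monic hx)
    refine ⟨P, hmon, ?_⟩
    rw [← Polynomial.aeval_def, ← Polynomial.aeval_map_algebraMap ℚ_[p], hP, minpoly.aeval]

/-- The spectral norm is multiplicative, so a nonunit of the ring of integers has norm less than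
`1`. For large `j` the element `π ^ j / p` has norm at most `1`, hence is integral. -/
theorem exists_natCast_dvd_pow {π : integralClosure ℤ_[p] K} (hπ : ¬ IsUnit π) :
    ∃ j, (p : integralClosure ℤ_[p] K) ∣ π ^ j := by
  let N := spectralMulAlgNorm ℚ_[p] K
  have hNp : N (p : K) = (p : ℝ)⁻¹ := by
    have := spectralNorm_extends (L := K) (p : ℚ_[p])
    rw [map_natCast, Padic.norm_p] at this
    exact this
  have hp0 : (0 : ℝ) < (p : ℝ)⁻¹ := by
    have := (Fact.out : p.Prime).pos
    positivity
  have hpK : (p : K) ≠ 0 := fun h => by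
    rw [h, map_zero] at hNp
    exact hp0.ne hNp
  have hlt : N (π : K) < 1 := by
    refine lt_of_le_of_ne ((isIntegral_iff_spectralNorm_le_one p K _).1 π.2) fun h1 => hπ ?_
    have hne : (π : K) ≠ 0 := fun h => by
      rw [h, map_zero] at h1
      exact zero_ne_one h1
    have hinv : N ((π : K)⁻¹) = 1 := by
      have := map_mul N (π : K) (π : K)⁻¹
      rw [mul_inv_cancel₀ hne, map_one, h1, one_mul] at this
      exact this.symm
    exact .of_mul_eq_one ⟨(π : K)⁻¹, (isIntegral_iff_spectralNorm_le_one p K _).2 hinv.le⟩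
      (Subtype.ext (mul_inv_cancel₀ hne))
  obtain ⟨j, hj⟩ := exists_pow_lt_of_lt_one hp0 hlt
  have hle : N ((π : K) ^ j * (p : K)⁻¹) ≤ 1 := by
    have h2 := map_mul N ((π : K) ^ j * (p : K)⁻¹) (p : K)
    rw [inv_mul_cancel_right₀ hpK, map_pow, hNp] at h2
    rw [h2] at hj
    exact ((mul_lt_iff_lt_one_left hp0).1 hj).le
  refine ⟨j, ⟨_, (isIntegral_iff_spectralNorm_le_one p K _).2 hle⟩, Subtype.ext ?_⟩
  change (π : K) ^ j = (p : K) * ((π : K) ^ j * (p : K)⁻¹)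
  field_simp

theorem finite_integralClosure : Module.Finite ℤ_[p] (integralClosure ℤ_[p] K) :=
  IsIntegralClosure.finite ℤ_[p] ℚ_[p] K _

/-- The ring of integers is free over `ℤ_p` of rank `[K : ℚ_p]`, and the residue field of `ℤ_p` has
`p` elements. -/
theorem card_integralClosure_quotient :
    Submodule.cardQuot (Ideal.span {(p : integralClosure ℤ_[p] K)}) =
      p ^ Module.finrank ℚ_[p] K := by
  have : Module.IsTorsionFree ℤ_[p] K := Module.IsTorsionFree.trans_faithfulSMul ℤ_[p] ℚ_[p] K
  have hfin := finite_integralClosure p K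
  have hfree : Module.Free ℤ_[p] (integralClosure ℤ_[p] K) :=
    IsIntegralClosure.module_free ℤ_[p] ℚ_[p] K _
  have h := IsLocalRing.finrank_quotient_map (R := ℤ_[p]) (S := integralClosure ℤ_[p] K)
  rw [IsIntegralClosure.rank ℤ_[p] ℚ_[p] K] at h
  have hmap : Ideal.span {(p : integralClosure ℤ_[p] K)} =
      Ideal.map (algebraMap ℤ_[p] _) (IsLocalRing.maximalIdeal ℤ_[p]) := by
    rw [PadicInt.maximalIdeal_eq_span_p, Ideal.map_span, Set.image_singleton, map_natCast]
  let : Field (ℤ_[p] ⧸ IsLocalRing.maximalIdeal ℤ_[p]) := Ideal.Quotient.field _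
  have hcard : Nat.card (ℤ_[p] ⧸ IsLocalRing.maximalIdeal ℤ_[p]) = p :=
    (Nat.card_congr (PadicInt.residueField (p := p)).toEquiv).trans (Nat.card_zmod p)
  rw [hmap, Submodule.cardQuot_apply, ← h,
    Module.natCard_eq_pow_finrank (K := ℤ_[p] ⧸ IsLocalRing.maximalIdeal ℤ_[p]), hcard]

theorem isDedekindDomain_integralClosure : IsDedekindDomain (integralClosure ℤ_[p] K) :=
  IsIntegralClosure.isDedekindDomain ℤ_[p] ℚ_[p] K _

end SpectralNorm

/-! ### The map from the Witt vectors to the ring of integers -/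

section Witt

variable {p : ℕ} [Fact p.Prime] {k : Type u} [Field k] [CharP k p] {A : Type v} [CommRing A]
  {π : A} {ι : WittVector p k →+* A}

theorem ker_mk_comp_eq (hπ : (Ideal.span {π}).IsMaximal)
    (hι : Function.Surjective ((Ideal.Quotient.mk (Ideal.span {π})).comp ι)) :
    RingHom.ker ((Ideal.Quotient.mk (Ideal.span {π})).comp ι) =
      RingHom.ker (WittVector.constantCoeff (p := p) (R := k)) := by
  let := Ideal.Quotient.field (Ideal.span {π})
  refine (RingHom.ker_isMaximal_of_surjective _ hι).eq_of_le
    (RingHom.ker_isMaximal_of_surjective (WittVector.constantCoeff (p := p) (R := k))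
      (WittVector.constantCoeff_surjective p)).ne_top ?_
  intro x hx
  by_contra hne
  have hu : IsUnit x := WittVector.isUnit_of_coeff_zero_ne_zero x hne
  exact (hu.map ((Ideal.Quotient.mk (Ideal.span {π})).comp ι)).ne_zero hx

theorem dvd_map_iff (hπ : (Ideal.span {π}).IsMaximal)
    (hι : Function.Surjective ((Ideal.Quotient.mk (Ideal.span {π})).comp ι))
    (a : WittVector p k) : π ∣ ι a ↔ WittVector.constantCoeff a = 0 := by
  rw [← RingHom.mem_ker, ← ker_mk_comp_eq hπ hι, RingHom.mem_ker, RingHom.comp_apply,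
    Ideal.Quotient.eq_zero_iff_dvd]

theorem card_residueField (hπ : (Ideal.span {π}).IsMaximal)
    (hι : Function.Surjective ((Ideal.Quotient.mk (Ideal.span {π})).comp ι)) :
    Nat.card k = Submodule.cardQuot (Ideal.span {π}) := by
  rw [Submodule.cardQuot_apply]
  exact Nat.card_congr ((RingHom.quotientKerEquivOfSurjective
    (WittVector.constantCoeff_surjective p)).symm.trans ((Ideal.quotEquivOfEq
      (ker_mk_comp_eq hπ hι).symm).trans (RingHom.quotientKerEquivOfSurjective hι))).toEquiv

omit [CharP k p] in
theorem exists_eq_sum_add_pow_mul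
    (hι : Function.Surjective ((Ideal.Quotient.mk (Ideal.span {π})).comp ι)) (n : ℕ) (a : A) :
    ∃ (c : Fin n → WittVector p k) (b : A), a = ∑ i, ι (c i) * π ^ (i : ℕ) + π ^ n * b := by
  induction n with
  | zero => exact ⟨Fin.elim0, a, by simp⟩
  | succ n ih =>
    obtain ⟨c, b, hb⟩ := ih
    obtain ⟨w, hw⟩ := hι (Ideal.Quotient.mk _ b)
    obtain ⟨b', hb'⟩ := Ideal.mem_span_singleton.1 (Ideal.Quotient.eq.1 hw.symm)
    refine ⟨Fin.snoc c w, b', ?_⟩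
    rw [Fin.sum_univ_castSucc]
    simp only [Fin.snoc_castSucc, Fin.snoc_last, Fin.val_castSucc, Fin.val_last]
    rw [hb, sub_eq_iff_eq_add.1 hb']
    ring

/-- A ring map from `W(k)` to a finite `ℤ_p`-algebra domain in which `p` is not invertible is
finite. -/
theorem finite_of_finite_padicInt [IsDomain A] [Algebra ℤ_[p] A] [Module.Finite ℤ_[p] A]
    (hp : ¬ IsUnit (p : A)) : letI := ι.toAlgebra; Module.Finite (WittVector p k) A := by
  let := ι.toAlgebra
  let j : ℤ_[p] →+* WittVector p k :=
    (WittVector.map (ZMod.castHom (dvd_refl p) k)).comp (WittVector.equiv p).symm.toRingHom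
  let := j.toAlgebra
  have hnoeth : IsNoetherianRing A := IsNoetherianRing.of_finite ℤ_[p] A
  -- The two maps from `ℤ_p` to `A` agree on natural numbers, hence modulo every power of `p`;
  -- Krull's intersection theorem makes them equal. So `A` is finite over `W(k)` because it is
  -- finite over `ℤ_p`.
  have key : ∀ x, algebraMap ℤ_[p] A x = ι (j x) := by
    intro x
    have hmem : ∀ n, algebraMap ℤ_[p] A x - ι (j x) ∈ Ideal.span {(p : A)} ^ n := by
      intro n
      obtain ⟨y, hy⟩ := Ideal.mem_span_singleton.1 (PadicInt.appr_spec n x)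
      rw [Ideal.span_singleton_pow, Ideal.mem_span_singleton]
      refine ⟨algebraMap ℤ_[p] A y - ι (j y), ?_⟩
      rw [sub_eq_iff_eq_add.1 hy]
      simp only [map_add, map_mul, map_pow, map_natCast]
      ring
    have h0 := Ideal.mem_iInf.2 hmem
    rw [Ideal.iInf_pow_eq_bot_of_isDomain _ (fun h => hp (Ideal.span_singleton_eq_top.1 h))] at h0
    exact sub_eq_zero.1 h0
  have : IsScalarTower ℤ_[p] (WittVector p k) A := IsScalarTower.of_algebraMap_eq key
  exact Module.Finite.of_restrictScalars_finite ℤ_[p] _ _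

end Witt

end KisinHN

namespace KisinHN

open Kisin

universe u v w

/-! ### The minimal polynomial of a uniformizer -/

section Minpoly

open Polynomial

variable {p : ℕ} [Fact p.Prime] {k : Type u} [Field k] [CharP k p] [PerfectRing k p]
  {A : Type v} [CommRing A] [IsDomain A] [Algebra (WittVector p k) A]
  [Module.Finite (WittVector p k) A] {π : A} {e : ℕ}

theorem natCast_mem_jacobson_bot :
    Ideal.span {(p : WittVector p k)} ≤ (⊥ : Ideal (WittVector p k)).jacobson := by
  rw [IsLocalRing.jacobson_eq_maximalIdeal ⊥ bot_ne_top, Ideal.span_singleton_le_iff_mem,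
    IsLocalRing.mem_maximalIdeal]
  exact (WittVector.irreducible (k := k) p).not_isUnit

omit [IsDomain A] in
-- Modulo `p`, an associate of `π ^ e`, every element is a combination of `1, π, …, π ^ (e - 1)`. By
-- Nakayama these powers span `A` over `W(k)`, and expressing `π ^ e` in them gives the polynomial.
theorem exists_monic_aeval_eq_zero
    (hι : Function.Surjective ((Ideal.Quotient.mk (Ideal.span {π})).comp
      (algebraMap (WittVector p k) A)))
    (hpe : Associated (p : A) (π ^ e)) :
    ∃ P : (WittVector p k)[X], P.Monic ∧ P.degree = e ∧ aeval π P = 0 := by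
  let N : Submodule (WittVector p k) A := Submodule.span _ (Set.range fun i : Fin e => π ^ (i : ℕ))
  have hN : (⊤ : Submodule (WittVector p k) A) ≤ N := by
    refine Submodule.le_of_le_smul_of_le_jacobson_bot Module.Finite.fg_top
      (natCast_mem_jacobson_bot (p := p) (k := k)) fun a _ => ?_
    obtain ⟨c, b, rfl⟩ := exists_eq_sum_add_pow_mul hι e a
    refine Submodule.add_mem_sup (Submodule.sum_mem _ fun i _ => ?_) ?_
    · rw [← Algebra.smul_def]
      exact N.smul_mem _ (Submodule.subset_span ⟨i, rfl⟩)
    · obtain ⟨b', hb'⟩ := hpe.dvd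
      rw [hb', mul_assoc, ← map_natCast (algebraMap (WittVector p k) A), ← Algebra.smul_def]
      exact Submodule.smul_mem_smul (Ideal.mem_span_singleton_self _) trivial
  obtain ⟨c, hc⟩ := (Submodule.mem_span_range_iff_exists_fun _).1 (hN (x := π ^ e) trivial)
  have hdeg : (∑ i : Fin e, C (c i) * X ^ (i : ℕ) : (WittVector p k)[X]).degree < e :=
    degree_sum_fin_lt c
  refine ⟨X ^ e - ∑ i : Fin e, C (c i) * X ^ (i : ℕ), monic_X_pow_sub hdeg, ?_, ?_⟩
  · rw [degree_sub_eq_left_of_degree_lt, degree_X_pow]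
    rwa [degree_X_pow]
  · simp only [map_sub, map_pow, aeval_X, map_sum, map_mul, aeval_C, ← Algebra.smul_def]
    rw [hc, sub_self]

/-- The Eisenstein argument: once `p` divides the coefficients below `i < e`, all other terms of the
relation for `π` are divisible by `π ^ (i + 1)`, so `π`, and then `p`, divides the `i`-th
coefficient. A degree less than `e` is impossible because `p` would divide the leading coefficient
`1`. -/
theorem natDegree_and_dvd_coeff_minpoly (hπ : (Ideal.span {π}).IsMaximal)
    (hι : Function.Surjective ((Ideal.Quotient.mk (Ideal.span {π})).comp
      (algebraMap (WittVector p k) A)))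
    (hpe : Associated (p : A) (π ^ e)) (hπ0 : π ≠ 0) :
    (minpoly (WittVector p k) π).natDegree = e ∧
      ∀ i < e, (p : WittVector p k) ∣ (minpoly (WittVector p k) π).coeff i := by
  have hint : IsIntegral (WittVector p k) π := Algebra.IsIntegral.isIntegral π
  have hmon := minpoly.monic hint
  set Q := minpoly (WittVector p k) π with hQ
  have hle : Q.natDegree ≤ e := by
    obtain ⟨P, hP, hPe, hP0⟩ := exists_monic_aeval_eq_zero hι hpe
    exact natDegree_le_of_degree_le ((minpoly.min _ π hP hP0).trans_eq hPe)
  have hlow : ∀ i < e, (p : WittVector p k) ∣ Q.coeff i := by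
    intro i
    induction i using Nat.strong_induction_on with
    | _ i ih =>
    intro hi
    have h0 : ∑ j ∈ Finset.range (e + 1), algebraMap _ A (Q.coeff j) * π ^ j = 0 := by
      have := minpoly.aeval (WittVector p k) π
      rw [aeval_eq_sum_range' (Nat.lt_succ_of_le hle)] at this
      simpa only [Algebra.smul_def] using this
    have hrest : π ^ (i + 1) ∣ ∑ j ∈ (Finset.range (e + 1)).erase i,
        algebraMap _ A (Q.coeff j) * π ^ j := by
      refine Finset.dvd_sum fun j hj => ?_
      rcases lt_or_gt_of_ne (Finset.ne_of_mem_erase hj) with hji | hji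
      · refine Dvd.dvd.mul_right ?_ _
        obtain ⟨c, hc⟩ := ih j hji (hji.trans hi)
        rw [hc, map_mul, map_natCast]
        exact ((pow_dvd_pow π hi).trans hpe.dvd').mul_right _
      · exact (pow_dvd_pow π hji).mul_left _
    rw [← Finset.add_sum_erase _ _ (Finset.mem_range.2 (hi.trans (Nat.lt_succ_self e)))] at h0
    have h1 := (dvd_add_left hrest).1 (h0 ▸ dvd_zero _)
    rw [pow_succ', mul_dvd_mul_iff_right (pow_ne_zero _ hπ0), dvd_map_iff hπ hι,
      constantCoeff_eq_zero_iff] at h1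
    exact h1
  refine ⟨hle.antisymm (not_lt.1 fun hlt => ?_), hlow⟩
  have := hlow _ hlt
  rw [coeff_natDegree, hmon.leadingCoeff] at this
  exact (WittVector.irreducible (k := k) p).not_isUnit (isUnit_of_dvd_one this)

theorem dvd_coe_minpoly_sub (hπ : (Ideal.span {π}).IsMaximal)
    (hι : Function.Surjective ((Ideal.Quotient.mk (Ideal.span {π})).comp
      (algebraMap (WittVector p k) A)))
    (hpe : Associated (p : A) (π ^ e)) (hπ0 : π ≠ 0) :
    (p : S p k) ∣ ((minpoly (WittVector p k) π : (WittVector p k)[X]) : S p k) -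
      PowerSeries.X ^ e := by
  obtain ⟨hdeg, hlow⟩ := natDegree_and_dvd_coeff_minpoly hπ hι hpe hπ0
  have hmon := minpoly.monic (A := WittVector p k) (Algebra.IsIntegral.isIntegral π)
  rw [← pow_one (p : S p k), natCast_dvd_iff]
  intro i
  rw [map_sub, Polynomial.coeff_coe, PowerSeries.coeff_X_pow, pow_one]
  rcases lt_trichotomy i e with h | rfl | h
  · rw [if_neg h.ne, sub_zero]
    exact hlow i h
  · nth_rw 1 [← hdeg]
    rw [coeff_natDegree, hmon.leadingCoeff, if_pos rfl, sub_self]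
    exact dvd_zero _
  · rw [if_neg h.ne', sub_zero, coeff_eq_zero_of_natDegree_lt (hdeg.trans_lt h)]
    exact dvd_zero _

/-- The polynomial is distinguished, so by Weierstrass division its quotient of `W(k)⟦u⟧` is the
same as its quotient of the polynomial ring. The latter is a domain, since the minimal polynomial is
irreducible and hence prime. -/
theorem prime_coe_minpoly (hπ : (Ideal.span {π}).IsMaximal)
    (hι : Function.Surjective ((Ideal.Quotient.mk (Ideal.span {π})).comp
      (algebraMap (WittVector p k) A)))
    (hpe : Associated (p : A) (π ^ e)) (hπ0 : π ≠ 0) :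
    Prime ((minpoly (WittVector p k) π : (WittVector p k)[X]) : S p k) := by
  obtain ⟨hdeg, hlow⟩ := natDegree_and_dvd_coeff_minpoly hπ hι hpe hπ0
  have hint : IsIntegral (WittVector p k) π := Algebra.IsIntegral.isIntegral π
  have hmon := minpoly.monic hint
  have hirr := minpoly.irreducible hint
  have hdist : (minpoly (WittVector p k) π).IsDistinguishedAt
      (Ideal.span {(p : WittVector p k)}) :=
    { mem := fun h => Ideal.mem_span_singleton.2 (hlow _ (hdeg ▸ h)), monic := hmon }
  have hdom : IsDomain ((WittVector p k)[X] ⧸ Ideal.span {minpoly (WittVector p k) π}) :=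
    (Ideal.Quotient.isDomain_iff_prime _).2
      ((Ideal.span_singleton_prime hmon.ne_zero).2 hirr.prime)
  have hadic := WittVector.isAdicCompleteIdealSpanP (p := p) (k := k)
  rw [← Ideal.span_singleton_prime (by simpa using hmon.ne_zero),
    ← Ideal.Quotient.isDomain_iff_prime]
  exact hdist.algEquivQuotient.symm.toMulEquiv.isDomain _

end Minpoly

end KisinHN

/-- `K` is a finite extension of `ℚ_p` with ring of integers `𝒪_K` (the integral closure of `ℤ_p`),
`π` is a uniformizer, and `k` is the residue field: `ι` is the canonical map `W(k) → 𝒪_K`, whose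
reduction `W(k) → 𝒪_K/π` is onto and hence identifies `k` with `𝒪_K/π`. -/
theorem mainTheorem10 (p : ℕ) [Fact p.Prime]
    (K : Type*) [Field K] [Algebra ℚ_[p] K] [Algebra ℤ_[p] K] [IsScalarTower ℤ_[p] ℚ_[p] K]
    [FiniteDimensional ℚ_[p] K]
    (k : Type*) [Field k] [CharP k p]
    (π : integralClosure ℤ_[p] K) (_hπ : (Ideal.span {π}).IsMaximal)
    (ι : WittVector p k →+* integralClosure ℤ_[p] K)
    (_hι : Function.Surjective ((Ideal.Quotient.mk (Ideal.span {π})).comp ι))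
    (M : KisinModule p k (Kisin.uniformizerPoly p k ι π)) (_hM : M.IsFlat) :
    ∃ N : KisinModule p k (Kisin.uniformizerPoly p k ι π),
      N.IsFlat ∧ N.IsTypeHN (Module.finrank ℚ_[p] K) ∧ M.Isogenous N := by
  have hπu : ¬ IsUnit π := fun h => _hπ.ne_top (Ideal.span_singleton_eq_top.2 h)
  have hcardA := KisinHN.card_integralClosure_quotient p K
  have hp1 : 1 < p := (Fact.out : p.Prime).one_lt
  have hdvd : π ∣ (p : integralClosure ℤ_[p] K) := by
    rw [← map_natCast ι, KisinHN.dvd_map_iff _hπ _hι, map_natCast, CharP.cast_eq_zero]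
  have hp0 : (p : integralClosure ℤ_[p] K) ≠ 0 := by
    intro h
    have := congrArg (algebraMap (integralClosure ℤ_[p] K) K) h
    rw [map_natCast, map_zero, ← map_natCast (algebraMap ℚ_[p] K), map_eq_zero,
      Nat.cast_eq_zero] at this
    omega
  have hπ0 : π ≠ 0 := fun h => hp0 (zero_dvd_iff.1 (h ▸ hdvd))
  have hprime : Prime π := (Ideal.span_singleton_prime hπ0).1 _hπ.isPrime
  obtain ⟨e, hpe⟩ : ∃ e, Associated (p : integralClosure ℤ_[p] K) (π ^ e) := by
    obtain ⟨j, hj⟩ := KisinHN.exists_natCast_dvd_pow p K hπu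
    obtain ⟨e, -, he⟩ := (dvd_prime_pow hprime j).1 hj
    exact ⟨e, he⟩
  have he : 0 < e := by
    refine Nat.pos_of_ne_zero fun h0 => hπu ?_
    rw [h0, pow_zero] at hpe
    exact isUnit_of_dvd_one (hdvd.trans hpe.dvd)
  have hded := KisinHN.isDedekindDomain_integralClosure p K
  -- Both sides count the ring of integers modulo `p`, which generates the same ideal as `π ^ e`. It
  -- follows that `k` is finite, hence perfect, and that `[K : ℚ_p] = e * d` with `d` the residue
  -- degree.
  have hpow : p ^ Module.finrank ℚ_[p] K = Nat.card k ^ e := by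
    have := _hπ.isPrime
    rw [KisinHN.card_residueField _hπ _hι, ← cardQuot_pow_of_prime
      (by rwa [Ne, Ideal.span_singleton_eq_bot]), Ideal.span_singleton_pow, ← hcardA,
      Ideal.span_singleton_eq_span_singleton.2 hpe]
  have hfink : Finite k := by
    refine Nat.finite_of_card_ne_zero fun h => ?_
    rw [h, zero_pow he.ne'] at hpow
    exact (pow_pos (zero_lt_one.trans hp1) _).ne' hpow
  have : PerfectRing k p := PerfectRing.ofFiniteOfIsReduced p k
  obtain ⟨d, hd, hkd⟩ := KisinHN.exists_resDeg p k
  have hd0 : 0 < d := by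
    refine Nat.pos_of_ne_zero fun h => ?_
    rw [h, pow_zero] at hkd
    exact Finite.one_lt_card.ne' hkd
  have hn : Module.finrank ℚ_[p] K = e * d := by
    rw [hkd, ← pow_mul] at hpow
    exact (Nat.pow_right_injective hp1 hpow).trans (mul_comm _ _)
  have hfinA := KisinHN.finite_integralClosure p K
  let := ι.toAlgebra
  have hfinW : Module.Finite (WittVector p k) (integralClosure ℤ_[p] K) :=
    KisinHN.finite_of_finite_padicInt (ι := ι) fun h => hπu (isUnit_of_dvd_unit hdvd h)
  exact KisinHN.exists_isTypeHN (KisinHN.frobeniusDatum p k he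
    (KisinHN.dvd_coe_minpoly_sub _hπ _hι hpe hπ0) (KisinHN.prime_coe_minpoly _hπ _hι hpe hπ0))
    hd hd0 hn M _hM
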